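/- Conventions. In a tensor product of crystals, $e_i(b_2\otimes b_1)=e_i(b_2)\otimes b_1$ if $\varepsilon_i(b_2)>\varphi_i(b_1)$ and $b_2\otimes e_i(b_1)$ otherwise; $f_i(b_2\otimes b_1)=f_i(b_2)\otimes b_1$ if $\varepsilon_i(b_2)\ge\varphi_i(b_1)$ and $b_2\otimes f_i(b_1)$ otherwise. Let either (A) $\mathfrak g=A_n^{(1)}$, $n\ge 1$, and $B=B_k\otimes\dots\otimes B_1$ ($k\ge 0$) be any tensor product of crystals $B^{r,s}$ ($1\le r\le n$, $s\ge1$), where $B^{r,s}\cong B(s\Lambda_r)$ is the set of semistandard $r\times s$ rectangular tableaux with entries in $\{1,\dots,n+1\}$ with the classical crystal structure induced by the column reading (columns left to right, each read from bottom to top, read as a tensor product of letters); or (D) $\mathfrak g=D_n^{(1)}$, $n\ge 4$, and $B$ be any tensor product of crystals $B^s=B^{1,s}$ ($s\ge 1$), where $B^s\cong B(s\Lambda_1)$ is the set of rows $x_1\le\dots\le x_s$ in the partially ordered alphabet $1<\dots<n-1<n,\bar n<\overline{n-1}<\dots<\bar 1$ ($n,\bar n$ incomparable), read as $x_1\otimes\dots\otimes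 x_s$. Write $\bar I=\{1,\dots,n\}$, $(\alpha_a|\alpha_b)$ for the Cartan matrix of $A_n$ (resp. $D_n$), $\Lambda_a$ for the classical fundamental weights, $B^1=B^{1,1}$. For a dominant weight $\lambda$ let $P(B,\lambda)$ be the set of $b\in B$ of weight $\lambda$ with $\varepsilon_i(b)=0$ for all $i\in\bar I$. Let $L=(L_i^{(a)})$ be the multiplicity array of $B$: $L_i^{(a)}$ is the number of factors $B^{a,i}$. Rigged configurations. $\mathrm{RC}(L,\lambda)$ is the set of pairs $(\nu,J)$ where $\nu=(\nu^{(a)})_{a\in\bar I}$ is a sequence of partitions, $m_i^{(a)}$ is the number of parts $i$ of $\nu^{(a)}$, $\sum_{a,i} i\,m_i^{(a)}\alpha_a=\sum_{a,i} i\,L_i^{(a)}\Lambda_a-\lambda$, the vacancy numbers $p_i^{(a)}=\sum_j\min(i,j)L_j^{(a)}-\sum_{b}(\alpha_a|\alpha_b)\sum_j\min(i,j)m_j^{(b)}$ are $\ge 0$ for all $a\in\bar I$, $i\ge1$, and $J^{(a,i)}$ is a partition contained in an $m_i^{(a)}\times p_i^{(a)}$ rectangle, regarded as a multiset of $m_i^{(a)}$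 riggings in $[0,p_i^{(a)}]$ attached to the parts of length $i$ of $\nu^{(a)}$. A pair (part $i$ of $\nu^{(a)}$, rigging) is a string; it is singular if its rigging is $p_i^{(a)}$. Maps on paths. $\mathrm{lh}$ removes a left factor $B^1$; it maps $P(B^1\otimes B',\lambda)$ to $\bigcup_{\mu\in\lambda^-}P(B',\mu)$, where $\lambda^-$ is the set of dominant $\mu$ such that $B(\lambda)$ occurs in $B^1\otimes B(\mu)$. For $s\ge2$, $\mathrm{ls}:B^{r,s}\otimes B'\to B^{r,1}\otimes B^{r,s-1}\otimes B'$ splits off the leftmost column. In type A, for $r\ge2$, $\mathrm{lb}:B^{r,1}\otimes B'\to B^{1,1}\otimes B^{r-1,1}\otimes B'$ splits off the bottommost entry. Let $\mathrm{lh}(L),\mathrm{ls}(L),\mathrm{lb}(L)$ be the multiplicity arrays of the new tensor products. Maps on rigged configurations. $\bar j(\nu,J)=(\nu,J)$, viewed in $\mathrm{RC}(\mathrm{ls}(L),\lambda)$. $\bar i$ adds one singular string of length $1$ to $(\nu,J)^{(a)}$ for each $1\le a<r$. The map $\bar\delta$ is defined as follows. In type A put $\ell^{(0)}=1$ and for $a=1,\dots,n$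 let $\ell^{(a)}$ be the smallest $i\ge\ell^{(a-1)}$ such that $(\nu,J)^{(a)}$ has a singular string of length $i$ ($\infty$ if there is none). In type D define $\ell^{(a)}$ in this way for $a\le n-2$, let $\ell^{(n-1)}$ and $\ell^{(n)}$ be the smallest lengths $\ge\ell^{(n-2)}$ of singular strings in $(\nu,J)^{(n-1)}$ and $(\nu,J)^{(n)}$, put $\bar\ell^{(n-1)}=\max(\ell^{(n-1)},\ell^{(n)})$, and for $a=n-2,\dots,1$ let $\bar\ell^{(a)}$ be the smallest $i\ge\bar\ell^{(a+1)}$ such that $(\nu,J)^{(a)}$ has a singular string of length $i$, and at least two of them if $i=\ell^{(a)}$ (again $\infty$ if there is none). Then $\bar\delta(\nu,J)$ is obtained by removing one box from a singular string of length $\ell^{(a)}$ of $(\nu,J)^{(a)}$ for each $a$ with $\ell^{(a)}<\infty$, and in type D from a (further) singular string of length $\bar\ell^{(a)}$ for each $a\le n-2$ with $\bar\ell^{(a)}<\infty$, and making the shortened strings (if not empty) singular with respect to the new configuration and $\mathrm{lh}(L)$; all other strings are kept. Statement. In each of the cases (A) and (D) there is a unique family of bijections $\bar\phi:P(B,\lambda)\to\mathrm{RC}(L,\lambda)$,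 indexed by all such $B$ and all dominant $\lambda$, that sends the empty path to the empty rigged configuration and satisfies: 1. if $B=B^1\otimes B'$, then $\bar\phi\circ\mathrm{lh}=\bar\delta\circ\bar\phi$ as maps $P(B,\lambda)\to\bigcup_{\mu\in\lambda^-}\mathrm{RC}(\mathrm{lh}(L),\mu)$; 2. if $B=B^{r,s}\otimes B'$ with $s\ge2$ (and $r=1$ in type D), then $\bar\phi\circ\mathrm{ls}=\bar j\circ\bar\phi$ as maps $P(B,\lambda)\to\mathrm{RC}(\mathrm{ls}(L),\lambda)$; 3. in type A, if $B=B^{r,1}\otimes B'$ with $r\ge2$, then $\bar\phi\circ\mathrm{lb}=\bar i\circ\bar\phi$ as maps $P(B,\lambda)\to\mathrm{RC}(\mathrm{lb}(L),\lambda)$. -/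

import Mathlib

namespace PathRC

/-! ## Classical crystals -/

/-- The nodes `1, …, n` of the classical Dynkin diagram. -/
abbrev Node (n : ℕ) : Type := Finset.Icc 1 n

/-- A crystal graph with vertex set `X` and colours `I` in which all strings are finite directed
paths: `f i b = some b'` means that there is an `i`-arrow from `b` to `b'`, and `none` is the
symbol `∅`. The laws force `eps i b` and `phi i b` to be the number of `i`-arrows from the
beginning of the `i`-string to `b`, and from `b` to its end. -/
structure Crystal (I X : Type) where
  e : I → X → Option X
  f : I → X → Option X
  eps : I → X → ℕ
  phi : I → X → ℕ
  e_iff_f : ∀ i x y, e i y = some x ↔ f i x = some y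
  eps_of_none : ∀ i x, e i x = none → eps i x = 0
  eps_of_some : ∀ i x y, e i x = some y → eps i x = eps i y + 1
  phi_of_none : ∀ i x, f i x = none → phi i x = 0
  phi_of_some : ∀ i x y, f i x = some y → phi i x = phi i y + 1

namespace Crystal

variable {I X : Type}

/-- The weight of `x`, written in the basis of classical fundamental weights: its `i`-th coordinate
is `⟨h_i, wt x⟩ = φ_i(x) - ε_i(x)`. -/
def wt (C : Crystal I X) (x : X) (i : I) : ℤ := (C.phi i x : ℤ) - C.eps i x

/-- The pair `(ε_i, φ_i)` on the word `x₁ x₂ … x_k`, seen as `x₁ ⊗ x₂ ⊗ ⋯ ⊗ x_k`. -/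
def wordStr (C : Crystal I X) (i : I) : List X → ℕ × ℕ
  | [] => (0, 0)
  | x :: w =>
    ((C.wordStr i w).1 + (C.eps i x - (C.wordStr i w).2),
      C.phi i x + ((C.wordStr i w).2 - C.eps i x))

/-- The operator `e_i` on words, by the tensor product rule
`e_i(b₂ ⊗ b₁) = e_i(b₂) ⊗ b₁` if `ε_i(b₂) > φ_i(b₁)`, and `b₂ ⊗ e_i(b₁)` otherwise. -/
def wordE (C : Crystal I X) (i : I) : List X → Option (List X)
  | [] => none
  | x :: w =>
    if (C.wordStr i w).2 < C.eps i x then (C.e i x).map (fun y => y :: w)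
    else (C.wordE i w).map (fun v => x :: v)

/-- The operator `f_i` on words, by the tensor product rule
`f_i(b₂ ⊗ b₁) = f_i(b₂) ⊗ b₁` if `ε_i(b₂) ≥ φ_i(b₁)`, and `b₂ ⊗ f_i(b₁)` otherwise. -/
def wordF (C : Crystal I X) (i : I) : List X → Option (List X)
  | [] => none
  | x :: w =>
    if (C.wordStr i w).2 ≤ C.eps i x then (C.f i x).map (fun y => y :: w)
    else (C.wordF i w).map (fun v => x :: v)

theorem word_eps_none (C : Crystal I X) (i : I) :
    ∀ w, C.wordE i w = none → (C.wordStr i w).1 = 0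
  | [], _ => rfl
  | x :: w, h => by
    have ih := word_eps_none C i w
    have h1 := C.eps_of_none i x
    simp only [wordE] at h
    simp only [wordStr]
    split_ifs at h with hc
    · rw [Option.map_eq_none_iff] at h
      have := h1 h
      omega
    · rw [Option.map_eq_none_iff] at h
      have := ih h
      omega

theorem word_phi_none (C : Crystal I X) (i : I) :
    ∀ w, C.wordF i w = none → (C.wordStr i w).2 = 0
  | [], _ => rfl
  | x :: w, h => by
    have ih := word_phi_none C i w
    have h1 := C.phi_of_none i x
    simp only [wordF] at h
    simp only [wordStr]
    split_ifs at h with hc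
    · rw [Option.map_eq_none_iff] at h
      have := h1 h
      omega
    · rw [Option.map_eq_none_iff] at h
      have := ih h
      omega

/-- An arrow of words moves both string statistics by one. -/
theorem wordF_str (C : Crystal I X) (i : I) :
    ∀ w v, C.wordF i w = some v →
      (C.wordStr i w).2 = (C.wordStr i v).2 + 1 ∧ (C.wordStr i v).1 = (C.wordStr i w).1 + 1
  | [], _, h => by simp [wordF] at h
  | x :: w, v, h => by
    have ih := wordF_str C i w
    simp only [wordF] at h
    split_ifs at h with hc
    · obtain ⟨y, hy, rfl⟩ := Option.map_eq_some_iff.1 h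
      have h1 := C.phi_of_some i x y hy
      have h2 := C.eps_of_some i y x ((C.e_iff_f i x y).2 hy)
      simp only [wordStr]
      omega
    · obtain ⟨u, hu, rfl⟩ := Option.map_eq_some_iff.1 h
      have h1 := ih u hu
      simp only [wordStr]
      omega

theorem wordE_of_wordF (C : Crystal I X) (i : I) :
    ∀ w v, C.wordF i w = some v → C.wordE i v = some w
  | [], _, h => by simp [wordF] at h
  | x :: w, v, h => by
    have ih := wordE_of_wordF C i w
    simp only [wordF] at h
    split_ifs at h with hc
    · obtain ⟨y, hy, rfl⟩ := Option.map_eq_some_iff.1 h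
      have hy' := (C.e_iff_f i x y).2 hy
      have h2 := C.eps_of_some i y x hy'
      simp only [wordE]
      rw [if_pos (by omega), hy']
      rfl
    · obtain ⟨u, hu, rfl⟩ := Option.map_eq_some_iff.1 h
      have h1 := wordF_str C i w u hu
      simp only [wordE]
      rw [if_neg (by omega), ih u hu]
      rfl

theorem wordF_of_wordE (C : Crystal I X) (i : I) :
    ∀ w v, C.wordE i w = some v → C.wordF i v = some w
  | [], _, h => by simp [wordE] at h
  | x :: w, v, h => by
    have ih := wordF_of_wordE C i w
    simp only [wordE] at h
    split_ifs at h with hc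
    · obtain ⟨y, hy, rfl⟩ := Option.map_eq_some_iff.1 h
      have hy' := (C.e_iff_f i y x).1 hy
      have h2 := C.eps_of_some i x y hy
      simp only [wordF]
      rw [if_pos (by omega), hy']
      rfl
    · obtain ⟨u, hu, rfl⟩ := Option.map_eq_some_iff.1 h
      have h1 := wordF_str C i u w (ih u hu)
      simp only [wordF]
      rw [if_neg (by omega), ih u hu]
      rfl

/-- The disjoint union of all tensor powers of `C`: the word `x₁ x₂ … x_k` is the element
`x₁ ⊗ x₂ ⊗ ⋯ ⊗ x_k`. -/
def words (C : Crystal I X) : Crystal I (List X) where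
  e := C.wordE
  f := C.wordF
  eps i w := (C.wordStr i w).1
  phi i w := (C.wordStr i w).2
  e_iff_f i x y := ⟨C.wordF_of_wordE i y x, C.wordE_of_wordF i x y⟩
  eps_of_none := C.word_eps_none
  eps_of_some i x y h := (C.wordF_str i y x (C.wordF_of_wordE i x y h)).2
  phi_of_none := C.word_phi_none
  phi_of_some i x y h := (C.wordF_str i x y h).1

end Crystal

/-! ## Paths

Here `K` is the set of labels of the allowed tensor factors, `E k` is the set of elements of the
factor labelled `k`, and `read k : E k → List X` is the reading that embeds `E k` into a tensor
power of the crystal `C` of letters. The classical crystal structure on a tensor product of such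
factors is the one that makes the concatenated reading an embedding of crystals. -/

section Paths

variable {I X K : Type} {E : K → Type}

/-- The underlying set of `B = B_L ⊗ ⋯ ⊗ B₁`; the head of the list is the leftmost factor `B_L`. -/
def Path (E : K → Type) : List K → Type
  | [] => Unit
  | k :: B => E k × Path E B

/-- The element of the tensor power of the crystal of letters that is given by `b_L ⊗ ⋯ ⊗ b₁`. -/
def Path.word (read : ∀ k, E k → List X) : (B : List K) → Path E B → List X
  | [], _ => []
  | k :: B, b => read k b.1 ++ Path.word read B b.2

/-- The set `P(B, λ)` of classical highest weight vectors of weight `λ = ∑ λ_i Λ_i` in `B`. -/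
def HW (C : Crystal I X) (read : ∀ k, E k → List X) (B : List K) (lam : I → ℕ) : Type :=
  {b : Path E B // (∀ i, C.words.eps i (b.word read B) = 0) ∧
    ∀ i, C.words.wt (b.word read B) i = lam i}

/-- The empty path. -/
def HW.empty (C : Crystal I X) (read : ∀ k, E k → List X) : HW C read [] (fun _ => 0) :=
  ⟨(), fun _ => rfl, fun _ => rfl⟩

/-- The set `λ⁻` of dominant weights `μ` such that `B(λ)` occurs in `B¹ ⊗ B(μ)`, where `C` is the
crystal `B¹` of letters. The highest weight vectors of `B¹ ⊗ B(μ)` are the `x ⊗ u_μ` with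
`ε_i(x) ≤ φ_i(u_μ) = ⟨h_i, μ⟩` for all `i`. -/
def lamMinus (C : Crystal I X) (lam : I → ℕ) : Set (I → ℕ) :=
  {mu | ∃ x : X, (∀ i, C.eps i x ≤ mu i) ∧ ∀ i, (mu i : ℤ) + C.wt x i = lam i}

/-- The map `lh : P(B¹ ⊗ B', λ) → ⋃_{μ ∈ λ⁻} P(B', μ)` that removes the leftmost factor. -/
def HW.lh (C : Crystal I X) (read : ∀ k, E k → List X) (k : K) (B : List K) (lam : I → ℕ)
    (hk : ∀ T : E k, ∃ x, read k T = [x]) (b : HW C read (k :: B) lam) :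
    (mu : lamMinus C lam) × HW C read B mu.1 :=
  ⟨⟨fun i => C.words.phi i (Path.word read B b.1.2), by
      obtain ⟨⟨T, b'⟩, h1, h2⟩ := b
      obtain ⟨x, hx⟩ := hk T
      refine ⟨x, fun i => ?_, fun i => ?_⟩
      · have := h1 i
        simp only [Path.word, hx, List.cons_append, List.nil_append, Crystal.words,
          Crystal.wordStr] at this ⊢
        omega
      · have := h1 i
        have h := h2 i
        simp only [Path.word, hx, List.cons_append, List.nil_append, Crystal.words,
          Crystal.wordStr, Crystal.wt] at this h ⊢
        omega⟩,
    ⟨b.1.2, by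
      obtain ⟨⟨T, b'⟩, h1, h2⟩ := b
      obtain ⟨x, hx⟩ := hk T
      have key : ∀ i, C.words.eps i (Path.word read B b') = 0 := by
        intro i
        have := h1 i
        simp only [Path.word, hx, List.cons_append, List.nil_append, Crystal.words,
          Crystal.wordStr] at this ⊢
        omega
      exact ⟨key, fun i => by simp [Crystal.wt, key i]⟩⟩⟩

/-- The map `P(B_k ⊗ B', λ) → P(B_{k₁} ⊗ B_{k₂} ⊗ B', λ)` that is induced by a map
`split : B_k → B_{k₁} ⊗ B_{k₂}` compatible with the readings. -/
def HW.split (C : Crystal I X) (read : ∀ k, E k → List X) {k k₁ k₂ : K} (s : E k → E k₁ × E k₂)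
    (hs : ∀ T, read k T = read k₁ (s T).1 ++ read k₂ (s T).2) (B : List K) (lam : I → ℕ)
    (b : HW C read (k :: B) lam) : HW C read (k₁ :: k₂ :: B) lam :=
  ⟨((s b.1.1).1, (s b.1.1).2, b.1.2), by
    have h : Path.word read (k₁ :: k₂ :: B) ((s b.1.1).1, (s b.1.1).2, b.1.2) =
        Path.word read (k :: B) b.1 := by
      simp [Path.word, hs]
    rw [h]
    exact b.2⟩

end Paths

/-! ## Rigged configurations -/

section RC

variable {I : Type} [Fintype I]

/-- The data of a rigged configuration: for each node `a` the multiset of strings `(i, x)` of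
`(ν, J)^{(a)}`, where `i` is a part of `ν^{(a)}` and `x` is its rigging, a part of `J^{(a,i)}`. -/
abbrev Rigged (I : Type) : Type := I → Multiset (ℕ × ℤ)

/-- The underlying sequence of partitions `ν`. -/
def Rigged.shape (nu : Rigged I) : I → Multiset ℕ := fun a => (nu a).map Prod.fst

/-- The vacancy number `p_i^{(a)}`. The matrix `A` is the Cartan matrix, `L a` is the multiset in
which `i` has multiplicity `L_i^{(a)}`, and `sh a` is the multiset of parts of `ν^{(a)}`. -/
def vacancy (A : I → I → ℤ) (L sh : I → Multiset ℕ) (a : I) (i : ℕ) : ℤ :=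
  (((L a).map fun j => min i j).sum : ℤ) - ∑ b, A a b * (((sh b).map fun j => min i j).sum : ℤ)

/-- The set `RC(L, λ)`. The equality of weights
`∑ i m_i^{(a)} α_a = ∑ i L_i^{(a)} Λ_a - λ` is written in the basis of fundamental weights. -/
structure IsRC (A : I → I → ℤ) (L : I → Multiset ℕ) (lam : I → ℕ) (nu : Rigged I) : Prop where
  length_pos : ∀ a, ∀ s ∈ nu a, 1 ≤ s.1
  weight : ∀ b, ∑ a, ((nu.shape a).sum : ℤ) * A b a = ((L b).sum : ℤ) - lam b
  admissible : ∀ a i, 1 ≤ i → 0 ≤ vacancy A L nu.shape a i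
  rigging : ∀ a, ∀ s ∈ nu a, 0 ≤ s.2 ∧ s.2 ≤ vacancy A L nu.shape a s.1

/-- The set `RC(L, λ)` as a type. -/
def RC (A : I → I → ℤ) (L : I → Multiset ℕ) (lam : I → ℕ) : Type :=
  {nu : Rigged I // IsRC A L lam nu}

/-- Decrease each number by one and drop zeros. -/
def decrement (s : Multiset ℕ) : Multiset ℕ := (s.map fun i => i - 1).filter fun i => 0 < i

/-- Remove a box from one singular string of length `i` of `(ν, J)^{(a)}` for each `i` in `sel a`
(with multiplicity), and make the shortened strings singular for the multiplicity array `L'`. -/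
def removeBoxes (A : I → I → ℤ) (L L' : I → Multiset ℕ) (nu : Rigged I) (sel : I → Multiset ℕ) :
    Rigged I := fun a =>
  nu a - (sel a).map (fun i => (i, vacancy A L nu.shape a i)) +
    (decrement (sel a)).map fun i =>
      (i, vacancy A L' (fun b => nu.shape b - sel b + decrement (sel b)) a i)

/-- The map `j̄`, which does not change the rigged configuration. -/
def jBar (nu : Rigged I) : Rigged I := nu

end RC

section Delta

variable {n : ℕ}

/-- The array obtained from `L` by decreasing `L_1^{(1)}` by one. -/
def lhArray (L : Node n → Multiset ℕ) : Node n → Multiset ℕ :=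
  fun a => if a.1 = 1 then (L a).erase 1 else L a

/-- The number of singular strings of length `i` in `(ν, J)^{(a)}`, that is, the number of parts
of size `p_i^{(a)}` of `J^{(a,i)}`. -/
def singCount (A : Node n → Node n → ℤ) (L : Node n → Multiset ℕ) (nu : Rigged (Node n))
    (a i : ℕ) : ℕ :=
  if h : a ∈ Finset.Icc 1 n then (nu ⟨a, h⟩).count (i, vacancy A L nu.shape ⟨a, h⟩ i) else 0

/-- The smallest natural number `i ≥ m` with property `p`, and `∞` if there is none. -/
noncomputable def leastFrom (m : ℕ∞) (p : ℕ → Prop) : ℕ∞ :=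
  sInf ((fun i : ℕ => (i : ℕ∞)) '' {i | m ≤ i ∧ p i})

/-- The multiset `{x}` if `x` is finite, and the empty multiset if `x = ∞`. -/
def finiteIndex (x : ℕ∞) : Multiset ℕ := if x = ⊤ then 0 else {x.toNat}

/-- The selected lengths `ℓ^{(a)}` along a linear diagram, with `ℓ^{(0)} = 1`. Once no string can
be selected, all later values are `∞`. -/
noncomputable def ell (A : Node n → Node n → ℤ) (L : Node n → Multiset ℕ) (nu : Rigged (Node n)) :
    ℕ → ℕ∞
  | 0 => 1
  | a + 1 => leastFrom (ell A L nu a) fun i => 1 ≤ singCount A L nu (a + 1) i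

/-- The selected lengths `ℓ^{(a)}` for `D_n`: both of `ℓ^{(n-1)}`, `ℓ^{(n)}` start from
`ℓ^{(n-2)}`. -/
noncomputable def ellD (A : Node n → Node n → ℤ) (L : Node n → Multiset ℕ) (nu : Rigged (Node n))
    (a : ℕ) : ℕ∞ :=
  if a = n then leastFrom (ell A L nu (n - 2)) fun i => 1 ≤ singCount A L nu n i
  else ell A L nu a

/-- `ellBarAux k` is `ℓ̄^{(n-1-k)}` for `D_n`: it is `max(ℓ^{(n-1)}, ℓ^{(n)})` for `k = 0`, and
then one goes down along `a = n-2, n-3, …, 1`; a string of length `ℓ^{(a)}` may be chosen only if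
there are two singular strings of that length. -/
noncomputable def ellBarAux (A : Node n → Node n → ℤ) (L : Node n → Multiset ℕ)
    (nu : Rigged (Node n)) : ℕ → ℕ∞
  | 0 => max (ellD A L nu (n - 1)) (ellD A L nu n)
  | k + 1 => leastFrom (ellBarAux A L nu k) fun i =>
      (if (i : ℕ∞) = ellD A L nu (n - 1 - (k + 1)) then 2 else 1) ≤
        singCount A L nu (n - 1 - (k + 1)) i

/-- The map `δ̄` in type `A_n^{(1)}`. -/
noncomputable def deltaA (A : Node n → Node n → ℤ) (L : Node n → Multiset ℕ)
    (nu : Rigged (Node n)) : Rigged (Node n) :=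
  removeBoxes A L (lhArray L) nu fun a => finiteIndex (ell A L nu a)

/-- The map `δ̄` in type `D_n^{(1)}`. -/
noncomputable def deltaD (A : Node n → Node n → ℤ) (L : Node n → Multiset ℕ)
    (nu : Rigged (Node n)) : Rigged (Node n) :=
  removeBoxes A L (lhArray L) nu fun a =>
    finiteIndex (ellD A L nu a) +
      if a.1 ≤ n - 2 then finiteIndex (ellBarAux A L nu (n - 1 - a.1)) else 0

/-- The map `ī` for a factor `B^{r,1}`: add a singular string of length one to `(ν, J)^{(a)}` for
`1 ≤ a < r`. Here `L'` is the multiplicity array in which `B^{r,1}` has been replaced by `B^{1,1}`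
and `B^{r-1,1}`. -/
def iBar (A : Node n → Node n → ℤ) (L' : Node n → Multiset ℕ) (r : ℕ) (nu : Rigged (Node n)) :
    Rigged (Node n) := fun a =>
  if a.1 < r then
    (1, vacancy A L' (fun b => if b.1 < r then 1 ::ₘ nu.shape b else nu.shape b) a 1) ::ₘ nu a
  else nu a

end Delta

/-! ## Type `A_n^{(1)}`: tensor products of the `B^{r,s}` -/

namespace TypeA

/-- The Cartan matrix of type `A_n`. -/
def cartan (n : ℕ) (a b : Node n) : ℤ :=
  if a = b then 2 else if a.1 + 1 = b.1 ∨ b.1 + 1 = a.1 then -1 else 0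

/-- The crystal `B(Λ₁)` of type `A_n` on the letters `1, …, n + 1`: the `i`-arrow is `i → i + 1`. -/
def letters (n : ℕ) : Crystal (Node n) (Node (n + 1)) where
  e i x := if x.1 = i.1 + 1 then
      some ⟨i.1, Finset.mem_Icc.2 (by have := Finset.mem_Icc.1 i.2; omega)⟩ else none
  f i x := if x.1 = i.1 then
      some ⟨i.1 + 1, Finset.mem_Icc.2 (by have := Finset.mem_Icc.1 i.2; omega)⟩ else none
  eps i x := if x.1 = i.1 + 1 then 1 else 0
  phi i x := if x.1 = i.1 then 1 else 0
  e_iff_f i x y := by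
    have h : ∀ {u v : ℕ} (hu : u ∈ Finset.Icc 1 (n + 1)) (hv : v ∈ Finset.Icc 1 (n + 1)),
      (⟨u, hu⟩ : Node (n + 1)) = ⟨v, hv⟩ ↔ u = v := fun _ _ => Subtype.mk_eq_mk
    obtain ⟨x, hx⟩ := x
    obtain ⟨y, hy⟩ := y
    dsimp only
    split_ifs <;> simp only [Option.some.injEq, h, iff_false, false_iff] <;> omega
  eps_of_none i x h := by split_ifs at h ⊢; rfl
  eps_of_some i x y h := by
    split_ifs at h with hx
    simp only [Option.some.injEq] at h
    subst h
    simp [hx]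
  phi_of_none i x h := by split_ifs at h ⊢; rfl
  phi_of_some i x y h := by
    split_ifs at h with hx
    simp only [Option.some.injEq] at h
    subst h
    simp [hx]

/-- The labels `(r, s)` of the crystals `B^{r,s}`, with `1 ≤ r ≤ n` and `s ≥ 1`. -/
structure Index (n : ℕ) where
  r : ℕ
  s : ℕ
  one_le_r : 1 ≤ r
  r_le : r ≤ n
  one_le_s : 1 ≤ s

/-- Semistandard tableaux of shape an `r × s` rectangle with entries in `1, …, n + 1`; the entry in
row `i` (from the top) and column `j` (from the left) is `T i j`. -/
def Tableau (n r s : ℕ) : Type :=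
  {T : Fin r → Fin s → Node (n + 1) // (∀ i, Monotone (T i)) ∧ ∀ j, StrictMono fun i => T i j}

/-- The elements of `B^{r,s}`. -/
def Elt (n : ℕ) (k : Index n) : Type := Tableau n k.r k.s

/-- The column reading of a tableau: columns from left to right, each from bottom to top. -/
def Tableau.read {n r s : ℕ} (T : Tableau n r s) : List (Node (n + 1)) :=
  (List.ofFn fun j : Fin s => List.ofFn fun i : Fin r => T.1 i.rev j).flatten

/-- The reading of an element of `B^{r,s}`, which embeds `B^{r,s} ≅ B(sΛ_r)` into a tensor power of
the crystal of letters. -/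
def read (n : ℕ) (k : Index n) (T : Elt n k) : List (Node (n + 1)) := Tableau.read T

/-- The map `ls : B^{r,s+1} → B^{r,1} ⊗ B^{r,s}` that splits off the leftmost column. -/
def Tableau.ls {n r s : ℕ} (T : Tableau n r (s + 1)) : Tableau n r 1 × Tableau n r s :=
  (⟨fun i _ => T.1 i 0, fun _ _ _ _ => le_rfl, fun _ => T.2.2 0⟩,
    ⟨fun i j => T.1 i j.succ, fun i _ _ h => T.2.1 i (Fin.succ_le_succ_iff.2 h),
      fun j => T.2.2 j.succ⟩)

/-- The map `lb : B^{r+1,1} → B^{1,1} ⊗ B^{r,1}` that splits off the bottommost entry. -/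
def Tableau.lb {n r : ℕ} (T : Tableau n (r + 1) 1) : Tableau n 1 1 × Tableau n r 1 :=
  (⟨fun _ _ => T.1 (Fin.last r) 0, fun _ _ _ _ => le_rfl,
      fun _ i j h => absurd h (by simp [Subsingleton.elim i j])⟩,
    ⟨fun i _ => T.1 i.castSucc 0, fun _ _ _ _ => le_rfl,
      fun _ _ _ h => T.2.2 0 (Fin.castSucc_lt_castSucc_iff.2 h)⟩)

theorem Tableau.read_ls {n r s : ℕ} (T : Tableau n r (s + 1)) :
    T.read = T.ls.1.read ++ T.ls.2.read := by
  simp [Tableau.read, Tableau.ls]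

theorem Tableau.read_lb {n r : ℕ} (T : Tableau n (r + 1) 1) :
    T.read = T.lb.1.read ++ T.lb.2.read := by
  simp [Tableau.read, Tableau.lb, Fin.rev_succ]

theorem Tableau.read_one {n : ℕ} (T : Tableau n 1 1) : T.read = [T.1 0 0] := by
  simp [Tableau.read]

/-- The multiplicity array `L` of `B`: the multiplicity of `i` in `mult B a` is the number of
factors `B^{a,i}` in `B`. -/
def mult {n : ℕ} (B : List (Index n)) (a : Node n) : Multiset ℕ :=
  ((B.filter fun k => k.r = a.1).map Index.s : List ℕ)

/-- The set `P(B, λ)` in type `A_n^{(1)}`. -/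
abbrev P (n : ℕ) (B : List (Index n)) (lam : Node n → ℕ) : Type := HW (letters n) (read n) B lam

/-- The set `RC(L, λ)` in type `A_n^{(1)}`, where `L` is the multiplicity array of `B`. -/
abbrev RCs (n : ℕ) (B : List (Index n)) (lam : Node n → ℕ) : Type := RC (cartan n) (mult B) lam

/-- The left hat map on `P(B^{1,1} ⊗ B', λ)`. -/
def lh {n : ℕ} (hn : 1 ≤ n) (B' : List (Index n)) (lam : Node n → ℕ)
    (b : P n (⟨1, 1, le_rfl, hn, le_rfl⟩ :: B') lam) :
    (mu : lamMinus (letters n) lam) × P n B' mu.1 :=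
  HW.lh (letters n) (read n) ⟨1, 1, le_rfl, hn, le_rfl⟩ B' lam
    (fun T => ⟨_, Tableau.read_one (n := n) T⟩) b

/-- Left splitting `P(B^{r,s+1} ⊗ B', λ) → P(B^{r,1} ⊗ B^{r,s} ⊗ B', λ)`, where `s ≥ 1`. -/
def ls {n r s : ℕ} (h1 : 1 ≤ r) (hr : r ≤ n) (hs : 1 ≤ s) (B' : List (Index n)) (lam : Node n → ℕ)
    (b : P n (⟨r, s + 1, h1, hr, Nat.le_add_left 1 s⟩ :: B') lam) :
    P n (⟨r, 1, h1, hr, le_rfl⟩ :: ⟨r, s, h1, hr, hs⟩ :: B') lam :=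
  HW.split (letters n) (read n) (k := ⟨r, s + 1, h1, hr, Nat.le_add_left 1 s⟩)
    (k₁ := ⟨r, 1, h1, hr, le_rfl⟩) (k₂ := ⟨r, s, h1, hr, hs⟩) Tableau.ls Tableau.read_ls B' lam b

/-- Box splitting `P(B^{r+1,1} ⊗ B', λ) → P(B^{1,1} ⊗ B^{r,1} ⊗ B', λ)`, where `r ≥ 1`. -/
def lb {n r : ℕ} (h1 : 1 ≤ r) (hr : r + 1 ≤ n) (B' : List (Index n)) (lam : Node n → ℕ)
    (b : P n (⟨r + 1, 1, Nat.le_add_left 1 r, hr, le_rfl⟩ :: B') lam) :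
    P n (⟨1, 1, le_rfl, (Nat.le_add_left 1 r).trans hr, le_rfl⟩ ::
      ⟨r, 1, h1, (Nat.le_succ r).trans hr, le_rfl⟩ :: B') lam :=
  HW.split (letters n) (read n) (k := ⟨r + 1, 1, Nat.le_add_left 1 r, hr, le_rfl⟩)
    (k₁ := ⟨1, 1, le_rfl, (Nat.le_add_left 1 r).trans hr, le_rfl⟩)
    (k₂ := ⟨r, 1, h1, (Nat.le_succ r).trans hr, le_rfl⟩) Tableau.lb Tableau.read_lb B' lam b

/-- A family of bijections `φ̄ : P(B, λ) → RC(L, λ)` in type `A_n^{(1)}` with the required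
compatibilities. The equalities are equalities of rigged configurations for the target array. -/
structure IsBijectionFamily {n : ℕ} (hn : 1 ≤ n)
    (phi : ∀ (B : List (Index n)) (lam : Node n → ℕ), P n B lam → RCs n B lam) : Prop where
  bijective : ∀ B lam, Function.Bijective (phi B lam)
  empty : (phi [] (fun _ => 0) (HW.empty _ _)).1 = fun _ => 0
  left_hat : ∀ (B' : List (Index n)) (lam : Node n → ℕ)
    (b : P n (⟨1, 1, le_rfl, hn, le_rfl⟩ :: B') lam),
    (phi B' (lh hn B' lam b).1 (lh hn B' lam b).2).1 =
      deltaA (cartan n) (mult (⟨1, 1, le_rfl, hn, le_rfl⟩ :: B')) (phi _ lam b).1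
  left_split : ∀ (r s : ℕ) (h1 : 1 ≤ r) (hr : r ≤ n) (hs : 1 ≤ s) (B' : List (Index n))
    (lam : Node n → ℕ) (b : P n (⟨r, s + 1, h1, hr, Nat.le_add_left 1 s⟩ :: B') lam),
    (phi _ lam (ls h1 hr hs B' lam b)).1 = jBar (phi _ lam b).1
  box_split : ∀ (r : ℕ) (h1 : 1 ≤ r) (hr : r + 1 ≤ n) (B' : List (Index n)) (lam : Node n → ℕ)
    (b : P n (⟨r + 1, 1, Nat.le_add_left 1 r, hr, le_rfl⟩ :: B') lam),
    (phi _ lam (lb h1 hr B' lam b)).1 =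
      iBar (cartan n)
        (mult (⟨1, 1, le_rfl, hn, le_rfl⟩ :: ⟨r, 1, h1, (Nat.le_succ r).trans hr, le_rfl⟩ :: B'))
        (r + 1) (phi _ lam b).1

end TypeA

/-! ## Type `D_n^{(1)}`: tensor products of the `B^s = B^{1,s}` -/

namespace TypeD

/-- The Cartan matrix of type `D_n`: the nodes `n - 1` and `n` are both joined to `n - 2`. -/
def cartan (n : ℕ) (a b : Node n) : ℤ :=
  if a = b then 2
  else if (a.1 + 1 = b.1 ∧ b.1 < n) ∨ (b.1 + 1 = a.1 ∧ a.1 < n) ∨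
    (a.1 + 2 = n ∧ b.1 = n) ∨ (b.1 + 2 = n ∧ a.1 = n) then -1
  else 0

/-- The letters `1, …, n` and `n̄, …, 1̄`. -/
inductive Letter (n : ℕ) : Type
  | pos : Node n → Letter n
  | bar : Node n → Letter n

namespace Letter

variable {n : ℕ}

/-- The position of a letter; `n` and `n̄` have the same position. -/
def rank : Letter n → ℕ
  | pos k => k.1
  | bar k => 2 * n - k.1

/-- The partial order `1 < 2 < ⋯ < n - 1 < n, n̄ < (n-1)‾ < ⋯ < 1̄`, in which `n` and `n̄` are
incomparable. -/
def Le (x y : Letter n) : Prop := x = y ∨ x.rank < y.rank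

/-- The operator `f_i`. The arrows are `i → i + 1` and `(i+1)‾ → i‾` for `i < n`, and
`n - 1 → n̄` and `n → (n-1)‾` for `i = n`. -/
def f (hn : 4 ≤ n) (i : Node n) : Letter n → Option (Letter n)
  | pos k =>
    if h : k.1 = i.1 ∧ i.1 < n then some (pos ⟨i.1 + 1, Finset.mem_Icc.2 (by omega)⟩)
    else if i.1 = n ∧ k.1 + 1 = n then some (bar i)
    else if i.1 = n ∧ k.1 = n then some (bar ⟨n - 1, Finset.mem_Icc.2 (by omega)⟩)
    else none
  | bar k => if k.1 = i.1 + 1 then some (bar i) else none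

/-- The operator `e_i`. -/
def e (hn : 4 ≤ n) (i : Node n) : Letter n → Option (Letter n)
  | pos k => if k.1 = i.1 + 1 then some (pos i) else none
  | bar k =>
    if h : k.1 = i.1 ∧ i.1 < n then some (bar ⟨i.1 + 1, Finset.mem_Icc.2 (by omega)⟩)
    else if i.1 = n ∧ k.1 = n then some (pos ⟨n - 1, Finset.mem_Icc.2 (by omega)⟩)
    else if i.1 = n ∧ k.1 + 1 = n then some (pos i)
    else none

end Letter

/-- The crystal `B(Λ₁)` of type `D_n`. -/
def letters (n : ℕ) (hn : 4 ≤ n) : Crystal (Node n) (Letter n) where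
  e := Letter.e hn
  f := Letter.f hn
  eps i x := if (Letter.e hn i x).isSome then 1 else 0
  phi i x := if (Letter.f hn i x).isSome then 1 else 0
  e_iff_f i x y := by
    obtain ⟨i, hi⟩ := i
    have hi' := Finset.mem_Icc.1 hi
    rcases x with ⟨x, hx⟩ | ⟨x, hx⟩ <;> rcases y with ⟨y, hy⟩ | ⟨y, hy⟩ <;>
      have hx' := Finset.mem_Icc.1 hx <;> have hy' := Finset.mem_Icc.1 hy <;>
      simp only [Letter.e, Letter.f] <;> split_ifs <;>
      simp only [Option.some.injEq, Letter.pos.injEq, Letter.bar.injEq, Subtype.mk.injEq,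
        reduceCtorEq, iff_false, false_iff] <;> omega
  eps_of_none i x h := by simp [h]
  eps_of_some i x y h := by
    have : Letter.e hn i y = none := by
      obtain ⟨i, hi⟩ := i
      have hi' := Finset.mem_Icc.1 hi
      rcases x with ⟨x, hx⟩ | ⟨x, hx⟩ <;> rcases y with ⟨y, hy⟩ | ⟨y, hy⟩ <;>
        have hx' := Finset.mem_Icc.1 hx <;> have hy' := Finset.mem_Icc.1 hy <;>
        simp only [Letter.e] at h ⊢ <;> split_ifs at h ⊢ <;>
        simp only [Option.some.injEq, Letter.pos.injEq, Letter.bar.injEq, Subtype.mk.injEq,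
          reduceCtorEq] at h ⊢ <;> omega
    simp [h, this]
  phi_of_none i x h := by simp [h]
  phi_of_some i x y h := by
    have : Letter.f hn i y = none := by
      obtain ⟨i, hi⟩ := i
      have hi' := Finset.mem_Icc.1 hi
      rcases x with ⟨x, hx⟩ | ⟨x, hx⟩ <;> rcases y with ⟨y, hy⟩ | ⟨y, hy⟩ <;>
        have hx' := Finset.mem_Icc.1 hx <;> have hy' := Finset.mem_Icc.1 hy <;>
        simp only [Letter.f] at h ⊢ <;> split_ifs at h ⊢ <;>
        simp only [Option.some.injEq, Letter.pos.injEq, Letter.bar.injEq, Subtype.mk.injEq,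
          reduceCtorEq] at h ⊢ <;> omega
    simp [h, this]

/-- The labels `s ≥ 1` of the crystals `B^s`. -/
structure Index where
  s : ℕ
  one_le_s : 1 ≤ s

/-- The one-row tableaux `x₁ ≤ x₂ ≤ ⋯ ≤ x_s`; in particular `n` and `n̄` do not both occur. -/
def Row (n s : ℕ) : Type := {w : Fin s → Letter n // ∀ i j, i < j → (w i).Le (w j)}

/-- The elements of `B^s`. -/
def Elt (n : ℕ) (k : Index) : Type := Row n k.s

/-- The reading `x₁ x₂ … x_s` of a row. -/
def Row.read {n s : ℕ} (w : Row n s) : List (Letter n) := List.ofFn w.1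

/-- The reading of an element of `B^s`, which embeds `B^s ≅ B(sΛ₁)` into a tensor power of the
crystal of letters. -/
def read (n : ℕ) (k : Index) (w : Elt n k) : List (Letter n) := Row.read w

/-- The map `ls : B^{s+1} → B^1 ⊗ B^s` that splits off the leftmost letter. -/
def Row.ls {n s : ℕ} (w : Row n (s + 1)) : Row n 1 × Row n s :=
  (⟨fun _ => w.1 0, fun i j h => absurd h (by simp [Subsingleton.elim i j])⟩,
    ⟨fun j => w.1 j.succ, fun _ _ h => w.2 _ _ (Fin.succ_lt_succ_iff.2 h)⟩)

theorem Row.read_ls {n s : ℕ} (w : Row n (s + 1)) : w.read = w.ls.1.read ++ w.ls.2.read := by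
  simp [Row.read, Row.ls, List.ofFn_succ]

theorem Row.read_one {n : ℕ} (w : Row n 1) : w.read = [w.1 0] := by
  simp [Row.read]

/-- The multiplicity array `L` of `B`: the multiplicity of `i` in `mult n B 1` is the number of
factors `B^i` in `B`, and the other entries are empty. -/
def mult (n : ℕ) (B : List Index) (a : Node n) : Multiset ℕ :=
  if a.1 = 1 then (B.map Index.s : List ℕ) else 0

/-- The set `P(B, λ)` in type `D_n^{(1)}`. -/
abbrev P {n : ℕ} (hn : 4 ≤ n) (B : List Index) (lam : Node n → ℕ) : Type :=
  HW (letters n hn) (read n) B lam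

/-- The set `RC(L, λ)` in type `D_n^{(1)}`, where `L` is the multiplicity array of `B`. -/
abbrev RCs (n : ℕ) (B : List Index) (lam : Node n → ℕ) : Type := RC (cartan n) (mult n B) lam

/-- The left hat map on `P(B^1 ⊗ B', λ)`. -/
def lh {n : ℕ} (hn : 4 ≤ n) (B' : List Index) (lam : Node n → ℕ)
    (b : P hn (⟨1, le_rfl⟩ :: B') lam) :
    (mu : lamMinus (letters n hn) lam) × P hn B' mu.1 :=
  HW.lh (letters n hn) (read n) ⟨1, le_rfl⟩ B' lam (fun w => ⟨_, Row.read_one (n := n) w⟩) b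

/-- Left splitting `P(B^{s+1} ⊗ B', λ) → P(B^1 ⊗ B^s ⊗ B', λ)`, where `s ≥ 1`. -/
def ls {n s : ℕ} (hn : 4 ≤ n) (hs : 1 ≤ s) (B' : List Index) (lam : Node n → ℕ)
    (b : P hn (⟨s + 1, Nat.le_add_left 1 s⟩ :: B') lam) :
    P hn (⟨1, le_rfl⟩ :: ⟨s, hs⟩ :: B') lam :=
  HW.split (letters n hn) (read n) (k := ⟨s + 1, Nat.le_add_left 1 s⟩) (k₁ := ⟨1, le_rfl⟩)
    (k₂ := ⟨s, hs⟩) Row.ls Row.read_ls B' lam b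

/-- A family of bijections `φ̄ : P(B, λ) → RC(L, λ)` in type `D_n^{(1)}` with the required
compatibilities. -/
structure IsBijectionFamily {n : ℕ} (hn : 4 ≤ n)
    (phi : ∀ (B : List Index) (lam : Node n → ℕ), P hn B lam → RCs n B lam) : Prop where
  bijective : ∀ B lam, Function.Bijective (phi B lam)
  empty : (phi [] (fun _ => 0) (HW.empty _ _)).1 = fun _ => 0
  left_hat : ∀ (B' : List Index) (lam : Node n → ℕ) (b : P hn (⟨1, le_rfl⟩ :: B') lam),
    (phi B' (lh hn B' lam b).1 (lh hn B' lam b).2).1 =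
      deltaD (cartan n) (mult n (⟨1, le_rfl⟩ :: B')) (phi _ lam b).1
  left_split : ∀ (s : ℕ) (hs : 1 ≤ s) (B' : List Index) (lam : Node n → ℕ)
    (b : P hn (⟨s + 1, Nat.le_add_left 1 s⟩ :: B') lam),
    (phi _ lam (ls hn hs B' lam b)).1 = jBar (phi _ lam b).1

end TypeD

end PathRC

namespace PathRC

/-! ## Truncated sums of multisets -/

/-! The three compatibilities reduce a tensor product to its leftmost letter: the splittings expose
a factor `B^1`, and the left hat removes it. They therefore define a relation `Rel` between paths
and rigged configurations by recursion, and the theorem amounts to two claims: `Rel` is the graph of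
a weight preserving bijection (`Good`), and every admissible family lies inside `Rel`. The induction
has two kinds of steps, `Good.hat` and `Good.split`.

Left hat. What `δ̄` forgets is exactly the letter `x` that records which selected lengths are
finite. So `δ̄` together with `x` must be a bijection onto the pairs of a configuration of weight
`μ` and a letter with `ε_a(x) ≤ μ_a` for all `a`, which is how highest weight vectors of `B^1 ⊗ B'`
arise from those of `B'`. The argument is local. At one node the lengths selected there and at the
neighbours form a chain `u ≤ l ≤ v ≤ v' ≤ l' ≤ u'` (`Selection`), and the vacancy numbers change by
`-1` on `[u, l)` and `[v', l')`, by `+1` on `[l, v)` and `[l', u')`, and by `0` elsewhere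
(`Selection.Ordered.gain_cases`). Only the intervals with `-1` are dangerous. There the minimal
choice of the selected strings leaves no singular string behind, and a convexity estimate for the
vacancy numbers makes them positive. Hence the result is a rigged configuration
(`IsMove.isRC_removal`). The inverse lengthens the last singular strings allowed by `x`; the
argument is mirrored with the two signs exchanged (`IsMove.isRC_addition`), and the condition on `ε`
supplies positivity on unbounded intervals.

Splittings. Both sides are injective, so only the images have to be matched. Splitting off a column
raises the vacancy numbers of node `r` by one at small lengths, so the image of `j̄` consists of the
configurations without short singular strings at `r` (`isRC_split_iff`); the image of `ī` consists
of those with singular strings of length one at the nodes below `r` (`exists_iBar_eq`). These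
conditions must be equivalent to weakly increasing rows and strictly increasing columns. Letters are
compared through finiteness of selected lengths, so two successive removals have to be compared. A
string shortened to length `i` by one removal is singular and available to the next, which pushes
the next selected lengths below the old ones; conversely, the gaps left by a removal contain no
singular strings, which lets the comparison run backwards from the infinite end. This gives
`le_iff_isRC` and `lt_iff_singCount` in type `A`, where whole columns are interlaced, and
`le_iff_isRC` in type `D`.

Uniqueness. The left hat condition also fixes the weight of the shortened path. Letters are
distinguished by their weights, so the removed letter is forced (`letter_eq`), and any family of
bijections with the compatibilities satisfies `Rel`. -/

/-- The number `∑ min(i, j)` of boxes in the first `i` columns. -/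
def trunc (s : Multiset ℕ) (i : ℕ) : ℤ := ((s.map fun j => min i j).sum : ℕ)

theorem vacancy_eq_trunc {I : Type} [Fintype I] (A : I → I → ℤ) (L sh : I → Multiset ℕ) (a : I)
    (i : ℕ) : vacancy A L sh a i = trunc (L a) i - ∑ b, A a b * trunc (sh b) i := by
  simp [vacancy, trunc]

@[simp] theorem trunc_zero (i : ℕ) : trunc 0 i = 0 := by simp [trunc]

theorem trunc_add (s t : Multiset ℕ) (i : ℕ) : trunc (s + t) i = trunc s i + trunc t i := by
  simp [trunc]

theorem trunc_cons (j : ℕ) (t : Multiset ℕ) (i : ℕ) : trunc (j ::ₘ t) i = min i j + trunc t i := by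
  simp [trunc]

theorem trunc_sub {s t : Multiset ℕ} (h : t ≤ s) (i : ℕ) :
    trunc (s - t) i = trunc s i - trunc t i := by
  have := trunc_add (s - t) t i
  rw [tsub_add_cancel_of_le h] at this
  omega

theorem decrement_cons (j : ℕ) (t : Multiset ℕ) :
    decrement (j ::ₘ t) = (if 2 ≤ j then {j - 1} else 0) + decrement t := by
  simp only [decrement, Multiset.map_cons, Multiset.filter_cons]
  congr 1
  split_ifs <;> first | rfl | omega

/-- Shortening a part `j` by one box changes `min(i, j)` exactly when `j ≤ i`. -/
theorem trunc_decrement {s : Multiset ℕ} (h : ∀ j ∈ s, 1 ≤ j) (i : ℕ) :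
    trunc (decrement s) i = trunc s i - s.countP (· ≤ i) := by
  induction s using Multiset.induction with
  | empty => simp [decrement]
  | cons j t ih =>
    have h1 : 1 ≤ j := h j (Multiset.mem_cons_self j t)
    rw [decrement_cons, trunc_add, ih fun k hk => h k (Multiset.mem_cons_of_mem hk), trunc_cons,
      Multiset.countP_cons]
    split_ifs <;> simp [trunc] <;> omega

theorem count_decrement (s : Multiset ℕ) {i : ℕ} (hi : 1 ≤ i) :
    (decrement s).count i = s.count (i + 1) := by
  induction s using Multiset.induction with
  | empty => simp [decrement]
  | cons j t ih =>
    rw [decrement_cons, Multiset.count_add, ih, Multiset.count_cons]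
    split_ifs <;> simp only [Multiset.count_singleton, Multiset.count_zero] <;>
      (try split_ifs) <;> omega

theorem pos_of_mem_decrement {s : Multiset ℕ} {i : ℕ} (h : i ∈ decrement s) : 1 ≤ i :=
  (Multiset.mem_filter.1 h).2

/-- As a function of `i`, `min(i, j)` is concave with a single corner, at `i = j`. All convexity
estimates for vacancy numbers come from this identity. -/
theorem trunc_second_difference (s : Multiset ℕ) (i : ℕ) :
    2 * trunc s (i + 1) - trunc s i - trunc s (i + 2) = s.count (i + 1) := by
  induction s using Multiset.induction with
  | empty => simp
  | cons j t ih =>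
    simp only [trunc_cons, Multiset.count_cons]
    by_cases h : i + 1 = j
    · rw [if_pos h]
      push_cast
      omega
    · rw [if_neg h]
      push_cast
      omega

theorem trunc_eq_sum {s : Multiset ℕ} {i : ℕ} (h : ∀ j ∈ s, j ≤ i) : trunc s i = (s.sum : ℕ) := by
  induction s using Multiset.induction with
  | empty => simp
  | cons j t ih =>
    rw [trunc_cons, ih fun k hk => h k (Multiset.mem_cons_of_mem hk), Multiset.sum_cons]
    have := h j (Multiset.mem_cons_self j t)
    push_cast
    omega

theorem countP_le_succ (s : Multiset ℕ) (i : ℕ) :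
    s.countP (· ≤ i + 1) = s.countP (· ≤ i) + s.count (i + 1) := by
  induction s using Multiset.induction with
  | empty => simp
  | cons j t ih =>
    rw [Multiset.countP_cons, Multiset.countP_cons, Multiset.count_cons, ih]
    split_ifs <;> omega

theorem exists_forall_le_bound {I : Type} [Fintype I] (s : I → Multiset ℕ) :
    ∃ N, ∀ a, ∀ j ∈ s a, j ≤ N := by
  refine ⟨∑ a, (s a).sum, fun a j hj => ?_⟩
  exact (Multiset.le_sum_of_mem hj).trans
    (Finset.single_le_sum (f := fun a => (s a).sum) (fun _ _ => Nat.zero_le _) (Finset.mem_univ a))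

theorem le_of_add_one_le_succ {t : ℕ∞} {i : ℕ} (h : t + 1 ≤ ((i + 1 : ℕ) : ℕ∞)) : t ≤ i := by
  push_cast at h
  exact (ENat.add_le_add_iff_right ENat.one_ne_top).1 h

/-- The indicator function of `{t}`. -/
noncomputable def hit (t : ℕ∞) (i : ℕ) : ℕ := if t = i then 1 else 0

theorem hit_of_eq {t : ℕ∞} {i : ℕ} (h : t = i) : hit t i = 1 := if_pos h

theorem hit_of_ne {t : ℕ∞} {i : ℕ} (h : t ≠ i) : hit t i = 0 := if_neg h

@[simp] theorem hit_top (i : ℕ) : hit ⊤ i = 0 := hit_of_ne (ENat.top_ne_natCast i)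

theorem hit_le_one (t : ℕ∞) (i : ℕ) : hit t i ≤ 1 := by
  unfold hit; split_ifs <;> omega

theorem count_finiteIndex (t : ℕ∞) (i : ℕ) : (finiteIndex t).count i = hit t i := by
  induction t using ENat.recTopCoe with
  | top => simp [finiteIndex]
  | coe t => simp [finiteIndex, hit, Multiset.count_singleton, eq_comm]

theorem mem_finiteIndex {t : ℕ∞} {i : ℕ} : i ∈ finiteIndex t ↔ t = i := by
  rw [← Multiset.one_le_count_iff_mem, count_finiteIndex, hit]
  split_ifs <;> simp [*]

theorem countP_finiteIndex (t : ℕ∞) (i : ℕ) :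
    (finiteIndex t).countP (· ≤ i) = if t ≤ i then 1 else 0 := by
  induction t using ENat.recTopCoe with
  | top => simp [finiteIndex]
  | coe t =>
    have : finiteIndex (t : ℕ∞) = t ::ₘ 0 := by simp [finiteIndex]
    rw [this, Multiset.countP_cons]
    simp

/-! ## Removing and adding boxes at one node -/

/-- The lengths that govern the change of the vacancy numbers at one node: `l` and `l'` are the
lengths of the strings of this node that lose a box, the other ones are lengths of such strings of
the neighbouring nodes. -/
structure Selection where
  u : ℕ∞
  l : ℕ∞
  v : ℕ∞
  v' : ℕ∞
  l' : ℕ∞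
  u' : ℕ∞

/-- The indicator function of `[t, ∞)`. -/
noncomputable def step (t : ℕ∞) (i : ℕ) : ℤ := if t ≤ i then 1 else 0

/-- The indicator function of `{t}`. -/
noncomputable def spike (t : ℕ∞) (i : ℕ) : ℤ := if t = i then 1 else 0

theorem step_succ (t : ℕ∞) (i : ℕ) : step t (i + 1) = step t i + spike t (i + 1) := by
  induction t using ENat.recTopCoe with
  | top =>
    have : (⊤ : ℕ∞) ≠ ((i + 1 : ℕ) : ℕ∞) := ENat.top_ne_natCast _
    simp only [step, spike, if_neg this, top_le_iff, ENat.natCast_ne_top, if_false, add_zero]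
  | coe t =>
    simp only [step, spike, Nat.cast_le, Nat.cast_inj]
    split_ifs <;> omega

namespace Selection

/-- The lengths are weakly increasing and positive. -/
structure Ordered (T : Selection) : Prop where
  one_le : 1 ≤ T.u
  ul : T.u ≤ T.l
  lv : T.l ≤ T.v
  vv : T.v ≤ T.v'
  vl : T.v' ≤ T.l'
  lu : T.l' ≤ T.u'

/-- The lengths of the strings that lose a box. -/
def lengths (T : Selection) : Multiset ℕ := finiteIndex T.l + finiteIndex T.l'

/-- The change of the vacancy numbers. -/
noncomputable def gain (T : Selection) (i : ℕ) : ℤ :=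
  -step T.u i + 2 * step T.l i - step T.v i - step T.v' i + 2 * step T.l' i - step T.u' i

/-- The number of neighbouring strings of length `i` that lose a box. -/
noncomputable def marks (T : Selection) (i : ℕ) : ℤ :=
  spike T.u i + spike T.v i + spike T.v' i + spike T.u' i

/-- The indicator of finite lengths. -/
noncomputable def fin (t : ℕ∞) : ℤ := if t = ⊤ then 0 else 1

/-- The change of the vacancy numbers at large lengths. -/
noncomputable def gainInf (T : Selection) : ℤ :=
  -fin T.u + 2 * fin T.l - fin T.v - fin T.v' + 2 * fin T.l' - fin T.u'

/-- The selected lengths are those of the first singular strings. -/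
structure Removable (T : Selection) (S : Multiset (ℕ × ℤ)) (p : ℕ → ℤ) : Prop where
  le : T.lengths.map (fun i => (i, p i)) ≤ S
  fst : ∀ i : ℕ, T.u ≤ i → i < T.l → S.count (i, p i) = 0
  snd : ∀ i : ℕ, T.v' ≤ i → i < T.l' → S.count (i, p i) ≤ hit T.l i

/-- The selected lengths, decreased by one, are those of the last singular strings. -/
structure Addable (T : Selection) (S : Multiset (ℕ × ℤ)) (p : ℕ → ℤ) : Prop where
  le : (decrement T.lengths).map (fun i => (i, p i)) ≤ S
  fst : ∀ i : ℕ, T.l ≤ i → i < T.v → S.count (i, p i) ≤ hit T.l' (i + 1)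
  snd : ∀ i : ℕ, T.l' ≤ i → i < T.u' → S.count (i, p i) = 0

/-- The jump of the gain at one length; it allows the marks to be computed by subtracting the
compatibility condition at consecutive lengths. -/
theorem gain_succ (T : Selection) (i : ℕ) :
    T.gain (i + 1) = T.gain i - T.marks (i + 1) + 2 * (spike T.l (i + 1) + spike T.l' (i + 1)) := by
  simp only [gain, marks, step_succ]
  ring

theorem count_lengths (T : Selection) (i : ℕ) :
    (T.lengths.count i : ℤ) = spike T.l i + spike T.l' i := by
  simp only [lengths, Multiset.count_add, count_finiteIndex, spike, hit]
  push_cast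
  rfl

theorem Ordered.one_le_l {T : Selection} (h : T.Ordered) : 1 ≤ T.l := h.one_le.trans h.ul

theorem Ordered.one_le_l' {T : Selection} (h : T.Ordered) : 1 ≤ T.l' :=
  h.one_le_l.trans (h.lv.trans (h.vv.trans h.vl))

theorem Ordered.pos_of_mem_lengths {T : Selection} (h : T.Ordered) {i : ℕ} (hi : i ∈ T.lengths) :
    1 ≤ i := by
  rcases Multiset.mem_add.1 hi with hi | hi <;> rw [mem_finiteIndex] at hi
  · exact_mod_cast hi ▸ h.one_le_l
  · exact_mod_cast hi ▸ h.one_le_l'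

theorem spike_nonneg (t : ℕ∞) (i : ℕ) : 0 ≤ spike t i := by
  unfold spike; split_ifs <;> simp

theorem marks_nonneg (T : Selection) (i : ℕ) : 0 ≤ T.marks i := by
  have := spike_nonneg T.u i
  have := spike_nonneg T.v i
  have := spike_nonneg T.v' i
  have := spike_nonneg T.u' i
  unfold marks; omega

end Selection

theorem spike_eq_one {t : ℕ∞} {i : ℕ} (h : t = i) : spike t i = 1 := if_pos h

/-- Where the gain vanishes, or is `1` or `-1`. -/
theorem Selection.Ordered.gain_cases {T : Selection} (h : T.Ordered) (i : ℕ) :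
    (i < T.u ∧ T.gain i = 0) ∨ (T.u ≤ i ∧ i < T.l ∧ T.gain i = -1) ∨
    (T.l ≤ i ∧ i < T.v ∧ T.gain i = 1) ∨ (T.v ≤ i ∧ i < T.v' ∧ T.gain i = 0) ∨
    (T.v' ≤ i ∧ i < T.l' ∧ T.gain i = -1) ∨ (T.l' ≤ i ∧ i < T.u' ∧ T.gain i = 1) ∨
    (T.u' ≤ i ∧ T.gain i = 0) := by
  obtain ⟨h0, h1, h2, h3, h4, h5⟩ := h
  by_cases c6 : T.u' ≤ i
  · have c5 := h5.trans c6
    have c4 := h4.trans c5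
    have c3 := h3.trans c4
    have c2 := h2.trans c3
    have c1 := h1.trans c2
    right; right; right; right; right; right
    simp [gain, step, *]
  by_cases c5 : T.l' ≤ i
  · have c4 := h4.trans c5
    have c3 := h3.trans c4
    have c2 := h2.trans c3
    have c1 := h1.trans c2
    right; right; right; right; right; left
    refine ⟨c5, not_le.1 c6, ?_⟩
    simp [gain, step, *]
  by_cases c4 : T.v' ≤ i
  · have c3 := h3.trans c4
    have c2 := h2.trans c3
    have c1 := h1.trans c2
    right; right; right; right; left
    refine ⟨c4, not_le.1 c5, ?_⟩
    simp [gain, step, *]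
  by_cases c3 : T.v ≤ i
  · have c2 := h2.trans c3
    have c1 := h1.trans c2
    right; right; right; left
    refine ⟨c3, not_le.1 c4, ?_⟩
    simp [gain, step, *]
  by_cases c2 : T.l ≤ i
  · have c1 := h1.trans c2
    right; right; left
    refine ⟨c2, not_le.1 c3, ?_⟩
    simp [gain, step, *]
  by_cases c1 : T.u ≤ i
  · right; left
    refine ⟨c1, not_le.1 c2, ?_⟩
    simp [gain, step, *]
  · left
    refine ⟨not_le.1 c1, ?_⟩
    simp [gain, step, *]

/-- The number of strings of length `i` is at most the number of singular ones if the vacancy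
number is zero. -/
theorem count_fst_le_of_nonpos {S : Multiset (ℕ × ℤ)} {p : ℕ → ℤ}
    (hS : ∀ s ∈ S, 0 ≤ s.2 ∧ s.2 ≤ p s.1) {i : ℕ} (hp : p i ≤ 0) :
    (S.map Prod.fst).count i ≤ S.count (i, p i) := by
  rw [Multiset.count_map, Multiset.count_eq_card_filter_eq]
  refine Multiset.card_le_card (le_of_eq (Multiset.filter_congr fun s hs => ?_))
  obtain ⟨j, x⟩ := s
  have := hS _ hs
  simp only [Prod.mk.injEq]
  constructor
  · rintro rfl
    exact ⟨rfl, by simp only at this; omega⟩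
  · exact fun h => h.1

/-! ### Positivity of vacancy numbers on the critical intervals -/

section Node

variable {T : Selection} {S : Multiset (ℕ × ℤ)} {p : ℕ → ℤ}

/-- Descent towards `u`. If the vacancy number vanished at `i + 1`, all strings of that length would
be singular, hence absent by the minimality of `l`. Convexity then leaves no room for a mark at `i +
1`, so `u ≤ i`, and it forces the vacancy number at `i` to vanish as well, against the induction
hypothesis. -/
theorem Selection.Removable.one_le_fst (hR : T.Removable S p) (hT : T.Ordered)
    (hS : ∀ s ∈ S, 0 ≤ s.2 ∧ s.2 ≤ p s.1) (hp : ∀ i, 0 ≤ p i)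
    (hc : ∀ i, p i + p (i + 2) + T.marks (i + 1) ≤
      2 * p (i + 1) + 2 * (S.map Prod.fst).count (i + 1)) :
    ∀ i : ℕ, T.u ≤ i → i < T.l → 1 ≤ p i := by
  intro i
  induction i with
  | zero =>
    intro h
    exact absurd (hT.one_le.trans h) (by simp)
  | succ i ih =>
    intro h1 h2
    by_contra hlt
    have hm := count_fst_le_of_nonpos hS (i := i + 1) (by omega)
    rw [hR.fst _ h1 h2] at hm
    have h3 := hc i
    have h4 := hp i
    have h5 := hp (i + 2)
    have h6 := spike_nonneg T.v (i + 1)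
    have h7 := spike_nonneg T.v' (i + 1)
    have h8 := spike_nonneg T.u' (i + 1)
    have h9 : T.u ≠ ((i + 1 : ℕ) : ℕ∞) := by
      intro h
      have := spike_eq_one h
      unfold marks at h3
      omega
    have h10 : T.u ≤ i := by
      have := lt_of_le_of_ne h1 h9
      push_cast at this
      exact Order.le_of_lt_add_one this
    have := ih h10 (lt_of_le_of_lt (by simp) h2)
    have := T.marks_nonneg (i + 1)
    omega

/-- The same descent towards `v'`, with one exceptional length: at `l = i + 1` one singular string
may be present. Then `v` and `v'` both equal `i + 1`, and their two marks use up the contribution of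
that string; the zero passes to `i`, which lies in the first interval. -/
theorem Selection.Removable.one_le_snd (hR : T.Removable S p) (hT : T.Ordered)
    (hS : ∀ s ∈ S, 0 ≤ s.2 ∧ s.2 ≤ p s.1) (hp : ∀ i, 0 ≤ p i)
    (hc : ∀ i, p i + p (i + 2) + T.marks (i + 1) ≤
      2 * p (i + 1) + 2 * (S.map Prod.fst).count (i + 1)) :
    ∀ i : ℕ, T.v' ≤ i → i < T.l' → 1 ≤ p i := by
  intro i
  induction i with
  | zero =>
    intro h
    exact absurd (hT.one_le.trans (hT.ul.trans (hT.lv.trans (hT.vv.trans h)))) (by simp)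
  | succ i ih =>
    intro h1 h2
    by_contra hlt
    have hm := count_fst_le_of_nonpos hS (i := i + 1) (by omega)
    have hm2 := hR.snd _ h1 h2
    have h3 := hc i
    have h4 := hp i
    have h5 := hp (i + 2)
    have s1 := spike_nonneg T.u (i + 1)
    have s2 := spike_nonneg T.v (i + 1)
    have s3 := spike_nonneg T.v' (i + 1)
    have s4 := spike_nonneg T.u' (i + 1)
    unfold marks at h3
    by_cases hl : T.l = ((i + 1 : ℕ) : ℕ∞)
    · rw [hit_of_eq hl] at hm2
      have hv : T.v = ((i + 1 : ℕ) : ℕ∞) := le_antisymm (hT.vv.trans h1) (hl ▸ hT.lv)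
      have hv' : T.v' = ((i + 1 : ℕ) : ℕ∞) := le_antisymm h1 (hv ▸ hT.vv)
      have e1 := spike_eq_one hv
      have e2 := spike_eq_one hv'
      have hu : T.u ≠ ((i + 1 : ℕ) : ℕ∞) := by
        intro h
        have := spike_eq_one h
        omega
      have h10 : T.u ≤ i := by
        have := lt_of_le_of_ne (hl ▸ hT.ul) hu
        push_cast at this
        exact Order.le_of_lt_add_one this
      have := hR.one_le_fst hT hS hp hc i h10 (by rw [hl]; exact_mod_cast Nat.lt_succ_self i)
      omega
    · rw [hit_of_ne hl] at hm2
      have h9 : T.v' ≠ ((i + 1 : ℕ) : ℕ∞) := by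
        intro h
        have := spike_eq_one h
        omega
      have h10 : T.v' ≤ i := by
        have := lt_of_le_of_ne h1 h9
        push_cast at this
        exact Order.le_of_lt_add_one this
      have := ih h10 (lt_of_le_of_lt (by simp) h2)
      omega

/-- The mirror image, with zeros propagating upwards. A zero cannot pass a finite `u'`, whose mark
violates convexity, and on an unbounded interval it would persist forever, which `htop` excludes.
The marks sit at `i + 2` because a string of length `i + 1` is the shortening of one of length `i +
2`. -/
theorem Selection.Addable.one_le_snd (hR : T.Addable S p) (hT : T.Ordered)
    (hS : ∀ s ∈ S, 0 ≤ s.2 ∧ s.2 ≤ p s.1) (hp : ∀ i, 0 ≤ p i)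
    (hc : ∀ i, p i + p (i + 2) + T.marks (i + 2) ≤
      2 * p (i + 1) + 2 * (S.map Prod.fst).count (i + 1))
    (htop : T.l' ≠ ⊤ → T.u' = ⊤ → ∀ i, ∃ j, i ≤ j ∧ 1 ≤ p j) :
    ∀ i : ℕ, T.l' ≤ i → i < T.u' → 1 ≤ p i := by
  have key : ∀ i : ℕ, T.l' ≤ i → i < T.u' → p i ≤ 0 → ((i + 1 : ℕ) : ℕ∞) < T.u' ∧ p (i + 1) ≤ 0 := by
    intro i h1 h2 h0
    obtain _ | i := i
    · exact absurd (hT.one_le_l'.trans h1) (by simp)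
    have hm := count_fst_le_of_nonpos hS (i := i + 1) h0
    rw [hR.snd _ h1 h2] at hm
    have h3 := hc i
    have h4 := hp i
    have h5 := hp (i + 2)
    have s1 := spike_nonneg T.u (i + 2)
    have s2 := spike_nonneg T.v (i + 2)
    have s3 := spike_nonneg T.v' (i + 2)
    have s4 := spike_nonneg T.u' (i + 2)
    unfold marks at h3
    refine ⟨lt_of_le_of_ne ?_ ?_, by show p (i + 2) ≤ 0; omega⟩
    · have := Order.add_one_le_of_lt h2
      exact_mod_cast this
    · intro h
      have := spike_eq_one (i := i + 2) h.symm
      omega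
  intro i h1 h2
  by_contra hlt
  have all : ∀ j : ℕ, i ≤ j → (j : ℕ∞) < T.u' ∧ p j ≤ 0 := by
    intro j hj
    induction j, hj using Nat.le_induction with
    | base => exact ⟨h2, by omega⟩
    | succ j hj ih => exact key j (h1.trans (by exact_mod_cast hj)) ih.1 ih.2
  have htop' : T.u' = ⊤ := by
    by_contra hne
    obtain ⟨m, hm⟩ := ENat.ne_top_iff_exists.1 hne
    have := (all (max i m) (le_max_left _ _)).1
    rw [← hm, Nat.cast_lt] at this
    omega
  obtain ⟨j, hj, hj'⟩ := htop (fun h => by simp [h] at h1) htop' i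
  have := (all j hj).2
  omega

/-- Again zeros propagate upwards. At the exceptional length `l' - 1` one singular string is
tolerated, but then `v` and `v'` both equal `l'` and their marks compensate; the zero arrives at
`l'`, where the second interval has already been shown to be positive. -/
theorem Selection.Addable.one_le_fst (hR : T.Addable S p) (hT : T.Ordered)
    (hS : ∀ s ∈ S, 0 ≤ s.2 ∧ s.2 ≤ p s.1) (hp : ∀ i, 0 ≤ p i)
    (hc : ∀ i, p i + p (i + 2) + T.marks (i + 2) ≤
      2 * p (i + 1) + 2 * (S.map Prod.fst).count (i + 1))
    (htop : T.l' ≠ ⊤ → T.u' = ⊤ → ∀ i, ∃ j, i ≤ j ∧ 1 ≤ p j)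
    (htop' : T.l ≠ ⊤ → T.v = ⊤ → ∀ i, ∃ j, i ≤ j ∧ 1 ≤ p j) :
    ∀ i : ℕ, T.l ≤ i → i < T.v → 1 ≤ p i := by
  have key : ∀ i : ℕ, T.l ≤ i → i < T.v → p i ≤ 0 → ((i + 1 : ℕ) : ℕ∞) < T.v ∧ p (i + 1) ≤ 0 := by
    intro i h1 h2 h0
    obtain _ | i := i
    · exact absurd (hT.one_le_l.trans h1) (by simp)
    have hm := count_fst_le_of_nonpos hS (i := i + 1) h0
    have hm2 := hR.fst _ h1 h2
    have h3 := hc i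
    have h4 := hp i
    have h5 := hp (i + 2)
    have s1 := spike_nonneg T.u (i + 2)
    have s2 := spike_nonneg T.v (i + 2)
    have s3 := spike_nonneg T.v' (i + 2)
    have s4 := spike_nonneg T.u' (i + 2)
    unfold marks at h3
    have h2' : ((i + 2 : ℕ) : ℕ∞) ≤ T.v := by
      have := Order.add_one_le_of_lt h2
      exact_mod_cast this
    by_cases hl : T.l' = ((i + 1 + 1 : ℕ) : ℕ∞)
    · rw [hit_of_eq hl] at hm2
      have hv' : T.v' = ((i + 2 : ℕ) : ℕ∞) := le_antisymm (hl ▸ hT.vl) (h2'.trans hT.vv)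
      have hv : T.v = ((i + 2 : ℕ) : ℕ∞) := le_antisymm (hv' ▸ hT.vv) h2'
      have e1 := spike_eq_one hv
      have e2 := spike_eq_one hv'
      have hu : T.u' ≠ ((i + 2 : ℕ) : ℕ∞) := by
        intro h
        have := spike_eq_one h
        omega
      have := hR.one_le_snd hT hS hp hc htop (i + 2) (le_of_eq hl)
        (lt_of_le_of_ne (hl ▸ hT.lu) (Ne.symm hu))
      omega
    · rw [hit_of_ne hl] at hm2
      refine ⟨lt_of_le_of_ne h2' ?_, by show p (i + 2) ≤ 0; omega⟩
      intro h
      have := spike_eq_one (i := i + 2) h.symm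
      omega
  intro i h1 h2
  by_contra hlt
  have all : ∀ j : ℕ, i ≤ j → (j : ℕ∞) < T.v ∧ p j ≤ 0 := by
    intro j hj
    induction j, hj using Nat.le_induction with
    | base => exact ⟨h2, by omega⟩
    | succ j hj ih => exact key j (h1.trans (by exact_mod_cast hj)) ih.1 ih.2
  have hvtop : T.v = ⊤ := by
    by_contra hne
    obtain ⟨m, hm⟩ := ENat.ne_top_iff_exists.1 hne
    have := (all (max i m) (le_max_left _ _)).1
    rw [← hm, Nat.cast_lt] at this
    omega
  obtain ⟨j, hj, hj'⟩ := htop' (fun h => by simp [h] at h1) hvtop i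
  have := (all j hj).2
  omega

end Node

end PathRC

namespace PathRC

open Selection

/-! ## Removing and adding boxes at all nodes -/

theorem map_fst_pair (s : Multiset ℕ) (p : ℕ → ℤ) :
    (s.map fun i => (i, p i)).map Prod.fst = s := by
  simp

theorem map_fst_sub {S R : Multiset (ℕ × ℤ)} (h : R ≤ S) :
    (S - R).map Prod.fst = S.map Prod.fst - R.map Prod.fst := by
  obtain ⟨U, rfl⟩ := Multiset.le_iff_exists_add.1 h
  simp

theorem shape_le_of_le {I : Type} {nu : Rigged I} {s : Multiset ℕ} {p : ℕ → ℤ} {a : I}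
    (h : s.map (fun i => (i, p i)) ≤ nu a) : s ≤ nu.shape a := by
  have := Multiset.map_le_map (f := Prod.fst) h
  rwa [map_fst_pair] at this

section Global

variable {I : Type} [Fintype I]

theorem step_eventually (t : ℕ∞) : ∃ N, ∀ i, N ≤ i → step t i = fin t := by
  induction t using ENat.recTopCoe with
  | top => exact ⟨0, fun i _ => by simp [step, fin]⟩
  | coe t => exact ⟨t, fun i hi => by simp [step, fin, hi]⟩

theorem Selection.gain_eventually (T : Selection) : ∃ N, ∀ i, N ≤ i → T.gain i = T.gainInf := by
  obtain ⟨a, ha⟩ := step_eventually T.u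
  obtain ⟨b, hb⟩ := step_eventually T.l
  obtain ⟨c, hc⟩ := step_eventually T.v
  obtain ⟨d, hd⟩ := step_eventually T.v'
  obtain ⟨e, he⟩ := step_eventually T.l'
  obtain ⟨f, hf⟩ := step_eventually T.u'
  refine ⟨a + b + c + d + e + f, fun i hi => ?_⟩
  simp only [gain, gainInf]
  rw [ha i (by omega), hb i (by omega), hc i (by omega), hd i (by omega), he i (by omega),
    hf i (by omega)]

theorem vacancy_eventually_eq (A : I → I → ℤ) (L sh : I → Multiset ℕ) :
    ∃ N, ∀ i, N ≤ i → ∀ b,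
      vacancy A L sh b i = ((L b).sum : ℤ) - ∑ a, ((sh a).sum : ℤ) * A b a := by
  obtain ⟨N, hN⟩ := exists_forall_le_bound L
  obtain ⟨M, hM⟩ := exists_forall_le_bound sh
  refine ⟨N + M, fun i hi b => ?_⟩
  rw [vacancy_eq_trunc, trunc_eq_sum fun j hj => (hN b j hj).trans (by omega)]
  congr 1
  refine Finset.sum_congr rfl fun a _ => ?_
  rw [trunc_eq_sum fun j hj => (hM a j hj).trans (by omega), mul_comm]

/-- The vacancy numbers at large lengths are the coordinates of the weight. -/
theorem IsRC.vacancy_eventually {A : I → I → ℤ} {L : I → Multiset ℕ} {lam : I → ℕ} {nu : Rigged I}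
    (h : IsRC A L lam nu) : ∃ N, ∀ i, N ≤ i → ∀ b, vacancy A L nu.shape b i = lam b := by
  obtain ⟨N, hN⟩ := vacancy_eventually_eq A L nu.shape
  refine ⟨N, fun i hi b => ?_⟩
  rw [hN i hi b, h.weight b]
  ring

/-- Beyond all parts the truncated sums are full sums, so the weight equation is a statement about
vacancy numbers at large lengths. The weight of a modified configuration can thus be read off from
the change of its vacancy numbers. -/
theorem weight_of_vacancy_eventually {A : I → I → ℤ} {L : I → Multiset ℕ} {lam : I → ℕ}
    {sh : I → Multiset ℕ} (h : ∃ N, ∀ i, N ≤ i → ∀ b, vacancy A L sh b i = lam b) (b : I) :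
    ∑ a, ((sh a).sum : ℤ) * A b a = ((L b).sum : ℤ) - lam b := by
  obtain ⟨N, hN⟩ := vacancy_eventually_eq A L sh
  obtain ⟨M, hM⟩ := h
  have h1 := hN (N + M) (by omega) b
  have h2 := hM (N + M) (by omega) b
  omega

/-- The selections `T`, one for each node, describe the removal of the array `H` of single boxes
from `L` together with the removal of boxes from `ν`. -/
structure IsMove (A : I → I → ℤ) (H : I → Multiset ℕ) (T : I → Selection) : Prop where
  ordered : ∀ a, (T a).Ordered
  hat : ∀ a, ∀ j ∈ H a, j = 1
  compat : ∀ a i, -((H a).countP (· ≤ i) : ℤ) + ∑ b, A a b * ((T b).lengths.countP (· ≤ i) : ℤ) =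
    (T a).gain i

variable {A : I → I → ℤ} {H L L' : I → Multiset ℕ} {T : I → Selection}

theorem trunc_hat {s : Multiset ℕ} (h : ∀ j ∈ s, j = 1) (i : ℕ) : trunc s i = s.countP (· ≤ i) := by
  induction s using Multiset.induction with
  | empty => simp
  | cons j t ih =>
    have := h j (Multiset.mem_cons_self j t)
    rw [trunc_cons, ih fun k hk => h k (Multiset.mem_cons_of_mem hk), Multiset.countP_cons]
    split_ifs <;> omega

/-- Each shortened string of length at most `i` lowers a truncated sum by one, and so does each
removed factor; `compat` says that the Cartan combination of these losses is the gain. -/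
theorem IsMove.vacancy_change (hT : IsMove A H T) (hL : ∀ a, L a = L' a + H a)
    {sh sh' : I → Multiset ℕ}
    (hs : ∀ b i, trunc (sh' b) i = trunc (sh b) i - ((T b).lengths.countP (· ≤ i) : ℤ))
    (a : I) (i : ℕ) : vacancy A L' sh' a i = vacancy A L sh a i + (T a).gain i := by
  rw [vacancy_eq_trunc, vacancy_eq_trunc, hL, trunc_add, ← hT.compat, trunc_hat (hT.hat a)]
  simp only [hs, mul_sub, Finset.sum_sub_distrib]
  ring

/-- The difference of `compat` at consecutive lengths. It expresses the marks by numbers of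
shortened strings, which can be subtracted inside the Cartan sum. -/
theorem IsMove.marks_eq (hT : IsMove A H T) (a : I) (i : ℕ) :
    (T a).marks (i + 1) = (H a).count (i + 1) - ∑ b, A a b * ((T b).lengths.count (i + 1) : ℤ) +
      2 * (T a).lengths.count (i + 1) := by
  have h1 := hT.compat a i
  have h2 := hT.compat a (i + 1)
  simp only [countP_le_succ] at h2
  rw [gain_succ, ← count_lengths] at h2
  push_cast at h2
  simp only [mul_add, Finset.sum_add_distrib] at h2
  linarith

theorem vacancy_second_difference (A : I → I → ℤ) (L sh : I → Multiset ℕ) (a : I) (i : ℕ) :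
    2 * vacancy A L sh a (i + 1) - vacancy A L sh a i - vacancy A L sh a (i + 2) =
      (L a).count (i + 1) - ∑ b, A a b * ((sh b).count (i + 1) : ℤ) := by
  simp only [vacancy_eq_trunc, ← trunc_second_difference, mul_sub, Finset.sum_sub_distrib,
    mul_left_comm (A a _) 2, ← Finset.mul_sum]
  ring

/-- A symmetrizable Cartan matrix, as far as it is needed here. -/
structure IsCartan (A : I → I → ℤ) : Prop where
  diag : ∀ a, A a a = 2
  offdiag : ∀ a b, a ≠ b → A a b ≤ 0

theorem IsCartan.sum_le (hA : IsCartan A) (g : I → ℤ) (hg : ∀ b, 0 ≤ g b) (a : I) :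
    ∑ b, A a b * g b ≤ 2 * g a := by
  classical
  rw [← Finset.add_sum_erase _ _ (Finset.mem_univ a), hA.diag]
  have : ∑ b ∈ Finset.univ.erase a, A a b * g b ≤ 0 :=
    Finset.sum_nonpos fun b hb =>
      mul_nonpos_of_nonpos_of_nonneg (hA.offdiag a b (Finset.ne_of_mem_erase hb).symm) (hg b)
  linarith

/-- The Cartan bound is applied to the strings that are kept rather than to all strings; the removed
strings of the neighbours then survive in the estimate as marks. -/
theorem IsMove.convex_removal (hT : IsMove A H T) (hA : IsCartan A) (hL : ∀ a, L a = L' a + H a)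
    {sh : I → Multiset ℕ} (hle : ∀ b, (T b).lengths ≤ sh b) (a : I) (i : ℕ) :
    vacancy A L sh a i + vacancy A L sh a (i + 2) + (T a).marks (i + 1) ≤
      2 * vacancy A L sh a (i + 1) + 2 * (sh a).count (i + 1) := by
  have h1 := vacancy_second_difference A L sh a i
  have h2 := hT.marks_eq a i
  have h3 := hA.sum_le (fun b => ((sh b).count (i + 1) : ℤ) - (T b).lengths.count (i + 1))
    (fun b => by have := Multiset.count_le_of_le (i + 1) (hle b); omega) a
  simp only [mul_sub, Finset.sum_sub_distrib] at h3
  have h4 : ((H a).count (i + 1) : ℤ) ≤ (L a).count (i + 1) := by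
    rw [hL, Multiset.count_add]; push_cast; omega
  linarith

/-- The strings not to be lengthened play the role of the kept ones, with lengths shifted by one.
The hat contributes nothing because its boxes have length one, while the lengths in question are at
least two. -/
theorem IsMove.convex_addition (hT : IsMove A H T) (hA : IsCartan A)
    {sh : I → Multiset ℕ} (hle : ∀ b, decrement (T b).lengths ≤ sh b) (a : I) (i : ℕ) :
    vacancy A L' sh a i + vacancy A L' sh a (i + 2) + (T a).marks (i + 2) ≤
      2 * vacancy A L' sh a (i + 1) + 2 * (sh a).count (i + 1) := by
  have h1 := vacancy_second_difference A L' sh a i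
  have h2 := hT.marks_eq a (i + 1)
  have h3 := hA.sum_le (fun b => ((sh b).count (i + 1) : ℤ) - (T b).lengths.count (i + 1 + 1))
    (fun b => by
      have := Multiset.count_le_of_le (i + 1) (hle b)
      rw [count_decrement _ (by omega)] at this
      omega) a
  simp only [mul_sub, Finset.sum_sub_distrib] at h3
  have h4 : (H a).count (i + 1 + 1) = 0 := by
    rw [Multiset.count_eq_zero]
    intro h
    have := hT.hat a _ h
    omega
  rw [h4] at h2
  have h5 : i + 1 + 1 = i + 2 := rfl
  rw [h5] at h2
  push_cast at h2
  have h6 : (0 : ℤ) ≤ (L' a).count (i + 1) := by positivity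
  linarith

theorem trunc_removal {s l : Multiset ℕ} (h : l ≤ s) (hl : ∀ j ∈ l, 1 ≤ j) (i : ℕ) :
    trunc (s - l + decrement l) i = trunc s i - (l.countP (· ≤ i) : ℤ) := by
  rw [trunc_add, trunc_sub h, trunc_decrement hl]
  ring

theorem trunc_addition {s l : Multiset ℕ} (h : decrement l ≤ s) (hl : ∀ j ∈ l, 1 ≤ j) (i : ℕ) :
    trunc (s - decrement l + l) i = trunc s i + (l.countP (· ≤ i) : ℤ) := by
  rw [trunc_add, trunc_sub h, trunc_decrement hl]
  ring

/-- The vacancy numbers as a function of the length. -/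
def vac (A : I → I → ℤ) (L : I → Multiset ℕ) (nu : Rigged I) (a : I) (i : ℕ) : ℤ :=
  vacancy A L nu.shape a i

theorem vac_zero (A : I → I → ℤ) (L : I → Multiset ℕ) (nu : Rigged I) (a : I) :
    vac A L nu a 0 = 0 := by
  simp [vac, vacancy]

theorem IsRC.vac_nonneg {lam : I → ℕ} {nu : Rigged I} (h : IsRC A L lam nu) (a : I) (i : ℕ) :
    0 ≤ vac A L nu a i := by
  obtain _ | i := i
  · rw [vac_zero]
  · exact h.admissible a _ (by omega)

theorem count_map_pair (s : Multiset ℕ) (p : ℕ → ℤ) (i : ℕ) (c : ℤ) :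
    (s.map fun i => (i, p i)).count (i, c) = if c = p i then s.count i else 0 := by
  split_ifs with h
  · rw [h]
    exact Multiset.count_map_eq_count' (fun i => (i, p i)) s
      (fun a b h => (Prod.mk.inj h).1) i
  · rw [Multiset.count_eq_zero, Multiset.mem_map]
    rintro ⟨j, _, hj⟩
    simp only [Prod.mk.injEq] at hj
    exact h (by rw [← hj.2, hj.1])

/-- The rigged configuration that is obtained by removing boxes as described by `T`. -/
def removal (A : I → I → ℤ) (L L' : I → Multiset ℕ) (T : I → Selection) (nu : Rigged I) :
    Rigged I :=
  removeBoxes A L L' nu fun a => (T a).lengths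

section Removal

variable {lam : I → ℕ} {nu : Rigged I}

theorem shape_removal (h : ∀ a, (T a).lengths.map (fun i => (i, vac A L nu a i)) ≤ nu a) (a : I) :
    (removal A L L' T nu).shape a =
      nu.shape a - (T a).lengths + decrement (T a).lengths := by
  have h1 := map_fst_sub (h a)
  rw [map_fst_pair] at h1
  simp only [removal, removeBoxes, Rigged.shape, Multiset.map_add, map_fst_pair]
  congr 1

theorem IsMove.vac_removal (hT : IsMove A H T) (hL : ∀ a, L a = L' a + H a)
    (h : ∀ a, (T a).lengths.map (fun i => (i, vac A L nu a i)) ≤ nu a) (a : I) (i : ℕ) :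
    vac A L' (removal A L L' T nu) a i = vac A L nu a i + (T a).gain i := by
  refine hT.vacancy_change hL (fun b j => ?_) a i
  rw [shape_removal h, trunc_removal (shape_le_of_le (h b))
    fun j hj => (hT.ordered b).pos_of_mem_lengths hj]

theorem removal_apply (h : ∀ a, (T a).lengths.map (fun i => (i, vac A L nu a i)) ≤ nu a) (a : I) :
    removal A L L' T nu a = nu a - (T a).lengths.map (fun i => (i, vac A L nu a i)) +
      (decrement (T a).lengths).map (fun i => (i, vac A L' (removal A L L' T nu) a i)) := by
  have : (fun b => nu.shape b - (T b).lengths + decrement (T b).lengths) =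
      (removal A L L' T nu).shape := funext fun b => (shape_removal h b).symm
  simp only [vac, ← this]
  rfl

/-- Removing boxes from the first singular strings yields a rigged configuration. -/
theorem IsMove.isRC_removal (hT : IsMove A H T) (hA : IsCartan A) (hL : ∀ a, L a = L' a + H a)
    (hnu : IsRC A L lam nu) (hR : ∀ a, (T a).Removable (nu a) (vac A L nu a)) {mu : I → ℕ}
    (hmu : ∀ a, (mu a : ℤ) = lam a + (T a).gainInf) : IsRC A L' mu (removal A L L' T nu) := by
  have hle := fun a => (hR a).le
  have hv := hT.vac_removal hL hle
  have hconv := hT.convex_removal hA hL fun b => shape_le_of_le (hle b)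
  have h1 := fun a => (hR a).one_le_fst (hT.ordered a) (hnu.rigging a) (hnu.vac_nonneg a) (hconv a)
  have h2 := fun a => (hR a).one_le_snd (hT.ordered a) (hnu.rigging a) (hnu.vac_nonneg a) (hconv a)
  have hnonneg : ∀ a i, 0 ≤ vac A L' (removal A L L' T nu) a i := by
    intro a i
    have h0 := hnu.vac_nonneg a i
    rw [hv]
    rcases (hT.ordered a).gain_cases i with ⟨_, h⟩ | ⟨c1, c2, h⟩ | ⟨_, _, h⟩ | ⟨_, _, h⟩ |
      ⟨c1, c2, h⟩ | ⟨_, _, h⟩ | ⟨_, h⟩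
    -- Vacancy numbers drop only on `[u, l)` and `[v', l')`, where they were at least one.
    on_goal 2 => have := h1 a i c1 c2
    on_goal 5 => have := h2 a i c1 c2
    all_goals omega
  refine ⟨fun a s hs => ?_, weight_of_vacancy_eventually ?_, fun a i _ => hnonneg a i,
    fun a s hs => ?_⟩
  · rw [removal_apply hle, Multiset.mem_add] at hs
    rcases hs with hs | hs
    · exact hnu.length_pos a s (Multiset.mem_of_le tsub_le_self hs)
    · obtain ⟨i, hi, rfl⟩ := Multiset.mem_map.1 hs
      exact pos_of_mem_decrement hi
  · obtain ⟨N, hN⟩ := hnu.vacancy_eventually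
    choose M hM using fun a => (T a).gain_eventually
    refine ⟨N + ∑ a, M a, fun i hi b => ?_⟩
    have h3 : M b ≤ ∑ a, M a :=
      Finset.single_le_sum (f := M) (fun _ _ => Nat.zero_le _) (Finset.mem_univ b)
    have := hv b i
    simp only [vac] at this
    rw [this, hN i (by omega), hM b i (by omega), hmu]
  · rw [removal_apply hle, Multiset.mem_add] at hs
    rcases hs with hs | hs
    · have hs' := Multiset.mem_of_le tsub_le_self hs
      have h3 := hnu.rigging a s hs'
      refine ⟨h3.1, ?_⟩
      change s.2 ≤ vac A L' (removal A L L' T nu) a s.1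
      change 0 ≤ s.2 ∧ s.2 ≤ vac A L nu a s.1 at h3
      rw [hv]
      obtain ⟨i, x⟩ := s
      simp only at h3 ⊢
      have hc := Multiset.one_le_count_iff_mem.2 hs
      rw [Multiset.count_sub, count_map_pair] at hc
      have h4 := (hR a).fst i
      have h5 := (hR a).snd i
      have h6 : (T a).l = i → 1 ≤ (T a).lengths.count i := fun h => by
        rw [lengths, Multiset.count_add, count_finiteIndex, hit_of_eq h]; omega
      -- A kept string can exceed its new bound only if it was singular at a length with gain `-1`.
      -- No such string is left: the single one tolerated on the second interval, of length `l`, is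
      -- itself removed.
      by_cases hx : x = vac A L nu a i
      · rw [if_pos hx, hx] at hc
        rcases (hT.ordered a).gain_cases i with ⟨_, h⟩ | ⟨c1, c2, h⟩ | ⟨_, _, h⟩ | ⟨_, _, h⟩ |
          ⟨c1, c2, h⟩ | ⟨_, _, h⟩ | ⟨_, h⟩
        on_goal 2 => have := h4 c1 c2
        on_goal 5 =>
          have := h5 c1 c2
          by_cases hl : (T a).l = i
          · have := h6 hl
            have := hit_le_one (T a).l i
            omega
          · rw [hit_of_ne hl] at this
            omega
        all_goals omega
      · rcases (hT.ordered a).gain_cases i with ⟨_, h⟩ | ⟨c1, c2, h⟩ | ⟨_, _, h⟩ | ⟨_, _, h⟩ |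
          ⟨c1, c2, h⟩ | ⟨_, _, h⟩ | ⟨_, h⟩ <;> omega
    · obtain ⟨i, hi, rfl⟩ := Multiset.mem_map.1 hs
      exact ⟨hnonneg a i, le_rfl⟩

/-- At large lengths the vacancy number is the weight and the gain is its limit; a limit `-1` means
an unbounded critical interval, on which the vacancy number is positive. -/
theorem IsMove.weight_nonneg (hT : IsMove A H T) (hA : IsCartan A) (hL : ∀ a, L a = L' a + H a)
    (hnu : IsRC A L lam nu) (hR : ∀ a, (T a).Removable (nu a) (vac A L nu a)) (a : I) :
    0 ≤ (lam a : ℤ) + (T a).gainInf := by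
  have hle := fun a => (hR a).le
  have hconv := hT.convex_removal hA hL fun b => shape_le_of_le (hle b)
  have h1 := (hR a).one_le_fst (hT.ordered a) (hnu.rigging a) (hnu.vac_nonneg a) (hconv a)
  have h2 := (hR a).one_le_snd (hT.ordered a) (hnu.rigging a) (hnu.vac_nonneg a) (hconv a)
  obtain ⟨N, hN⟩ := hnu.vacancy_eventually
  obtain ⟨M, hM⟩ := (T a).gain_eventually
  have h3 := hN (N + M) (by omega) a
  rw [← h3, ← hM (N + M) (by omega)]
  have h0 := hnu.vac_nonneg a (N + M)
  have h1' := h1 (N + M)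
  have h2' := h2 (N + M)
  simp only [vac] at h0 h1' h2'
  rcases (hT.ordered a).gain_cases (N + M) with ⟨_, h⟩ | ⟨c1, c2, h⟩ | ⟨_, _, h⟩ | ⟨_, _, h⟩ |
      ⟨c1, c2, h⟩ | ⟨_, _, h⟩ | ⟨_, h⟩
  on_goal 2 => have := h1' c1 c2
  on_goal 5 => have := h2' c1 c2
  all_goals omega

/-- The number of strings with a given length and vacancy number after a removal. -/
theorem count_removal (h : ∀ a, (T a).lengths.map (fun i => (i, vac A L nu a i)) ≤ nu a) (a : I)
    (i : ℕ) (c : ℤ) : (removal A L L' T nu a).count (i, c) =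
      (nu a).count (i, c) - (if c = vac A L nu a i then (T a).lengths.count i else 0) +
      if c = vac A L' (removal A L L' T nu) a i then (decrement (T a).lengths).count i else 0 := by
  rw [removal_apply h, Multiset.count_add, Multiset.count_sub, count_map_pair, count_map_pair]

/-- Where the gain is `+1`, a kept string has rigging at most the old vacancy number and is no
longer singular. The only singular strings on these intervals are therefore the freshly shortened
ones. -/
theorem IsMove.addable_removal (hT : IsMove A H T) (hL : ∀ a, L a = L' a + H a)
    (hnu : IsRC A L lam nu) (hR : ∀ a, (T a).Removable (nu a) (vac A L nu a)) (a : I) :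
    (T a).Addable (removal A L L' T nu a) (vac A L' (removal A L L' T nu) a) := by
  have hle := fun a => (hR a).le
  have hv := hT.vac_removal hL hle
  have key : ∀ i, (T a).gain i = 1 →
      (removal A L L' T nu a).count (i, vac A L' (removal A L L' T nu) a i) =
        (decrement (T a).lengths).count i := by
    intro i hi
    rw [count_removal hle, if_pos rfl, if_neg (by rw [hv]; omega)]
    have : (nu a).count (i, vac A L' (removal A L L' T nu) a i) = 0 := by
      rw [Multiset.count_eq_zero]
      intro hmem
      have h2 := (hnu.rigging a _ hmem).2
      change vac A L' (removal A L L' T nu) a i ≤ vac A L nu a i at h2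
      rw [hv] at h2
      omega
    omega
  have one : ∀ i : ℕ, (T a).l ≤ i → 1 ≤ i := fun i hi => by
    exact_mod_cast (hT.ordered a).one_le_l.trans hi
  refine ⟨?_, fun i h1 h2 => ?_, fun i h1 h2 => ?_⟩
  · rw [removal_apply hle]
    exact Multiset.le_add_left _ _
  · rcases (hT.ordered a).gain_cases i with ⟨c, h⟩ | ⟨_, c2, h⟩ | ⟨_, _, h⟩ | ⟨c1, _, h⟩ |
      ⟨c1, _, h⟩ | ⟨c1, _, h⟩ | ⟨c, h⟩
    · exact absurd ((hT.ordered a).ul.trans h1) (not_le.2 c)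
    · exact absurd h1 (not_le.2 c2)
    · rw [key i h, count_decrement _ (one i h1), lengths, Multiset.count_add, count_finiteIndex,
        count_finiteIndex]
      rw [hit_of_ne (t := (T a).l) (fun h3 => ?_), zero_add]
      rw [h3, Nat.cast_le] at h1
      omega
    · exact absurd h2 (not_lt.2 c1)
    · exact absurd h2 (not_lt.2 ((hT.ordered a).vv.trans c1))
    · exact absurd h2 (not_lt.2 ((hT.ordered a).vv.trans ((hT.ordered a).vl.trans c1)))
    · exact absurd h2 (not_lt.2 ((hT.ordered a).vv.trans ((hT.ordered a).vl.trans
        ((hT.ordered a).lu.trans c))))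
  · have h0 : (T a).l ≤ i :=
      (hT.ordered a).lv.trans ((hT.ordered a).vv.trans ((hT.ordered a).vl.trans h1))
    rcases (hT.ordered a).gain_cases i with ⟨c, h⟩ | ⟨_, c2, h⟩ | ⟨_, c2, h⟩ | ⟨_, c2, h⟩ |
      ⟨_, c2, h⟩ | ⟨_, _, h⟩ | ⟨c, h⟩
    · exact absurd ((hT.ordered a).ul.trans h0) (not_le.2 c)
    · exact absurd h0 (not_le.2 c2)
    · exact absurd ((hT.ordered a).vv.trans ((hT.ordered a).vl.trans h1)) (not_le.2 c2)
    · exact absurd ((hT.ordered a).vl.trans h1) (not_le.2 c2)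
    · exact absurd h1 (not_le.2 c2)
    · rw [key i h, count_decrement _ (one i h0), lengths, Multiset.count_add, count_finiteIndex,
        count_finiteIndex, hit_of_ne, hit_of_ne]
      · intro h3
        rw [h3, Nat.cast_le] at h1
        omega
      · intro h3
        rw [h3, Nat.cast_le] at h0
        omega
    · exact absurd h2 (not_lt.2 c)

end Removal

/-- The rigged configuration that is obtained by adding boxes as described by `T`. -/
noncomputable def addition (A : I → I → ℤ) (L' : I → Multiset ℕ) (T : I → Selection)
    (nu : Rigged I) : Rigged I := fun a =>
  nu a - (decrement (T a).lengths).map (fun i => (i, vac A L' nu a i)) +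
    (T a).lengths.map fun i => (i, vac A L' nu a i - (T a).gain i)

section Addition

variable {mu : I → ℕ} {nu : Rigged I}

theorem shape_addition
    (h : ∀ a, (decrement (T a).lengths).map (fun i => (i, vac A L' nu a i)) ≤ nu a) (a : I) :
    (addition A L' T nu).shape a =
      nu.shape a - decrement (T a).lengths + (T a).lengths := by
  simp only [addition, Rigged.shape, Multiset.map_add, map_fst_pair]
  congr 1
  rw [map_fst_sub (h a), map_fst_pair]

theorem IsMove.vac_addition (hT : IsMove A H T) (hL : ∀ a, L a = L' a + H a)
    (h : ∀ a, (decrement (T a).lengths).map (fun i => (i, vac A L' nu a i)) ≤ nu a) (a : I)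
    (i : ℕ) : vac A L (addition A L' T nu) a i = vac A L' nu a i - (T a).gain i := by
  have := hT.vacancy_change hL (sh := (addition A L' T nu).shape) (sh' := nu.shape)
    (fun b j => by
      rw [shape_addition h, trunc_addition (shape_le_of_le (h b))
        fun j hj => (hT.ordered b).pos_of_mem_lengths hj]
      ring) a i
  simp only [vac]
  omega

theorem IsMove.addition_apply (hT : IsMove A H T) (hL : ∀ a, L a = L' a + H a)
    (h : ∀ a, (decrement (T a).lengths).map (fun i => (i, vac A L' nu a i)) ≤ nu a) (a : I) :
    addition A L' T nu a = nu a - (decrement (T a).lengths).map (fun i => (i, vac A L' nu a i)) +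
      (T a).lengths.map (fun i => (i, vac A L (addition A L' T nu) a i)) := by
  simp only [hT.vac_addition hL h]
  rfl

theorem IsMove.count_addition (hT : IsMove A H T) (hL : ∀ a, L a = L' a + H a)
    (h : ∀ a, (decrement (T a).lengths).map (fun i => (i, vac A L' nu a i)) ≤ nu a) (a : I)
    (i : ℕ) (c : ℤ) : (addition A L' T nu a).count (i, c) =
      (nu a).count (i, c) - (if c = vac A L' nu a i then (decrement (T a).lengths).count i else 0) +
      if c = vac A L (addition A L' T nu) a i then (T a).lengths.count i else 0 := by
  rw [hT.addition_apply hL h, Multiset.count_add, Multiset.count_sub, count_map_pair,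
    count_map_pair]

theorem IsMove.removal_addition (hT : IsMove A H T) (hL : ∀ a, L a = L' a + H a)
    (h : ∀ a, (decrement (T a).lengths).map (fun i => (i, vac A L' nu a i)) ≤ nu a) :
    removal A L L' T (addition A L' T nu) = nu := by
  have hle : ∀ a, (T a).lengths.map (fun i => (i, vac A L (addition A L' T nu) a i)) ≤
      addition A L' T nu a := fun a => by
    rw [hT.addition_apply hL h]
    exact Multiset.le_add_left _ _
  funext a
  have h1 : vac A L' (removal A L L' T (addition A L' T nu)) a = vac A L' nu a := by
    funext i
    rw [hT.vac_removal hL hle, hT.vac_addition hL h]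
    ring
  rw [removal_apply hle, h1, hT.addition_apply hL h, add_tsub_cancel_right,
    tsub_add_cancel_of_le (h a)]

/-- Adding boxes to the last singular strings yields a rigged configuration. -/
theorem IsMove.isRC_addition (hT : IsMove A H T) (hA : IsCartan A) (hL : ∀ a, L a = L' a + H a)
    (hnu : IsRC A L' mu nu) (hR : ∀ a, (T a).Addable (nu a) (vac A L' nu a)) {lam : I → ℕ}
    (hlam : ∀ a, (lam a : ℤ) = mu a - (T a).gainInf)
    (h1 : ∀ a, (T a).l ≠ ⊤ → (T a).v = ⊤ → 1 ≤ mu a)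
    (h2 : ∀ a, (T a).l' ≠ ⊤ → (T a).u' = ⊤ → 1 ≤ mu a) :
    IsRC A L lam (addition A L' T nu) ∧
      ∀ a, (T a).Removable (addition A L' T nu a) (vac A L (addition A L' T nu) a) := by
  have hle := fun a => (hR a).le
  have hv := hT.vac_addition hL hle
  have hconv := hT.convex_addition (L' := L') hA fun b => shape_le_of_le (hle b)
  -- On an unbounded interval the propagation of zeros is stopped by the weight, which is the
  -- eventual value of the vacancy numbers.
  have htop : ∀ a, 1 ≤ mu a → ∀ i, ∃ j, i ≤ j ∧ 1 ≤ vac A L' nu a j := by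
    intro a ha i
    obtain ⟨N, hN⟩ := hnu.vacancy_eventually
    refine ⟨i + N, by omega, ?_⟩
    have := hN (i + N) (by omega) a
    simp only [vac]
    omega
  have p1 := fun a => (hR a).one_le_fst (hT.ordered a) (hnu.rigging a) (hnu.vac_nonneg a) (hconv a)
    (fun c d => htop a (h2 a c d)) (fun c d => htop a (h1 a c d))
  have p2 := fun a => (hR a).one_le_snd (hT.ordered a) (hnu.rigging a) (hnu.vac_nonneg a) (hconv a)
    (fun c d => htop a (h2 a c d))
  have hnonneg : ∀ a i, 0 ≤ vac A L (addition A L' T nu) a i := by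
    intro a i
    have h0 := hnu.vac_nonneg a i
    rw [hv]
    rcases (hT.ordered a).gain_cases i with ⟨_, h⟩ | ⟨_, _, h⟩ | ⟨c1, c2, h⟩ | ⟨_, _, h⟩ |
      ⟨_, _, h⟩ | ⟨c1, c2, h⟩ | ⟨_, h⟩
    on_goal 3 => have := p1 a i c1 c2
    on_goal 6 => have := p2 a i c1 c2
    all_goals omega
  have hrig : ∀ a, ∀ i x, (i, x) ∈ nu a - (decrement (T a).lengths).map
      (fun i => (i, vac A L' nu a i)) → 0 ≤ x ∧ x ≤ vac A L (addition A L' T nu) a i := by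
    intro a i x hs
    have hs' := Multiset.mem_of_le tsub_le_self hs
    have h3 := hnu.rigging a _ hs'
    refine ⟨h3.1, ?_⟩
    change 0 ≤ x ∧ x ≤ vac A L' nu a i at h3
    rw [hv]
    have hi : 1 ≤ i := hnu.length_pos a _ hs'
    have hc := Multiset.one_le_count_iff_mem.2 hs
    rw [Multiset.count_sub, count_map_pair, count_decrement _ hi] at hc
    have h4 := (hR a).fst i
    have h5 := (hR a).snd i
    have h6 : (T a).l' = ((i + 1 : ℕ) : ℕ∞) → 1 ≤ (T a).lengths.count (i + 1) := fun h => by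
      rw [lengths, Multiset.count_add, count_finiteIndex, count_finiteIndex, hit_of_eq h]; omega
    -- Only a string that stays singular where the vacancy number drops could break its bound.
    -- `Addable` excludes it, except for one string of length `l' - 1`, which is itself lengthened.
    by_cases hx : x = vac A L' nu a i
    · rw [if_pos hx, hx] at hc
      rcases (hT.ordered a).gain_cases i with ⟨_, h⟩ | ⟨_, _, h⟩ | ⟨c1, c2, h⟩ | ⟨_, _, h⟩ |
        ⟨_, _, h⟩ | ⟨c1, c2, h⟩ | ⟨_, h⟩
      on_goal 6 => have := h5 c1 c2
      on_goal 3 =>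
        have := h4 c1 c2
        by_cases hl : (T a).l' = ((i + 1 : ℕ) : ℕ∞)
        · have := h6 hl
          have := hit_le_one (T a).l' (i + 1)
          omega
        · rw [hit_of_ne hl] at this
          omega
      all_goals omega
    · rcases (hT.ordered a).gain_cases i with ⟨_, h⟩ | ⟨_, _, h⟩ | ⟨c1, c2, h⟩ | ⟨_, _, h⟩ |
        ⟨_, _, h⟩ | ⟨c1, c2, h⟩ | ⟨_, h⟩ <;> omega
  refine ⟨⟨fun a s hs => ?_, weight_of_vacancy_eventually ?_, fun a i _ => hnonneg a i,
    fun a s hs => ?_⟩, fun a => ?_⟩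
  · rw [addition, Multiset.mem_add] at hs
    rcases hs with hs | hs
    · exact hnu.length_pos a s (Multiset.mem_of_le tsub_le_self hs)
    · obtain ⟨i, hi, rfl⟩ := Multiset.mem_map.1 hs
      exact (hT.ordered a).pos_of_mem_lengths hi
  · obtain ⟨N, hN⟩ := hnu.vacancy_eventually
    choose M hM using fun a => (T a).gain_eventually
    refine ⟨N + ∑ a, M a, fun i hi b => ?_⟩
    have h3 : M b ≤ ∑ a, M a :=
      Finset.single_le_sum (f := M) (fun _ _ => Nat.zero_le _) (Finset.mem_univ b)
    have := hv b i
    simp only [vac] at this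
    rw [this, hN i (by omega), hM b i (by omega), hlam]
  · rw [hT.addition_apply hL hle, Multiset.mem_add] at hs
    rcases hs with hs | hs
    · exact hrig a s.1 s.2 hs
    · obtain ⟨i, hi, rfl⟩ := Multiset.mem_map.1 hs
      exact ⟨hnonneg a i, le_rfl⟩
  -- At these lengths the enlarged configuration has larger vacancy numbers, so only the lengthened
  -- strings are singular.
  · have key : ∀ i, (T a).gain i = -1 →
        (addition A L' T nu a).count (i, vac A L (addition A L' T nu) a i) =
          (T a).lengths.count i := by
      intro i hi
      rw [hT.count_addition hL hle, if_pos rfl, if_neg (by rw [hv]; omega)]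
      have : (nu a).count (i, vac A L (addition A L' T nu) a i) = 0 := by
        rw [Multiset.count_eq_zero]
        intro hmem
        have h2 := (hnu.rigging a _ hmem).2
        change vac A L (addition A L' T nu) a i ≤ vac A L' nu a i at h2
        rw [hv] at h2
        omega
      omega
    have hO := hT.ordered a
    refine ⟨?_, fun i c1 c2 => ?_, fun i c1 c2 => ?_⟩
    · rw [hT.addition_apply hL hle]
      exact Multiset.le_add_left _ _
    · rcases hO.gain_cases i with ⟨d, h⟩ | ⟨_, d2, h⟩ | ⟨d, _, h⟩ | ⟨d, _, h⟩ |
        ⟨d, _, h⟩ | ⟨d, _, h⟩ | ⟨d, h⟩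
      · exact absurd c1 (not_le.2 d)
      · rw [key i h, lengths, Multiset.count_add, count_finiteIndex, count_finiteIndex, hit_of_ne,
          hit_of_ne]
        · intro h3
          exact absurd c2 (not_lt.2 (h3 ▸ (hO.lv.trans (hO.vv.trans hO.vl))))
        · exact ne_of_gt c2
      · exact absurd c2 (not_lt.2 d)
      · exact absurd c2 (not_lt.2 (hO.lv.trans d))
      · exact absurd c2 (not_lt.2 (hO.lv.trans (hO.vv.trans d)))
      · exact absurd c2 (not_lt.2 (hO.lv.trans (hO.vv.trans (hO.vl.trans d))))
      · exact absurd c2 (not_lt.2 (hO.lv.trans (hO.vv.trans (hO.vl.trans (hO.lu.trans d)))))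
    · rcases hO.gain_cases i with ⟨d, h⟩ | ⟨_, d, h⟩ | ⟨_, d, h⟩ | ⟨_, d, h⟩ |
        ⟨_, _, h⟩ | ⟨d, _, h⟩ | ⟨d, h⟩
      · exact absurd (hO.ul.trans (hO.lv.trans (hO.vv.trans c1))) (not_le.2 d)
      · exact absurd (hO.lv.trans (hO.vv.trans c1)) (not_le.2 d)
      · exact absurd (hO.vv.trans c1) (not_le.2 d)
      · exact absurd c1 (not_le.2 d)
      · rw [key i h, lengths, Multiset.count_add, count_finiteIndex, count_finiteIndex,
          hit_of_ne (t := (T a).l') (ne_of_gt c2), add_zero]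
      · exact absurd c2 (not_lt.2 d)
      · exact absurd c2 (not_lt.2 (hO.lu.trans d))

/-- A rigged configuration is determined by the result of a removal and the selected lengths. -/
theorem IsMove.addition_removal (hT : IsMove A H T) (hL : ∀ a, L a = L' a + H a) {nu : Rigged I}
    (h : ∀ a, (T a).lengths.map (fun i => (i, vac A L nu a i)) ≤ nu a) :
    addition A L' T (removal A L L' T nu) = nu := by
  funext a
  simp only [addition, hT.vac_removal hL h a, add_sub_cancel_right]
  have h1 := removal_apply (L' := L') h a
  simp only [hT.vac_removal hL h a] at h1
  rw [h1, add_tsub_cancel_right, tsub_add_cancel_of_le (h a)]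

end Addition

end Global

end PathRC

namespace PathRC

open Selection

/-! ## First and last lengths with a property -/

theorem le_leastFrom (m : ℕ∞) (p : ℕ → Prop) : m ≤ leastFrom m p := by
  refine le_sInf ?_
  rintro _ ⟨i, hi, rfl⟩
  exact hi.1

theorem leastFrom_spec {m : ℕ∞} {p : ℕ → Prop} {i : ℕ} (h : leastFrom m p = i) : p i := by
  have hne : ((fun i : ℕ => (i : ℕ∞)) '' {i | m ≤ i ∧ p i}).Nonempty := by
    by_contra hn
    rw [Set.not_nonempty_iff_eq_empty] at hn
    rw [leastFrom, hn, sInf_empty] at h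
    exact ENat.top_ne_natCast _ h
  obtain ⟨j, hj, hj'⟩ := csInf_mem hne
  change (j : ℕ∞) = leastFrom m p at hj'
  rw [h, Nat.cast_inj] at hj'
  exact hj' ▸ hj.2

theorem leastFrom_le {m : ℕ∞} {p : ℕ → Prop} {i : ℕ} (h1 : m ≤ i) (h2 : p i) :
    leastFrom m p ≤ i :=
  sInf_le ⟨i, ⟨h1, h2⟩, rfl⟩

theorem eq_leastFrom {m t : ℕ∞} {p : ℕ → Prop} (h1 : m ≤ t) (h2 : ∀ i : ℕ, t = i → p i)
    (h3 : ∀ i : ℕ, m ≤ i → i < t → ¬ p i) : t = leastFrom m p := by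
  refine le_antisymm (le_sInf ?_) ?_
  · rintro _ ⟨i, hi, rfl⟩
    by_contra hlt
    exact h3 i hi.1 (not_le.1 hlt) hi.2
  · induction t using ENat.recTopCoe with
    | top => exact le_top
    | coe t => exact leastFrom_le h1 (h2 t rfl)

/-- The smallest `s ≥ 1` such that no natural number in `[s, t)` has property `q`. -/
noncomputable def lastBelow (t : ℕ∞) (q : ℕ → Prop) : ℕ :=
  sInf {s | 1 ≤ s ∧ ∀ i : ℕ, s ≤ i → (i : ℕ∞) < t → ¬ q i}

section LastBelow

variable {t : ℕ∞} {q : ℕ → Prop}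

theorem lastBelow_mem (hq : ∃ N, ∀ i, N ≤ i → ¬ q i) :
    1 ≤ lastBelow t q ∧ ∀ i : ℕ, lastBelow t q ≤ i → (i : ℕ∞) < t → ¬ q i := by
  obtain ⟨N, hN⟩ := hq
  exact Nat.sInf_mem (s := {s | 1 ≤ s ∧ ∀ i : ℕ, s ≤ i → (i : ℕ∞) < t → ¬ q i})
    ⟨N + 1, by omega, fun i hi _ => hN i (by omega)⟩

theorem lastBelow_le (ht : 1 ≤ t) : (lastBelow t q : ℕ∞) ≤ t := by
  induction t using ENat.recTopCoe with
  | top => exact le_top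
  | coe t =>
    rw [Nat.cast_le]
    refine Nat.sInf_le ⟨by exact_mod_cast ht, fun i hi hi' => ?_⟩
    rw [Nat.cast_lt] at hi'
    omega

/-- If `q i` failed, `i` itself would be an admissible bound. A value `i + 1` with `i ≥ 1` stands
for lengthening a string of length `i`; the value `1` stands for creating a string and needs no
property. -/
theorem lastBelow_spec (hq : ∃ N, ∀ i, N ≤ i → ¬ q i) {i : ℕ} (hi : 1 ≤ i)
    (h : lastBelow t q = i + 1) : q i := by
  by_contra hn
  have h1 := lastBelow_mem (t := t) hq
  have : lastBelow t q ≤ i := Nat.sInf_le ⟨hi, fun j hj hj' => by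
    rcases hj.eq_or_lt with rfl | hlt
    · exact hn
    · exact h1.2 j (by omega) hj'⟩
  omega

end LastBelow

theorem eventually_count_eq_zero (S : Multiset (ℕ × ℤ)) (p : ℕ → ℤ) :
    ∃ N, ∀ i, N ≤ i → S.count (i, p i) = 0 := by
  refine ⟨(S.map Prod.fst).sum + 1, fun i hi => ?_⟩
  rw [Multiset.count_eq_zero]
  intro h
  have := Multiset.le_sum_of_mem (Multiset.mem_map_of_mem Prod.fst h)
  simp only at this
  omega

theorem map_pair_le_iff {M : Multiset ℕ} {S : Multiset (ℕ × ℤ)} {p : ℕ → ℤ} :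
    M.map (fun i => (i, p i)) ≤ S ↔ ∀ i, M.count i ≤ S.count (i, p i) := by
  rw [Multiset.le_iff_count]
  constructor
  · intro h i
    have := h (i, p i)
    rwa [count_map_pair, if_pos rfl] at this
  · rintro h ⟨i, x⟩
    rw [count_map_pair]
    split_ifs with hx
    · exact hx ▸ h i
    · exact Nat.zero_le _

theorem Selection.map_lengths_le_iff {T : Selection} {S : Multiset (ℕ × ℤ)} {p : ℕ → ℤ} :
    T.lengths.map (fun i => (i, p i)) ≤ S ↔
      ∀ i : ℕ, hit T.l i + hit T.l' i ≤ S.count (i, p i) := by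
  simp only [map_pair_le_iff, lengths, Multiset.count_add, count_finiteIndex]

theorem Selection.count_decrement_lengths (T : Selection) (i : ℕ) :
    (decrement T.lengths).count i = if 1 ≤ i then hit T.l (i + 1) + hit T.l' (i + 1) else 0 := by
  split_ifs with hi
  · rw [count_decrement _ hi, lengths, Multiset.count_add, count_finiteIndex, count_finiteIndex]
  · rw [Multiset.count_eq_zero]
    exact fun h => hi (pos_of_mem_decrement h)

theorem Selection.map_decrement_lengths_le_iff {T : Selection} {S : Multiset (ℕ × ℤ)}
    {p : ℕ → ℤ} : (decrement T.lengths).map (fun i => (i, p i)) ≤ S ↔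
      ∀ i : ℕ, 1 ≤ i → hit T.l (i + 1) + hit T.l' (i + 1) ≤ S.count (i, p i) := by
  simp only [map_pair_le_iff, count_decrement_lengths]
  refine forall_congr' fun i => ?_
  by_cases hi : 1 ≤ i <;> simp [hi]

/-- The array of the single box that is removed from `L` by a left hat. -/
def hatArray (n : ℕ) (a : Node n) : Multiset ℕ := if a.1 = 1 then {1} else 0

theorem lhArray_add_hatArray {n : ℕ} {L : Node n → Multiset ℕ}
    (h : ∀ a : Node n, a.1 = 1 → 1 ∈ L a) (a : Node n) : L a = lhArray L a + hatArray n a := by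
  unfold lhArray hatArray
  split_ifs with ha
  · rw [add_comm, Multiset.singleton_add, Multiset.cons_erase (h a ha)]
  · simp

theorem countP_hatArray {n : ℕ} (a : Node n) (i : ℕ) :
    ((hatArray n a).countP (· ≤ i) : ℤ) = if a.1 = 1 then step 1 i else 0 := by
  unfold hatArray step
  have : ({1} : Multiset ℕ) = 1 ::ₘ 0 := rfl
  split_ifs with ha h1
  · rw [this, Multiset.countP_cons]; simp at h1 ⊢; omega
  · rw [this, Multiset.countP_cons]; simp at h1 ⊢; omega
  · simp

theorem eq_one_of_mem_hatArray {n : ℕ} (a : Node n) : ∀ j ∈ hatArray n a, j = 1 := by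
  unfold hatArray
  split_ifs <;> simp

theorem singCount_eq {n : ℕ} (A : Node n → Node n → ℤ) (L : Node n → Multiset ℕ)
    (nu : Rigged (Node n)) (a : Node n) (i : ℕ) :
    singCount A L nu a i = (nu a).count (i, vac A L nu a i) := by
  simp [singCount, a.2, vac]

theorem singCount_of_not_mem {n : ℕ} (A : Node n → Node n → ℤ) (L : Node n → Multiset ℕ)
    (nu : Rigged (Node n)) {a : ℕ} (h : a ∉ Finset.Icc 1 n) (i : ℕ) :
    singCount A L nu a i = 0 := by
  simp only [singCount, dif_neg h]

theorem Selection.countP_lengths (T : Selection) (i : ℕ) :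
    (T.lengths.countP (· ≤ i) : ℤ) = step T.l i + step T.l' i := by
  simp only [lengths, Multiset.countP_add, countP_finiteIndex, step]
  push_cast
  rfl

@[simp] theorem step_top (i : ℕ) : step ⊤ i = 0 := by simp [step]

theorem finiteIndex_top : finiteIndex ⊤ = 0 := by simp [finiteIndex]

end PathRC

namespace PathRC

open Selection

namespace TypeA

/-! ## The left hat map on rigged configurations in type `A` -/

variable {n : ℕ}

/-- The function lives on all natural numbers so that neighbours are reached by arithmetic; its
values at the missing nodes `0` and `n + 1` are cut off. -/
theorem sum_cartan (g : ℕ → ℤ) (a : Node n) :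
    ∑ b : Node n, cartan n a b * g b =
      2 * g a - (if a.1 = 1 then 0 else g (a - 1)) - (if a.1 = n then 0 else g (a + 1)) := by
  have ha := Finset.mem_Icc.1 a.2
  have h1 : ∀ b : Node n, cartan n a b * g b =
      (if a.1 = b.1 then 2 * g a else 0) - (if a.1 - 1 = b.1 then g (a - 1) else 0) -
        (if a.1 + 1 = b.1 then g (a + 1) else 0) := by
    intro b
    have hb := Finset.mem_Icc.1 b.2
    simp only [cartan, Subtype.ext_iff]
    by_cases c1 : a.1 = b.1
    · rw [if_pos c1, if_pos c1, if_neg (by omega), if_neg (by omega), c1]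
      ring
    by_cases c2 : a.1 - 1 = b.1
    · rw [if_neg c1, if_pos (by omega), if_neg c1, if_pos c2, if_neg (by omega), c2]
      ring
    by_cases c3 : a.1 + 1 = b.1
    · rw [if_neg c1, if_pos (by omega), if_neg c1, if_neg c2, if_pos c3, c3]
      ring
    · rw [if_neg c1, if_neg (by omega), if_neg c1, if_neg c2, if_neg c3]
      ring
  rw [Finset.sum_congr rfl fun b _ => h1 b]
  have h2 : ∀ (k : ℕ) (z : ℤ), ∑ b : Node n, (if k = b.1 then z else 0) =
      if k ∈ Finset.Icc 1 n then z else 0 := by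
    intro k z
    rw [Finset.sum_coe_sort (Finset.Icc 1 n) (fun b => if k = b then z else 0), Finset.sum_ite_eq]
  rw [Finset.sum_sub_distrib, Finset.sum_sub_distrib, h2, h2, h2]
  simp only [Finset.mem_Icc]
  rw [if_pos ha]
  by_cases c1 : a.1 = 1
  · rw [if_pos c1, if_neg (by omega)]
    by_cases c2 : a.1 = n
    · rw [if_pos c2, if_neg (by omega)]
    · rw [if_neg c2, if_pos (by omega)]
  · rw [if_neg c1, if_pos (by omega)]
    by_cases c2 : a.1 = n
    · rw [if_pos c2, if_neg (by omega)]
    · rw [if_neg c2, if_pos (by omega)]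

theorem isCartan_cartan (n : ℕ) : IsCartan (cartan n) where
  diag a := by simp [cartan]
  offdiag a b h := by
    simp only [cartan, if_neg h]
    split_ifs <;> simp

/-- The selection at the node `a` for the selected lengths `e`. -/
def selection (e : ℕ → ℕ∞) (a : Node n) : Selection := ⟨e (a - 1), e a, e (a + 1), ⊤, ⊤, ⊤⟩

theorem lengths_selection (e : ℕ → ℕ∞) (a : Node n) :
    (selection e a).lengths = finiteIndex (e a) := by
  simp [selection, lengths, finiteIndex_top]

/-- A weakly increasing sequence of lengths that starts with `1` and ends with `∞`. -/
structure IsChain (n : ℕ) (e : ℕ → ℕ∞) : Prop where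
  zero : e 0 = 1
  mono : ∀ a, e a ≤ e (a + 1)
  top : ∀ a, n < a → e a = ⊤

theorem IsChain.monotone {e : ℕ → ℕ∞} (h : IsChain n e) : Monotone e :=
  monotone_nat_of_le_succ h.mono

theorem IsChain.one_le {e : ℕ → ℕ∞} (h : IsChain n e) (a : ℕ) : 1 ≤ e a :=
  h.zero ▸ h.monotone (Nat.zero_le a)

theorem IsChain.ordered {e : ℕ → ℕ∞} (h : IsChain n e) (a : Node n) :
    (selection e a).Ordered where
  one_le := h.one_le _
  ul := h.monotone (Nat.sub_le _ _)
  lv := h.mono _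
  vv := le_top
  vl := le_top
  lu := le_top

/-- The hat box acts as a neighbour at node `0` that loses a box from length `e 0 = 1`, and the
missing node `n + 1` acts as a neighbour with length `∞`. Hence the gain has the same form at all
nodes. -/
theorem IsChain.isMove {e : ℕ → ℕ∞} (h : IsChain n e) :
    IsMove (cartan n) (hatArray n) (selection e) where
  ordered := h.ordered
  hat := eq_one_of_mem_hatArray
  compat a i := by
    have ha := Finset.mem_Icc.1 a.2
    have h1 : ∀ b : Node n, ((selection e b).lengths.countP (· ≤ i) : ℤ) = step (e b) i :=
      fun b => by rw [countP_lengths]; simp [selection]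
    simp only [h1, countP_hatArray, gain]
    rw [sum_cartan (fun b => step (e b) i)]
    have h2 : (if a.1 = n then 0 else step (e (a + 1)) i) = step (e (a + 1)) i := by
      split_ifs with hn
      · rw [h.top _ (by omega), step_top]
      · rfl
    rw [h2]
    simp only [selection, step_top]
    split_ifs with h1
    · have : a.1 - 1 = 0 := by omega
      rw [this, h.zero]
      ring
    · ring

/-- The letter `x` is the one that is removed if the selected lengths are `e`. -/
def IsLetter (e : ℕ → ℕ∞) (x : Node (n + 1)) : Prop := ∀ a, e a ≠ ⊤ ↔ a < x.1

/-- The letter is the first index at which the chain is infinite; the two ends of the chain confine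
it to `1, …, n + 1`. -/
theorem IsChain.exists_isLetter {e : ℕ → ℕ∞} (h : IsChain n e) :
    ∃ x : Node (n + 1), IsLetter e x := by
  classical
  have hex : ∃ a, e a = ⊤ := ⟨n + 1, h.top _ (Nat.lt_succ_self n)⟩
  have h1 : Nat.find hex ≤ n + 1 := Nat.find_min' hex (h.top _ (Nat.lt_succ_self n))
  have h0 : Nat.find hex ≠ 0 := by
    intro h0
    have := Nat.find_spec hex
    rw [h0, h.zero] at this
    exact absurd this (by simp)
  refine ⟨⟨Nat.find hex, Finset.mem_Icc.2 ⟨by omega, h1⟩⟩, fun a => ⟨fun ha => ?_, fun ha => ?_⟩⟩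
  · by_contra hlt
    have := h.monotone (not_lt.1 hlt)
    rw [Nat.find_spec hex, top_le_iff] at this
    exact ha this
  · exact Nat.find_min hex ha

theorem IsLetter.unique {e : ℕ → ℕ∞} {x y : Node (n + 1)} (hx : IsLetter e x)
    (hy : IsLetter e y) : x = y := by
  have h : ∀ a, a < x.1 ↔ a < y.1 := fun a => (hx a).symm.trans (hy a)
  have h1 := h x.1
  have h2 := h y.1
  exact Subtype.ext (by omega)

theorem wt_letters (x : Node (n + 1)) (a : Node n) :
    (letters n).wt x a = (if x.1 = a.1 then 1 else 0) - (if x.1 = a.1 + 1 then 1 else 0) := by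
  simp [Crystal.wt, letters]

theorem IsLetter.gainInf {e : ℕ → ℕ∞} {x : Node (n + 1)} (hx : IsLetter e x) (a : Node n) :
    (selection e a).gainInf = -(letters n).wt x a := by
  have ha := Finset.mem_Icc.1 a.2
  have h1 : ∀ b, fin (e b) = if b < x.1 then 1 else 0 := by
    intro b
    rw [fin]
    have := hx b
    by_cases hb : e b = ⊤
    · rw [if_pos hb, if_neg fun h => this.2 h hb]
    · rw [if_neg hb, if_pos (this.1 hb)]
  simp only [Selection.gainInf, selection, h1, wt_letters]
  simp only [fin, if_true]
  split_ifs <;> omega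

section Delta

variable {L : Node n → Multiset ℕ} {lam mu : Node n → ℕ} {nu : Rigged (Node n)}

theorem isChain_ell (A : Node n → Node n → ℤ) (L : Node n → Multiset ℕ) (nu : Rigged (Node n)) :
    IsChain n (ell A L nu) where
  zero := rfl
  mono a := le_leastFrom _ _
  top a ha := by
    obtain _ | a := a
    · omega
    · refine (eq_leastFrom le_top (fun i hi => absurd hi (ENat.top_ne_natCast i))
        fun i _ _ => ?_).symm
      rw [singCount_of_not_mem _ _ _ (by simp; omega)]
      omega

theorem removable_ell (A : Node n → Node n → ℤ) (L : Node n → Multiset ℕ) (nu : Rigged (Node n))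
    (a : Node n) : (selection (ell A L nu) a).Removable (nu a) (vac A L nu a) := by
  obtain ⟨a, ha⟩ := a
  have ha' := Finset.mem_Icc.1 ha
  obtain _ | a := a
  · omega
  refine ⟨map_lengths_le_iff.2 fun i => ?_, fun i h1 h2 => ?_, fun i h1 => ?_⟩
  · simp only [selection, hit_top, add_zero]
    by_cases h : ell A L nu (a + 1) = i
    · have := leastFrom_spec h
      rw [singCount_eq A L nu ⟨a + 1, ha⟩] at this
      rwa [hit_of_eq h]
    · rw [hit_of_ne h]
      exact Nat.zero_le _
  · by_contra hne
    refine absurd h2 (not_lt.2 (leastFrom_le h1 ?_))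
    rw [singCount_eq A L nu ⟨a + 1, ha⟩]
    omega
  · exact absurd h1 (by simp [selection])

/-- The selected lengths are characterized by the choice of the first singular strings. -/
theorem eq_ell {A : Node n → Node n → ℤ} {e : ℕ → ℕ∞} (he : IsChain n e)
    (hR : ∀ a, (selection e a).Removable (nu a) (vac A L nu a)) : e = ell A L nu := by
  funext a
  induction a with
  | zero => exact he.zero
  | succ a ih =>
    by_cases ha : a + 1 ≤ n
    · have h := hR ⟨a + 1, Finset.mem_Icc.2 ⟨by omega, ha⟩⟩
      rw [ell, ← ih]
      refine eq_leastFrom (he.mono a) (fun i hi => ?_) fun i h1 h2 => ?_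
      · have := map_lengths_le_iff.1 h.le i
        rw [singCount_eq A L nu ⟨a + 1, Finset.mem_Icc.2 ⟨by omega, ha⟩⟩]
        simp only [selection] at this
        rw [hit_of_eq hi] at this
        omega
      · rw [singCount_eq A L nu ⟨a + 1, Finset.mem_Icc.2 ⟨by omega, ha⟩⟩, h.fst i h1 h2]
        omega
    · rw [he.top _ (by omega), (isChain_ell A L nu).top _ (by omega)]

theorem deltaA_eq_removal (A : Node n → Node n → ℤ) (L : Node n → Multiset ℕ)
    (nu : Rigged (Node n)) :
    deltaA A L nu = removal A L (lhArray L) (selection (ell A L nu)) nu := by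
  simp only [deltaA, removal, lengths_selection]

theorem exists_isRC_deltaA (hL : ∀ a : Node n, a.1 = 1 → 1 ∈ L a)
    (h : IsRC (cartan n) L lam nu) {x : Node (n + 1)} (hx : IsLetter (ell (cartan n) L nu) x) :
    ∃ mu, IsRC (cartan n) (lhArray L) mu (deltaA (cartan n) L nu) ∧
      (∀ a, (mu a : ℤ) + (letters n).wt x a = lam a) ∧ ∀ a, (letters n).eps a x ≤ mu a := by
  have hM := (isChain_ell (cartan n) L nu).isMove
  have hR := removable_ell (cartan n) L nu
  have hL' := lhArray_add_hatArray hL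
  have h0 := hM.weight_nonneg (isCartan_cartan n) hL' h hR
  refine ⟨fun a => (lam a + (selection (ell (cartan n) L nu) a).gainInf : ℤ).toNat, ?_,
    fun a => ?_, fun a => ?_⟩
  · rw [deltaA_eq_removal]
    exact hM.isRC_removal (isCartan_cartan n) hL' h hR fun a => Int.toNat_of_nonneg (h0 a)
  · rw [Int.toNat_of_nonneg (h0 a), hx.gainInf]
    ring
  · have h1 := h0 a
    beta_reduce
    rw [hx.gainInf, wt_letters] at h1 ⊢
    simp only [letters]
    split_ifs at h1 ⊢ <;> omega

/-- An unbounded interval on which boxes are added occurs only at the node `x - 1`. This is where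
`ε_a(x) = 1`, so `ε_a(x) ≤ μ_a` is precisely the positivity that the inverse of `δ̄` requires. -/
theorem mem_selection_of_isLetter {e : ℕ → ℕ∞} {x : Node (n + 1)} (hx : IsLetter e x)
    {a : Node n} (h1 : (selection e a).l ≠ ⊤) (h2 : (selection e a).v = ⊤) : x.1 = a.1 + 1 := by
  have h3 := (hx a).1 h1
  have h4 := mt (hx (a + 1)).2 (not_not.2 h2)
  omega

/-- A greedy choice from node `x - 1` down to node `1`: each node takes the last singular string
that is shorter than the length chosen at the next node, or creates a string if there is none. -/
theorem exists_addable (nu : Rigged (Node n)) (p : Node n → ℕ → ℤ) (x : Node (n + 1)) :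
    ∃ e : ℕ → ℕ∞, IsChain n e ∧ IsLetter e x ∧ ∀ a, (selection e a).Addable (nu a) (p a) := by
  have hx := Finset.mem_Icc.1 x.2
  let q : ℕ → ℕ → Prop := fun a i =>
    ∃ h : a ∈ Finset.Icc 1 n, 1 ≤ (nu ⟨a, h⟩).count (i, p ⟨a, h⟩ i)
  have hq : ∀ a, ∃ N, ∀ i, N ≤ i → ¬ q a i := by
    intro a
    by_cases h : a ∈ Finset.Icc 1 n
    · obtain ⟨N, hN⟩ := eventually_count_eq_zero (nu ⟨a, h⟩) (p ⟨a, h⟩)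
      exact ⟨N, fun i hi ⟨_, h'⟩ => by rw [hN i hi] at h'; omega⟩
    · exact ⟨0, fun i _ ⟨h', _⟩ => h h'⟩
  -- `f k` is the length at the node `x - k`; the initial value `∞` belongs to the node `x` itself.
  let f : ℕ → ℕ∞ := fun k =>
    Nat.rec ⊤ (fun j t => ((lastBelow t (q (x.1 - 1 - j)) : ℕ) : ℕ∞)) k
  have f1 : ∀ k, f (k + 1) = ((lastBelow (f k) (q (x.1 - 1 - k)) : ℕ) : ℕ∞) := fun k => rfl
  have f0 : ∀ k, 1 ≤ f k := by
    intro k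
    obtain _ | k := k
    · exact le_top
    · rw [f1]
      exact_mod_cast (lastBelow_mem (t := f k) (hq _)).1
  have f2 : ∀ k, f (k + 1) ≤ f k := fun k => by
    rw [f1]
    exact lastBelow_le (f0 k)
  let e : ℕ → ℕ∞ := fun a => if a = 0 then 1 else f (x.1 - a)
  have e1 : ∀ a, 1 ≤ a → e a = f (x.1 - a) := fun a ha => if_neg (by omega)
  have hletter : IsLetter e x := by
    intro a
    obtain rfl | ha := Nat.eq_zero_or_pos a
    · simp only [e, if_true]
      simp only [ne_eq, ENat.one_ne_top, not_false_eq_true, true_iff]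
      omega
    · rw [e1 a ha]
      by_cases hlt : a < x.1
      · obtain ⟨k, hk⟩ : ∃ k, x.1 - a = k + 1 := ⟨x.1 - a - 1, by omega⟩
        rw [hk, f1]
        simp [hlt]
      · have : x.1 - a = 0 := by omega
        rw [this]
        simp only [hlt, iff_false, not_not]
        rfl
  have hchain : IsChain n e := by
    refine ⟨rfl, fun a => ?_, fun a ha => ?_⟩
    · rw [e1 (a + 1) (by omega)]
      obtain rfl | ha := Nat.eq_zero_or_pos a
      · exact f0 _
      · rw [e1 a ha]
        by_cases hlt : a < x.1
        · have : x.1 - a = (x.1 - (a + 1)) + 1 := by omega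
          rw [this]
          exact f2 _
        · have h1 : x.1 - a = 0 := by omega
          have h2 : x.1 - (a + 1) = 0 := by omega
          rw [h1, h2]
    · have h1 := mt (hletter a).1 (by omega)
      exact not_not.1 h1
  refine ⟨e, hchain, hletter, fun a => ?_⟩
  have ha := Finset.mem_Icc.1 a.2
  have step : a.1 < x.1 → e a = ((lastBelow (e (a + 1)) (q a) : ℕ) : ℕ∞) := by
    intro hlt
    have : x.1 - a = (x.1 - (a + 1)) + 1 := by omega
    rw [e1 _ ha.1, e1 _ (by omega), this, f1]
    congr 3
    omega
  refine ⟨map_decrement_lengths_le_iff.2 fun i hi => ?_, fun i h1 h2 => ?_, fun i h1 => ?_⟩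
  · simp only [selection, hit_top, add_zero]
    by_cases h : e a = ((i + 1 : ℕ) : ℕ∞)
    · have hlt : a.1 < x.1 := (hletter a).1 (by rw [h]; exact ENat.natCast_ne_top _)
      rw [hit_of_eq h]
      rw [step hlt, Nat.cast_inj] at h
      exact (lastBelow_spec (hq _) hi h).2
    · rw [hit_of_ne h]
      exact Nat.zero_le _
  · have hlt : a.1 < x.1 := (hletter a).1 fun h => by simp [selection, h] at h1
    simp only [selection] at h1 h2
    rw [step hlt, Nat.cast_le] at h1
    have := (lastBelow_mem (hq a.1)).2 i h1 h2
    by_contra hne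
    refine this ⟨a.2, ?_⟩
    exact lt_of_le_of_lt (Nat.zero_le _) (not_le.1 hne)
  · exact absurd h1 (by simp [selection])

theorem exists_deltaA_eq (hL : ∀ a : Node n, a.1 = 1 → 1 ∈ L a)
    (h : IsRC (cartan n) (lhArray L) mu nu) {x : Node (n + 1)}
    (hlam : ∀ a, (mu a : ℤ) + (letters n).wt x a = lam a) (hmu : ∀ a, (letters n).eps a x ≤ mu a) :
    ∃ rho, IsRC (cartan n) L lam rho ∧ deltaA (cartan n) L rho = nu ∧
      IsLetter (ell (cartan n) L rho) x := by
  obtain ⟨e, he, hx, hadd⟩ := exists_addable nu (vac (cartan n) (lhArray L) nu) x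
  have hM := he.isMove
  have hL' := lhArray_add_hatArray hL
  have heps : ∀ a, (selection e a).l ≠ ⊤ → (selection e a).v = ⊤ → 1 ≤ mu a := fun a h1 h2 => by
    have h3 := mem_selection_of_isLetter hx h1 h2
    have := hmu a
    simpa [letters, h3] using this
  obtain ⟨h1, h2⟩ := hM.isRC_addition (isCartan_cartan n) hL' h hadd (lam := lam)
    (fun a => by rw [hx.gainInf, ← hlam]; ring) heps fun a ht => absurd rfl ht
  have h3 := eq_ell he h2
  refine ⟨_, h1, ?_, h3 ▸ hx⟩
  rw [deltaA_eq_removal, ← h3]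
  exact hM.removal_addition hL' fun a => (hadd a).le

/-- The lengths of the strings to which boxes are added are determined by the letter. -/
theorem eq_of_addable {p : Node n → ℕ → ℤ} {e e' : ℕ → ℕ∞} (he : IsChain n e) (he' : IsChain n e')
    {x : Node (n + 1)} (hx : IsLetter e x) (hx' : IsLetter e' x)
    (h : ∀ a, (selection e a).Addable (nu a) (p a))
    (h' : ∀ a, (selection e' a).Addable (nu a) (p a)) : e = e' := by
  have main : ∀ {e e' : ℕ → ℕ∞}, IsChain n e → IsChain n e' → IsLetter e x → IsLetter e' x →
      (∀ a, (selection e a).Addable (nu a) (p a)) → (∀ a, (selection e' a).Addable (nu a) (p a)) →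
      ∀ a, 1 ≤ a → a ≤ n → e (a + 1) = e' (a + 1) → e' a ≤ e a := by
    -- If `e a < e' a = i + 1`, the choice `e'` lengthens a singular string of length `i` in `[e a,
    -- e (a + 1))`, where `e` admits none. Together with the common value `∞` beyond `n`, this
    -- determines the chain from the top node downwards.
    intro e e' he he' hx hx' h h' a h1 h2 h3
    by_contra hlt
    rw [not_le] at hlt
    have hfin : e' a ≠ ⊤ := (hx' a).2 ((hx a).1 (ne_top_of_lt hlt))
    obtain ⟨i, hi⟩ := ENat.ne_top_iff_exists.1 hfin
    obtain _ | i := i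
    · exact absurd (hi ▸ he'.one_le a) (by simp)
    have c1 := (h ⟨a, Finset.mem_Icc.2 ⟨h1, h2⟩⟩).fst i
    have c2 := map_decrement_lengths_le_iff.1 (h' ⟨a, Finset.mem_Icc.2 ⟨h1, h2⟩⟩).le i
    simp only [selection, hit_top, add_zero, hit_of_eq hi.symm] at c1 c2
    have c3 : e a ≤ i := by
      rw [← hi] at hlt
      push_cast at hlt
      exact Order.le_of_lt_add_one hlt
    have c4 : (i : ℕ∞) < e (a + 1) := by
      rw [h3]
      refine lt_of_lt_of_le ?_ (hi ▸ he'.mono a)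
      exact_mod_cast Nat.lt_succ_self i
    have := c1 c3 c4
    have hi1 : 1 ≤ i := by exact_mod_cast (he.one_le a).trans c3
    have := c2 hi1
    omega
  have all : ∀ k a, a + k = n + 1 → e a = e' a := by
    intro k
    induction k with
    | zero =>
      intro a ha
      rw [he.top _ (by omega), he'.top _ (by omega)]
    | succ k ih =>
      intro a ha
      obtain rfl | h1 := Nat.eq_zero_or_pos a
      · rw [he.zero, he'.zero]
      · exact le_antisymm (main he' he hx' hx h' h a h1 (by omega) (ih _ (by omega)).symm)
          (main he he' hx hx' h h' a h1 (by omega) (ih _ (by omega)))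
  funext a
  by_cases ha : a ≤ n + 1
  · exact all (n + 1 - a) a (by omega)
  · rw [he.top _ (by omega), he'.top _ (by omega)]

theorem addable_deltaA (hL : ∀ a : Node n, a.1 = 1 → 1 ∈ L a)
    (h : IsRC (cartan n) L lam nu) (a : Node n) :
    (selection (ell (cartan n) L nu) a).Addable (deltaA (cartan n) L nu a)
      (vac (cartan n) (lhArray L) (deltaA (cartan n) L nu) a) := by
  rw [deltaA_eq_removal]
  exact (isChain_ell (cartan n) L nu).isMove.addable_removal (lhArray_add_hatArray hL) h
    (removable_ell (cartan n) L nu) a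

/-- The common image and letter determine the selected lengths, and adding the boxes back recovers
both configurations. -/
theorem deltaA_injective (hL : ∀ a : Node n, a.1 = 1 → 1 ∈ L a) {nu' : Rigged (Node n)}
    {lam' : Node n → ℕ} (h : IsRC (cartan n) L lam nu) (h' : IsRC (cartan n) L lam' nu')
    {x : Node (n + 1)}
    (hx : IsLetter (ell (cartan n) L nu) x) (hx' : IsLetter (ell (cartan n) L nu') x)
    (heq : deltaA (cartan n) L nu = deltaA (cartan n) L nu') : nu = nu' := by
  have h1 := addable_deltaA hL h
  have h2 := addable_deltaA hL h'
  rw [← heq] at h2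
  have he := eq_of_addable (isChain_ell _ _ _) (isChain_ell _ _ _) hx hx' h1 h2
  have hL' := lhArray_add_hatArray hL
  rw [← (isChain_ell (cartan n) L nu).isMove.addition_removal hL'
    (fun a => (removable_ell (cartan n) L nu a).le), ← deltaA_eq_removal, heq,
    deltaA_eq_removal, he]
  exact (isChain_ell (cartan n) L nu').isMove.addition_removal hL'
    (fun a => (removable_ell (cartan n) L nu' a).le)

end Delta

end TypeA

end PathRC

namespace PathRC

namespace TypeA

/-! ## Removal of a column -/

/-- The singular strings before and after the removal of the bottommost entry of a column of height
`k`: the numbers of singular strings of length `i` at the node `a` are `s a i` and `s' a i`, and `e`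
are the selected lengths. -/
structure ColStep (n k : ℕ) (s s' : ℕ → ℕ → ℕ) (e : ℕ → ℕ∞) : Prop where
  chain : IsChain n e
  one : ∀ a, a < k → e a = 1
  sing : ∀ a (i : ℕ), k ≤ a → a ≤ n → e a = i → 1 ≤ s a i
  least : ∀ a (i : ℕ), k ≤ a → a ≤ n → e (a - 1) ≤ i → 1 ≤ s a i → e a ≤ i
  gap : ∀ a (i : ℕ), 1 ≤ a → a ≤ n → e a ≤ i → i < e (a + 1) → s' a i = 0
  persist : ∀ a (i : ℕ), 1 ≤ a → a ≤ n → 1 ≤ i → (i < e (a - 1) ∨ e (a + 1) ≤ i) →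
    s' a i + (if k ≤ a then hit (e a) i else 0) = s a i + hit (e a) (i + 1)
  new : ∀ a (i : ℕ), 1 ≤ a → a ≤ n → 1 ≤ i → e a = ((i + 1 : ℕ) : ℕ∞) → 1 ≤ s' a i

variable {n : ℕ}

theorem exists_eq_succ_of_one_le {t : ℕ∞} (h : 1 ≤ t) (ht : t ≠ ⊤) :
    ∃ i : ℕ, t = ((i + 1 : ℕ) : ℕ∞) := by
  obtain ⟨m, hm⟩ := ENat.ne_top_iff_exists.1 ht
  rw [← hm] at h ⊢
  have : 1 ≤ m := by exact_mod_cast h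
  exact ⟨m - 1, by rw [Nat.cast_inj]; omega⟩

/-- The first removal leaves no singular strings of length in `[e (a + 1), e (a + 2))` at node `a +
1`. Once the second removal starts at or above the lower bound there, it must select beyond the
upper bound. In terms of letters this is strict increase along a column. -/
theorem ColStep.interlace {k : ℕ} (hk : 1 ≤ k) {s s' s'' : ℕ → ℕ → ℕ} {e e' : ℕ → ℕ∞}
    (h : ColStep n (k + 1) s s' e) (h' : ColStep n k s' s'' e') (a : ℕ) : e (a + 1) ≤ e' a := by
  induction a with
  | zero => rw [h.one _ (by omega)]; exact h'.chain.one_le 0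
  | succ a ih =>
    by_cases c1 : a + 1 < k
    · rw [h.one _ (by omega)]
      exact h'.chain.one_le _
    by_cases c2 : a + 1 ≤ n
    · by_contra hlt
      rw [not_le] at hlt
      obtain ⟨i, hi⟩ := ENat.ne_top_iff_exists.1 (ne_top_of_lt hlt)
      have h1 := h'.sing (a + 1) i (by omega) c2 hi.symm
      have h2 := h.gap (a + 1) i (by omega) c2
        (ih.trans (hi ▸ h'.chain.mono a)) (hi ▸ hlt)
      omega
    · rw [h'.chain.top _ (by omega)]
      exact le_top

/-- The removal of a whole column of height `r`. -/
def ColChain (n r : ℕ) (S : ℕ → ℕ → ℕ → ℕ) (E : ℕ → ℕ → ℕ∞) : Prop :=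
  ∀ k, 1 ≤ k → k ≤ r → ColStep n k (S k) (S (k - 1)) (E k)

section ColChain

variable {r : ℕ} {S S' : ℕ → ℕ → ℕ → ℕ} {E F : ℕ → ℕ → ℕ∞}

theorem ColChain.interlace (h : ColChain n r S E) {k : ℕ} (h1 : 1 ≤ k) (h2 : k + 1 ≤ r) (a : ℕ) :
    E (k + 1) (a + 1) ≤ E k a :=
  ColStep.interlace h1 (h (k + 1) (by omega) h2) (h k h1 (by omega)) a

theorem ColChain.antitone (h : ColChain n r S E) {j k : ℕ} (h1 : 1 ≤ j) (h2 : j ≤ k) (h3 : k ≤ r)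
    (a : ℕ) : E k a ≤ E j a := by
  induction k, h2 using Nat.le_induction with
  | base => exact le_rfl
  | succ k hk ih =>
    exact (((h (k + 1) (by omega) h3).chain.mono a).trans (h.interlace (by omega) h3 a)).trans
      (ih (by omega))

theorem ColChain.le_of_lt (h : ColChain n r S E) {j k : ℕ} (h1 : 1 ≤ j) (h2 : j < k) (h3 : k ≤ r)
    (a : ℕ) : E k (a + 1) ≤ E j a := by
  obtain ⟨k, rfl⟩ : ∃ m, k = m + 1 := ⟨k - 1, by omega⟩
  exact (h.interlace (by omega) h3 a).trans (h.antitone h1 (by omega) (by omega) a)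

theorem ColChain.diagonal (h : ColChain n r S E) {k : ℕ} (h1 : 1 ≤ k) (h3 : k ≤ r) :
    E r r ≤ E k k := by
  induction r, h3 using Nat.le_induction with
  | base => exact le_rfl
  | succ m hm ih =>
    exact (h.interlace (by omega) le_rfl m).trans
      (ih fun k hk hk' => h k hk (by omega))

/-- The shortened strings are singular after the removal of a column. -/
theorem ColChain.sum_hit_le (h : ColChain n r S E) {k : ℕ} (hk : k ≤ r) {a i : ℕ} (ha : 1 ≤ a)
    (ha' : a ≤ n) (hi : 1 ≤ i) : ∑ j ∈ Finset.Ioc k r, hit (E j a) (i + 1) ≤ S k a i := by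
  obtain ⟨d, hd⟩ : ∃ d, k + d = r := ⟨r - k, by omega⟩
  induction d generalizing k with
  | zero => simp [show k = r by omega]
  | succ d ih =>
    have ih' := ih (k := k + 1) (by omega) (by omega)
    have hs := h (k + 1) (by omega) (by omega)
    rw [Nat.add_sub_cancel] at hs
    have hsum : ∑ j ∈ Finset.Ioc k r, hit (E j a) (i + 1) =
        ∑ j ∈ Finset.Ioc (k + 1) r, hit (E j a) (i + 1) + hit (E (k + 1) a) (i + 1) := by
      rw [← Finset.insert_Ioc_add_one_left_eq_Ioc (by omega : k < r), Finset.sum_insert (by simp),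
        add_comm]
    -- If a previous removal produced a string of length `i`, interlacing places the present one
    -- beyond `i` already at node `a - 1`, so nothing of length `i` is lost. Otherwise only the
    -- string shortened just now has to be found.
    by_cases hz : ∃ j ∈ Finset.Ioc (k + 1) r, E j a = ((i + 1 : ℕ) : ℕ∞)
    · obtain ⟨j, hj, hj'⟩ := hz
      rw [Finset.mem_Ioc] at hj
      have hlt := h.le_of_lt (j := k + 1) (by omega) hj.1 hj.2 (a - 1)
      rw [Nat.sub_add_cancel ha, hj'] at hlt
      have hlt' : (i : ℕ∞) < E (k + 1) (a - 1) :=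
        lt_of_lt_of_le (by exact_mod_cast Nat.lt_succ_self i) hlt
      have hp := hs.persist a i ha ha' hi (Or.inl hlt')
      have hz : hit (E (k + 1) a) i = 0 := hit_of_ne
        (ne_of_gt (hlt'.trans_le (hs.chain.monotone (Nat.sub_le _ _))))
      rw [hz, ite_self, add_zero] at hp
      omega
    · push Not at hz
      rw [hsum, Finset.sum_eq_zero fun j hj => hit_of_ne (hz j hj), zero_add]
      by_cases he : E (k + 1) a = ((i + 1 : ℕ) : ℕ∞)
      · rw [hit_of_eq he]
        exact hs.new a i ha ha' hi he
      · rw [hit_of_ne he]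
        exact Nat.zero_le _

/-- The removed strings are singular before the removal of a column. -/
theorem ColChain.sum_sing_le (h : ColChain n r S E) {k : ℕ} (hk : k ≤ r) {a i : ℕ} (ha : 1 ≤ a)
    (ha' : a ≤ n) (hi : 1 ≤ i) :
    ∑ j ∈ Finset.Icc 1 k, (if j ≤ a then hit (E j a) i else 0) ≤ S k a i := by
  induction k with
  | zero => simp
  | succ k ih =>
    have ih' := ih (by omega)
    have hs := h (k + 1) (by omega) hk
    rw [Nat.add_sub_cancel] at hs
    rw [Finset.sum_Icc_succ_top (by omega)]
    -- If a later removal takes a string of length `i`, interlacing gives `E (k + 1) (a + 1) ≤ i`,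
    -- so its singularity can be traced back through the present removal.
    by_cases hz : ∃ j ∈ Finset.Icc 1 k, E j a = i
    · obtain ⟨j, hj, hj'⟩ := hz
      rw [Finset.mem_Icc] at hj
      have hle := h.le_of_lt (k := k + 1) hj.1 (by omega) hk a
      rw [hj'] at hle
      have hp := hs.persist a i ha ha' hi (Or.inr hle)
      have hz : hit (E (k + 1) a) (i + 1) = 0 := hit_of_ne fun hc => by
        have := (hs.chain.mono a).trans hle
        rw [hc, Nat.cast_le] at this
        omega
      omega
    · push Not at hz
      rw [Finset.sum_eq_zero fun j hj => by rw [hit_of_ne (hz j hj), ite_self], zero_add]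
      split_ifs with hka
      · by_cases he : E (k + 1) a = i
        · rw [hit_of_eq he]
          exact hs.sing a i hka ha' he
        · rw [hit_of_ne he]
          exact Nat.zero_le _
      · exact Nat.zero_le _

/-- If the first column removes only strings of length at least `t + 1` at the node `r`, then the
strings that are selected for the second column are shorter. -/
theorem ColChain.add_one_le (h : ColChain n r S E) (h' : ColChain n r S' F) (hr : r ≤ n) {t : ℕ}
    (ht : 1 ≤ t) (hS : ∀ a i, 1 ≤ a → a ≤ n → (a ≠ r ∨ t ≤ i) → S' r a i = S 0 a i)
    (hE : ((t + 1 : ℕ) : ℕ∞) ≤ E r r) {k : ℕ} (hk : 1 ≤ k) (hk' : k ≤ r) {a : ℕ} (ha : k ≤ a) :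
    F k a + 1 ≤ E k a := by
  -- Suppose the strings shortened by the entries `1, …, k` of the first column are still singular
  -- when the second column removes its entry `k`. Then node by node a string of length `E k a - 1`
  -- is available, and `F k a` is at most that.
  have claim : ∀ k, 1 ≤ k → k ≤ r → (∀ a i, 1 ≤ a → a ≤ n → 1 ≤ i →
      ∑ j ∈ Finset.Icc 1 k, hit (E j a) (i + 1) ≤ S' k a i) → ∀ a, k ≤ a → F k a + 1 ≤ E k a := by
    intro k hk hk' hC a ha
    have hs := h' k hk hk'
    have hs0 := h k hk hk'
    induction a, ha using Nat.le_induction with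
    | base =>
      by_cases htop : E k k = ⊤
      · rw [htop]; exact le_top
      have h1 := hE.trans (h.diagonal hk hk')
      obtain ⟨i, hi⟩ := exists_eq_succ_of_one_le (hs0.chain.one_le k) htop
      rw [hi, Nat.cast_le] at h1
      have h2 := hC k i hk (by omega) (by omega)
      have h3 : hit (E k k) (i + 1) ≤ ∑ j ∈ Finset.Icc 1 k, hit (E j k) (i + 1) :=
        Finset.single_le_sum (f := fun j => hit (E j k) (i + 1)) (fun _ _ => Nat.zero_le _)
          (Finset.mem_Icc.2 ⟨hk, le_rfl⟩)
      rw [hit_of_eq hi] at h3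
      have h4 := hs.least k i le_rfl (by omega)
        (by rw [hs.one _ (by omega)]; exact_mod_cast (by omega : 1 ≤ i)) (by omega)
      rw [hi]
      push_cast
      exact add_le_add_left h4 1
    | succ a ha ih =>
      by_cases htop : E k (a + 1) = ⊤
      · rw [htop]; exact le_top
      have han : a + 1 ≤ n := by
        by_contra hc
        exact htop (hs0.chain.top _ (by omega))
      obtain ⟨i, hi⟩ := exists_eq_succ_of_one_le (hs0.chain.one_le (a + 1)) htop
      have h1 : F k a ≤ i := le_of_add_one_le_succ (hi ▸ ih.trans (hs0.chain.mono a))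
      have hi1 : 1 ≤ i := by exact_mod_cast (hs.chain.one_le a).trans h1
      have h2 := hC (a + 1) i (by omega) han hi1
      have h3 : hit (E k (a + 1)) (i + 1) ≤ ∑ j ∈ Finset.Icc 1 k, hit (E j (a + 1)) (i + 1) :=
        Finset.single_le_sum (f := fun j => hit (E j (a + 1)) (i + 1)) (fun _ _ => Nat.zero_le _)
          (Finset.mem_Icc.2 ⟨hk, le_rfl⟩)
      rw [hit_of_eq hi] at h3
      have h4 := hs.least (a + 1) i (by omega) han h1 (by omega)
      rw [hi]
      push_cast
      exact add_le_add_left h4 1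
  -- These strings survive the removals of the entries `r, …, k + 1` of the second column. At a
  -- length that matters, such a removal costs a string only if `E (k + 1) a = i + 1`, and this term
  -- leaves the sum at the same moment.
  have inv : ∀ k, k ≤ r → ∀ a i, 1 ≤ a → a ≤ n → 1 ≤ i →
      ∑ j ∈ Finset.Icc 1 k, hit (E j a) (i + 1) ≤ S' k a i := by
    intro k hk
    obtain ⟨d, hd⟩ : ∃ d, k + d = r := ⟨r - k, by omega⟩
    induction d generalizing k with
    | zero =>
      obtain rfl : k = r := by omega
      intro a i ha ha' hi
      by_cases hc : a ≠ k ∨ t ≤ i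
      · rw [hS a i ha ha' hc]
        have := h.sum_hit_le (Nat.zero_le k) ha ha' hi
        rwa [← Finset.Icc_add_one_left_eq_Ioc, zero_add] at this
      -- The two states are not compared at node `r` below length `t`, but the first column shortens
      -- no string of length at most `t` there.
      · push Not at hc
        obtain ⟨rfl, hc⟩ := hc
        rw [Finset.sum_eq_zero fun j hj => hit_of_ne fun he => ?_]
        · exact Nat.zero_le _
        · rw [Finset.mem_Icc] at hj
          have := hE.trans (h.antitone hj.1 hj.2 le_rfl a)
          rw [he, Nat.cast_le] at this
          omega
    | succ d ih =>
      intro a i ha ha' hi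
      have hC := ih (k + 1) (by omega) (by omega)
      have hC' := hC a i ha ha' hi
      rw [Finset.sum_Icc_succ_top (by omega)] at hC'
      by_cases hz : ∃ j ∈ Finset.Icc 1 k, E j a = ((i + 1 : ℕ) : ℕ∞)
      · obtain ⟨j, hj, hj'⟩ := hz
        rw [Finset.mem_Icc] at hj
        have hs := h' (k + 1) (by omega) (by omega)
        rw [Nat.add_sub_cancel] at hs
        have cl := claim (k + 1) (by omega) (by omega) hC
        have h1 := h.le_of_lt (k := k + 1) hj.1 (by omega) (by omega) a
        rw [hj'] at h1
        have h2 : F (k + 1) (a + 1) ≤ i := by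
          by_cases hka : k + 1 ≤ a + 1
          · exact le_of_add_one_le_succ ((cl (a + 1) hka).trans h1)
          · rw [hs.one _ (by omega)]
            exact_mod_cast hi
        have hp := hs.persist a i ha ha' hi (Or.inr h2)
        have h3 := (hs.chain.mono a).trans h2
        have hz : hit (F (k + 1) a) (i + 1) = 0 := hit_of_ne fun hc => by
          rw [hc, Nat.cast_le] at h3
          omega
        by_cases hka : k + 1 ≤ a
        · rw [if_pos hka] at hp
          by_cases hF : F (k + 1) a = i
          · have h4 := cl a hka
            have h5 := h.antitone (k := k + 1) hj.1 (by omega) (by omega) a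
            rw [hj'] at h5
            rw [hF] at h4
            have h6 : E (k + 1) a = ((i + 1 : ℕ) : ℕ∞) :=
              le_antisymm h5 (by push_cast; exact h4)
            rw [hit_of_eq h6] at hC'
            rw [hit_of_eq hF] at hp
            omega
          · rw [hit_of_ne hF] at hp
            omega
        · rw [if_neg hka] at hp
          omega
      · push Not at hz
        rw [Finset.sum_eq_zero fun j hj => hit_of_ne (hz j hj)]
        exact Nat.zero_le _
  exact claim k hk hk' (inv k hk') a ha

/-- If the letters of the second column are at least those of the first one, then the strings that
are selected for the first column are longer. -/
theorem ColChain.lt_of_fin (h : ColChain n r S E) (h' : ColChain n r S' F) (hr : r ≤ n)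
    (hr1 : 1 ≤ r) {t : ℕ}
    (hS : ∀ a i, 1 ≤ a → a ≤ n → (a ≠ r ∨ t ≤ i) → S' r a i = S 0 a i) (hF : (t : ℕ∞) ≤ F r r)
    (hEF : ∀ k a, 1 ≤ k → k ≤ r → E k a ≠ ⊤ → F k a ≠ ⊤) : (t : ℕ∞) < E r r ∨ E r r = ⊤ := by
  -- The nodes are treated from the infinite end of `E k` downwards. If `E k a ≤ F k a`, the string
  -- selected by `F` would lie in the gap `[E k a, E k (a + 1))` that the first column leaves
  -- without singular strings.
  have claim : ∀ k, 1 ≤ k → k ≤ r → (∀ a i, 1 ≤ a → a ≤ n → 1 ≤ i →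
      ∑ j ∈ Finset.Ioc (k - 1) r, (if j ≤ a then hit (F j a) i else 0) ≤ S (k - 1) a i) →
      ∀ a, k ≤ a → E k a ≠ ⊤ → F k a < E k a := by
    intro k hk hk' hG
    have hs := h k hk hk'
    have hs' := h' k hk hk'
    have main : ∀ d a, a + d = n + 1 → k ≤ a → E k a ≠ ⊤ → F k a < E k a := by
      intro d
      induction d with
      | zero =>
        intro a ha _ htop
        exact absurd (hs.chain.top a (by omega)) htop
      | succ d ih =>
        intro a ha hka htop
        by_contra hlt
        rw [not_lt] at hlt
        obtain ⟨i, hi⟩ := ENat.ne_top_iff_exists.1 (hEF k a hk hk' htop)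
        have hi1 : 1 ≤ i := by exact_mod_cast hi ▸ hs'.chain.one_le a
        have h1 := hG a i (by omega) (by omega) hi1
        have h2 : (if k ≤ a then hit (F k a) i else 0) ≤
            ∑ j ∈ Finset.Ioc (k - 1) r, (if j ≤ a then hit (F j a) i else 0) :=
          Finset.single_le_sum (f := fun j => if j ≤ a then hit (F j a) i else 0)
            (fun _ _ => Nat.zero_le _) (Finset.mem_Ioc.2 ⟨by omega, hk'⟩)
        rw [if_pos hka, hit_of_eq hi.symm] at h2
        have h3 : (i : ℕ∞) < E k (a + 1) := by
          by_cases htop' : E k (a + 1) = ⊤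
          · rw [htop']; exact ENat.natCast_lt_top i
          · rw [hi]
            exact (hs'.chain.mono a).trans_lt (ih (a + 1) (by omega) (by omega) htop')
        have := hs.gap a i (by omega) (by omega) (hi ▸ hlt) h3
        omega
    intro a hka htop
    have han : a ≤ n := by
      by_contra hc
      exact htop (hs.chain.top _ (by omega))
    exact main (n + 1 - a) a (by omega) hka htop
  -- The strings to be taken by the entries above `k` of the second column are traced back through
  -- the removals of the first column. A string of length `i` is new only if `E (k + 1) a = i + 1`,
  -- and then `F (k + 1) a = i` provides a term to spare.
  have inv : ∀ k, k ≤ r → ∀ a i, 1 ≤ a → a ≤ n → 1 ≤ i →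
      ∑ j ∈ Finset.Ioc k r, (if j ≤ a then hit (F j a) i else 0) ≤ S k a i := by
    intro k
    induction k with
    | zero =>
      intro _ a i ha ha' hi
      by_cases hc : a ≠ r ∨ t ≤ i
      · rw [← hS a i ha ha' hc]
        have := h'.sum_sing_le le_rfl ha ha' hi
        rwa [← Finset.Icc_add_one_left_eq_Ioc, zero_add]
      · push Not at hc
        obtain ⟨rfl, hc⟩ := hc
        rw [Finset.sum_eq_zero fun j hj => ?_]
        · exact Nat.zero_le _
        · rw [Finset.mem_Ioc] at hj
          rw [hit_of_ne fun he => ?_, ite_self]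
          have := hF.trans (h'.antitone (by omega) hj.2 le_rfl a)
          rw [he, Nat.cast_le] at this
          omega
    | succ k ih =>
      intro hk a i ha ha' hi
      have hG := ih (by omega)
      have cl := claim (k + 1) (by omega) hk hG
      have hs := h (k + 1) (by omega) hk
      rw [Nat.add_sub_cancel] at hs
      have hG' := hG a i ha ha' hi
      rw [← Finset.insert_Ioc_add_one_left_eq_Ioc (by omega : k < r),
        Finset.sum_insert (by simp)] at hG'
      by_cases hz : ∃ j ∈ Finset.Ioc (k + 1) r, j ≤ a ∧ F j a = i
      · obtain ⟨j, hj, hja, hj'⟩ := hz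
        rw [Finset.mem_Ioc] at hj
        have h1 := h'.le_of_lt (j := k + 1) (by omega) hj.1 hj.2 (a - 1)
        rw [Nat.sub_add_cancel ha, hj'] at h1
        have h2 : (i : ℕ∞) < E (k + 1) (a - 1) := by
          by_cases htop : E (k + 1) (a - 1) = ⊤
          · rw [htop]; exact ENat.natCast_lt_top i
          · exact h1.trans_lt (cl (a - 1) (by omega) htop)
        have hp := hs.persist a i ha ha' hi (Or.inl h2)
        have hz : hit (E (k + 1) a) i = 0 := hit_of_ne
          (ne_of_gt (h2.trans_le (hs.chain.monotone (Nat.sub_le _ _))))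
        rw [hz, ite_self, add_zero] at hp
        by_cases he : E (k + 1) a = ((i + 1 : ℕ) : ℕ∞)
        · have h3 := cl a (by omega) (by rw [he]; exact ENat.natCast_ne_top _)
          rw [he] at h3
          push_cast at h3
          have h4 := h'.antitone (j := k + 1) (by omega) (by omega) hj.2 a
          rw [hj'] at h4
          have h5 : F (k + 1) a = i := le_antisymm (Order.le_of_lt_add_one h3) h4
          rw [if_pos (by omega), hit_of_eq h5] at hG'
          rw [hit_of_eq he] at hp
          omega
        · rw [hit_of_ne he] at hp
          omega
      · push Not at hz
        rw [Finset.sum_eq_zero fun j hj => ?_]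
        · exact Nat.zero_le _
        · split_ifs with hja
          · exact hit_of_ne (hz j hj hja)
          · rfl
  by_cases htop : E r r = ⊤
  · exact Or.inr htop
  · exact Or.inl (hF.trans_lt (claim r hr1 le_rfl (inv (r - 1) (by omega)) r le_rfl htop))

end ColChain

/-- If the first letter is obtained by a removal that is not of column type, then the second one is
not smaller. -/
theorem ColStep.add_one_le {k : ℕ} (hk : 1 ≤ k) {s s' s'' : ℕ → ℕ → ℕ} {e e' : ℕ → ℕ∞}
    (h : ColStep n 1 s s' e) (h' : ColStep n k s' s'' e') (h2 : 2 ≤ e k) {a : ℕ} (ha : k ≤ a) :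
    e' a + 1 ≤ e a := by
  induction a, ha using Nat.le_induction with
  | base =>
    by_cases htop : e k = ⊤
    · rw [htop]; exact le_top
    have hkn : k ≤ n := by
      by_contra hc
      exact htop (h.chain.top _ (by omega))
    obtain ⟨i, hi⟩ := exists_eq_succ_of_one_le (h.chain.one_le k) htop
    rw [hi] at h2
    have hi1 : 2 ≤ i + 1 := by exact_mod_cast h2
    have h4 := h'.least k i le_rfl hkn
      (by rw [h'.one _ (by omega)]; exact_mod_cast (by omega : 1 ≤ i))
      (h.new k i hk hkn (by omega) hi)
    rw [hi]
    push_cast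
    exact add_le_add_left h4 1
  | succ a ha ih =>
    by_cases htop : e (a + 1) = ⊤
    · rw [htop]; exact le_top
    have han : a + 1 ≤ n := by
      by_contra hc
      exact htop (h.chain.top _ (by omega))
    obtain ⟨i, hi⟩ := exists_eq_succ_of_one_le (h.chain.one_le (a + 1)) htop
    have h1 : e' a ≤ i := le_of_add_one_le_succ (hi ▸ ih.trans (h.chain.mono a))
    have hi1 : 1 ≤ i := by exact_mod_cast (h'.chain.one_le a).trans h1
    have h4 := h'.least (a + 1) i (by omega) han h1 (h.new (a + 1) i (by omega) han hi1 hi)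
    rw [hi]
    push_cast
    exact add_le_add_left h4 1

end TypeA

end PathRC

namespace PathRC

open Selection

namespace TypeA

/-! ## Box splitting on rigged configurations -/

variable {n : ℕ}

/-- The multiplicity array with an additional factor `B^{k,1}`. -/
def addBox (M : Node n → Multiset ℕ) (k : ℕ) : Node n → Multiset ℕ :=
  fun a => if a.1 = k then 1 ::ₘ M a else M a

theorem addBox_zero (M : Node n → Multiset ℕ) : addBox M 0 = M := by
  funext a
  have := Finset.mem_Icc.1 a.2
  exact if_neg (by omega)

/-- The multiplicity array after splitting off the bottommost box of a column of height `k`. -/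
def splitBox (M : Node n → Multiset ℕ) (k : ℕ) : Node n → Multiset ℕ :=
  addBox (addBox M (k - 1)) 1

theorem one_mem_splitBox (M : Node n → Multiset ℕ) (k : ℕ) (a : Node n) (ha : a.1 = 1) :
    1 ∈ splitBox M k a := by
  simp [splitBox, addBox, ha]

theorem lhArray_splitBox (M : Node n → Multiset ℕ) (k : ℕ) :
    lhArray (splitBox M k) = addBox M (k - 1) := by
  funext a
  unfold lhArray splitBox
  split_ifs with ha
  · conv_lhs => rw [addBox, if_pos ha]
    exact Multiset.erase_cons_head _ _
  · conv_lhs => rw [addBox, if_neg ha]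

theorem trunc_addBox (M : Node n → Multiset ℕ) (k : ℕ) (a : Node n) (i : ℕ) :
    trunc (addBox M k a) i = trunc (M a) i + if a.1 = k then ((min i 1 : ℕ) : ℤ) else 0 := by
  unfold addBox
  split_ifs
  · rw [trunc_cons]
    push_cast
    ring
  · ring

/-- The shape of the rigged configuration after box splitting. -/
def splitShape (k : ℕ) (sh : Node n → Multiset ℕ) : Node n → Multiset ℕ :=
  fun b => if b.1 < k then 1 ::ₘ sh b else sh b

/-- The Cartan matrix applied to the indicator of the nodes `1, …, k - 1` is `Λ_1 + Λ_{k-1} - Λ_k`,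
which is the change of the factors. The added strings of length one therefore cancel the effect of
splitting on all vacancy numbers. -/
theorem vacancy_split {k : ℕ} (h1 : 1 ≤ k) (h2 : k ≤ n) (M sh : Node n → Multiset ℕ) (a : Node n)
    (i : ℕ) : vacancy (cartan n) (splitBox M k) (splitShape k sh) a i =
      vacancy (cartan n) (addBox M k) sh a i := by
  have ha := Finset.mem_Icc.1 a.2
  have h3 : ∀ b : Node n, cartan n a b * trunc (splitShape k sh b) i =
      cartan n a b * trunc (sh b) i +
        cartan n a b * (fun b : ℕ => if b < k then ((min i 1 : ℕ) : ℤ) else 0) b := by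
    intro b
    rw [← mul_add]
    congr 1
    unfold splitShape
    beta_reduce
    split_ifs
    · rw [trunc_cons]
      push_cast
      ring
    · ring
  rw [vacancy_eq_trunc, vacancy_eq_trunc, Finset.sum_congr rfl fun b _ => h3 b,
    Finset.sum_add_distrib,
    sum_cartan (fun b : ℕ => if b < k then ((min i 1 : ℕ) : ℤ) else 0), splitBox, trunc_addBox,
    trunc_addBox, trunc_addBox]
  generalize ((min i 1 : ℕ) : ℤ) = m
  split_ifs <;> omega

section Split

variable {M : Node n → Multiset ℕ} {k : ℕ} {lam : Node n → ℕ} {nu : Rigged (Node n)}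

theorem shape_iBar (L : Node n → Multiset ℕ) (k : ℕ) (nu : Rigged (Node n)) :
    (iBar (cartan n) L k nu).shape = splitShape k nu.shape := by
  funext a
  simp only [Rigged.shape, iBar, splitShape]
  split_ifs <;> simp

theorem vac_iBar (h1 : 1 ≤ k) (h2 : k ≤ n) (M : Node n → Multiset ℕ) (nu : Rigged (Node n)) :
    vac (cartan n) (splitBox M k) (iBar (cartan n) (splitBox M k) k nu) =
      vac (cartan n) (addBox M k) nu := by
  funext a i
  simp only [vac, shape_iBar, vacancy_split h1 h2]

theorem iBar_apply (h1 : 1 ≤ k) (h2 : k ≤ n) (M : Node n → Multiset ℕ) (nu : Rigged (Node n))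
    (a : Node n) : iBar (cartan n) (splitBox M k) k nu a =
      if a.1 < k then (1, vac (cartan n) (addBox M k) nu a 1) ::ₘ nu a else nu a := by
  have h3 := vacancy_split h1 h2 M nu.shape a 1
  unfold splitShape at h3
  simp only [iBar, h3, vac]

theorem iBar_one (L : Node n → Multiset ℕ) (nu : Rigged (Node n)) :
    iBar (cartan n) L 1 nu = nu := by
  funext a
  have := Finset.mem_Icc.1 a.2
  exact if_neg (by omega)

theorem isRC_iBar (h1 : 1 ≤ k) (h2 : k ≤ n) (h : IsRC (cartan n) (addBox M k) lam nu) :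
    IsRC (cartan n) (splitBox M k) lam (iBar (cartan n) (splitBox M k) k nu) := by
  have hv := vac_iBar h1 h2 M nu
  have hv' : ∀ a i, vacancy (cartan n) (splitBox M k)
      (iBar (cartan n) (splitBox M k) k nu).shape a i =
        vacancy (cartan n) (addBox M k) nu.shape a i := fun a i => congrFun (congrFun hv a) i
  refine ⟨fun a s hs => ?_, weight_of_vacancy_eventually ?_, fun a i hi => ?_, fun a s hs => ?_⟩
  · rw [iBar_apply h1 h2] at hs
    split_ifs at hs
    · rcases Multiset.mem_cons.1 hs with rfl | hs
      · exact le_rfl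
      · exact h.length_pos a s hs
    · exact h.length_pos a s hs
  · simp only [hv']
    exact h.vacancy_eventually
  · rw [hv']
    exact h.admissible a i hi
  · rw [hv']
    rw [iBar_apply h1 h2] at hs
    split_ifs at hs
    · rcases Multiset.mem_cons.1 hs with rfl | hs
      · exact ⟨h.admissible a 1 le_rfl, le_rfl⟩
      · exact h.rigging a s hs
    · exact h.rigging a s hs

theorem iBar_injective (h1 : 1 ≤ k) (h2 : k ≤ n) {nu' : Rigged (Node n)}
    (h : iBar (cartan n) (splitBox M k) k nu = iBar (cartan n) (splitBox M k) k nu') :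
    nu = nu' := by
  have hs : vac (cartan n) (addBox M k) nu = vac (cartan n) (addBox M k) nu' := by
    rw [← vac_iBar h1 h2 M nu, h, vac_iBar h1 h2]
  funext a
  have ha := congrFun h a
  rw [iBar_apply h1 h2, iBar_apply h1 h2, hs] at ha
  split_ifs at ha
  · exact (Multiset.cons_inj_right _).1 ha
  · exact ha

theorem count_iBar (h1 : 1 ≤ k) (h2 : k ≤ n) (M : Node n → Multiset ℕ) (nu : Rigged (Node n))
    (a : Node n) (i : ℕ) :
    singCount (cartan n) (splitBox M k) (iBar (cartan n) (splitBox M k) k nu) a i =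
      singCount (cartan n) (addBox M k) nu a i + if a.1 < k then hit 1 i else 0 := by
  rw [singCount_eq, singCount_eq, vac_iBar h1 h2, iBar_apply h1 h2]
  by_cases ha : a.1 < k
  · rw [if_pos ha, if_pos ha, Multiset.count_cons]
    congr 1
    by_cases hi : 1 = i
    · subst hi
      rw [if_pos rfl, hit_of_eq (by simp)]
    · rw [if_neg (by simp only [Prod.mk.injEq]; omega), hit_of_ne (by exact_mod_cast hi)]
  · rw [if_neg ha, if_neg ha, add_zero]

/-- A rigged configuration is in the image of box splitting if it has the required singular
strings. -/
theorem exists_iBar_eq (h1 : 1 ≤ k) (h2 : k ≤ n) {rho : Rigged (Node n)}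
    (h : IsRC (cartan n) (splitBox M k) lam rho)
    (hs : ∀ a : Node n, a.1 < k → 1 ≤ singCount (cartan n) (splitBox M k) rho a 1) :
    ∃ nu, IsRC (cartan n) (addBox M k) lam nu ∧ iBar (cartan n) (splitBox M k) k nu = rho := by
  let nu : Rigged (Node n) := fun a =>
    if a.1 < k then (rho a).erase (1, vac (cartan n) (splitBox M k) rho a 1) else rho a
  have hmem : ∀ a : Node n, a.1 < k → (1, vac (cartan n) (splitBox M k) rho a 1) ∈ rho a :=
    fun a ha => by
      have := hs a ha
      rw [singCount_eq] at this
      exact Multiset.one_le_count_iff_mem.1 this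
  have hsh : splitShape k nu.shape = rho.shape := by
    funext a
    simp only [splitShape, Rigged.shape, nu]
    split_ifs with ha
    · have := congrArg (Multiset.map Prod.fst) (Multiset.cons_erase (hmem a ha))
      rw [Multiset.map_cons] at this
      exact this
    · rfl
  have hv : vac (cartan n) (addBox M k) nu = vac (cartan n) (splitBox M k) rho := by
    funext a i
    simp only [vac, ← hsh, vacancy_split h1 h2]
  have hv' : ∀ a i, vacancy (cartan n) (addBox M k) nu.shape a i =
      vacancy (cartan n) (splitBox M k) rho.shape a i := fun a i => congrFun (congrFun hv a) i
  have hsub : ∀ a, ∀ s ∈ nu a, s ∈ rho a := by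
    intro a s hs
    simp only [nu] at hs
    split_ifs at hs
    · exact Multiset.mem_of_mem_erase hs
    · exact hs
  refine ⟨nu, ⟨fun a s hs => h.length_pos a s (hsub a s hs), weight_of_vacancy_eventually ?_,
    fun a i hi => ?_, fun a s hs => ?_⟩, ?_⟩
  · simp only [hv']
    exact h.vacancy_eventually
  · rw [hv']
    exact h.admissible a i hi
  · rw [hv']
    exact h.rigging a s (hsub a s hs)
  · funext a
    rw [iBar_apply h1 h2, hv]
    simp only [nu]
    split_ifs with ha
    · exact Multiset.cons_erase (hmem a ha)
    · rfl

end Split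

/-! ### Removing the bottommost entry of a column -/

section ColStep

variable {M : Node n → Multiset ℕ} {k : ℕ} {lam : Node n → ℕ} {nu : Rigged (Node n)}

/-- The removal of the bottommost entry of a column of height `k`. -/
noncomputable def colDelta (M : Node n → Multiset ℕ) (k : ℕ) (nu : Rigged (Node n)) :
    Rigged (Node n) :=
  deltaA (cartan n) (splitBox M k) (iBar (cartan n) (splitBox M k) k nu)

/-- The lengths that are selected for the bottommost entry of a column of height `k`. -/
noncomputable def colEll (M : Node n → Multiset ℕ) (k : ℕ) (nu : Rigged (Node n)) : ℕ → ℕ∞ :=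
  ell (cartan n) (splitBox M k) (iBar (cartan n) (splitBox M k) k nu)

theorem one_of_singCount {L : Node n → Multiset ℕ} {nu : Rigged (Node n)}
    (h : ∀ a : Node n, a.1 < k → 1 ≤ singCount (cartan n) L nu a 1) (hk : k ≤ n) {a : ℕ}
    (ha : a < k) : ell (cartan n) L nu a = 1 := by
  induction a with
  | zero => rfl
  | succ a ih =>
    refine le_antisymm ?_ ((isChain_ell (cartan n) L nu).one_le _)
    exact leastFrom_le (i := 1) (ih (by omega)).le
      (h ⟨a + 1, Finset.mem_Icc.2 ⟨by omega, by omega⟩⟩ ha)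

/-- Translates one application of `ī` and `δ̄` into numbers of singular strings before box splitting
and after the hat, which is all that the interlacing arguments use. -/
theorem colStep (h1 : 1 ≤ k) (h2 : k ≤ n) (h : IsRC (cartan n) (addBox M k) lam nu) :
    ColStep n k (singCount (cartan n) (addBox M k) nu)
      (singCount (cartan n) (addBox M (k - 1)) (colDelta M k nu)) (colEll M k nu) := by
  have hrc := isRC_iBar h1 h2 h
  have hmem := one_mem_splitBox (n := n) M k
  have hchain := isChain_ell (cartan n) (splitBox M k) (iBar (cartan n) (splitBox M k) k nu)
  have hR := removable_ell (cartan n) (splitBox M k) (iBar (cartan n) (splitBox M k) k nu)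
  have hadd := addable_deltaA hmem hrc
  have hcount := count_iBar h1 h2 M nu
  have hvac := hchain.isMove.vac_removal (lhArray_add_hatArray hmem) fun a => (hR a).le
  have hcr := count_removal (L' := lhArray (splitBox M k)) (fun a => (hR a).le)
  rw [← deltaA_eq_removal] at hvac hcr
  rw [lhArray_splitBox] at hadd hvac hcr
  have e1 : deltaA (cartan n) (splitBox M k) (iBar (cartan n) (splitBox M k) k nu) =
    colDelta M k nu := rfl
  have e2 : ell (cartan n) (splitBox M k) (iBar (cartan n) (splitBox M k) k nu) =
    colEll M k nu := rfl
  simp only [e1, e2] at hadd hvac hcr hR hchain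
  have hone : ∀ a, a < k → colEll M k nu a = 1 := fun a ha =>
    one_of_singCount (fun b hb => by
      rw [hcount, if_pos hb, hit_of_eq (by simp)]; omega) h2 ha
  refine ⟨hchain, hone, fun a i ha ha' hi => ?_, fun a i ha ha' hle hi => ?_,
    fun a i ha ha' hle hlt => ?_, fun a i ha ha' hi hor => ?_, fun a i ha ha' hi he => ?_⟩
  · have hn : a ∈ Finset.Icc 1 n := Finset.mem_Icc.2 ⟨by omega, ha'⟩
    obtain _ | a := a
    · omega
    have := leastFrom_spec hi
    rwa [hcount ⟨a + 1, hn⟩, if_neg (by simp only; omega), add_zero] at this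
  · have hn : a ∈ Finset.Icc 1 n := Finset.mem_Icc.2 ⟨by omega, ha'⟩
    obtain _ | a := a
    · omega
    refine leastFrom_le hle ?_
    rwa [hcount ⟨a + 1, hn⟩, if_neg (by simp only; omega), add_zero]
  · have hn : a ∈ Finset.Icc 1 n := Finset.mem_Icc.2 ⟨ha, ha'⟩
    have := (hadd ⟨a, hn⟩).fst i hle hlt
    simp only [selection, hit_top] at this
    rw [singCount_eq _ _ _ ⟨a, hn⟩]
    exact Nat.le_zero.1 this
  · have hn : a ∈ Finset.Icc 1 n := Finset.mem_Icc.2 ⟨ha, ha'⟩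
    -- Outside `[e (a - 1), e (a + 1))` the vacancy number does not change, so a string that is not
    -- touched is singular afterwards if and only if it was before.
    have hgain : (selection (colEll M k nu) ⟨a, hn⟩).gain i = 0 := by
      rcases (hchain.ordered ⟨a, hn⟩).gain_cases i with ⟨_, h⟩ | ⟨c1, c2, _⟩ | ⟨c1, c2, _⟩ |
        ⟨_, _, h⟩ | ⟨c1, _, _⟩ | ⟨c1, _, _⟩ | ⟨c1, _⟩
      · exact h
      · rcases hor with hor | hor
        · exact absurd c1 (not_le.2 hor)
        · exact absurd ((hchain.mono a).trans hor) (not_le.2 c2)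
      · rcases hor with hor | hor
        · exact absurd ((hchain.ordered ⟨a, hn⟩).ul.trans c1) (not_le.2 hor)
        · exact absurd hor (not_le.2 c2)
      · exact h
      all_goals exact absurd c1 (by simp [selection])
    have hv := hvac ⟨a, hn⟩ i
    rw [hgain, add_zero] at hv
    have hc := hcr ⟨a, hn⟩ i (vac (cartan n) (addBox M (k - 1)) (colDelta M k nu) ⟨a, hn⟩ i)
    rw [if_pos hv] at hc
    have h0 : singCount (cartan n) (splitBox M k) (iBar (cartan n) (splitBox M k) k nu) a i =
      singCount (cartan n) (addBox M k) nu a i + if a < k then hit 1 i else 0 := hcount ⟨a, hn⟩ i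
    have hle := map_lengths_le_iff.1 (hR ⟨a, hn⟩).le i
    rw [singCount_eq _ _ _ ⟨a, hn⟩] at h0
    rw [singCount_eq _ _ _ ⟨a, hn⟩]
    have e3 : (iBar (cartan n) (splitBox M k) k nu ⟨a, hn⟩).count
        (i, vac (cartan n) (addBox M (k - 1)) (colDelta M k nu) ⟨a, hn⟩ i) =
        singCount (cartan n) (addBox M k) nu a i + if a < k then hit 1 i else 0 := by
      rw [← h0]
      congr 2
    rw [e3, if_pos rfl, count_decrement_lengths, if_pos hi, lengths_selection,
      count_finiteIndex] at hc
    simp only [selection, hit_top, add_zero] at hc hle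
    rw [h0] at hle
    rw [hc]
    -- At the nodes below `k` the removed string is the one that box splitting had just added, so
    -- the number of singular strings shows no loss.
    by_cases hka : k ≤ a
    · rw [if_pos hka]
      rw [if_neg (by omega), add_zero] at hle
      rw [if_neg (by omega), add_zero]
      omega
    · rw [if_neg hka, if_pos (by omega), hone a (by omega)]
      omega
  · have hn : a ∈ Finset.Icc 1 n := Finset.mem_Icc.2 ⟨ha, ha'⟩
    have hle := map_decrement_lengths_le_iff.1 (hadd ⟨a, hn⟩).le i hi
    rw [singCount_eq _ _ _ ⟨a, hn⟩]
    simp only [selection, hit_top, add_zero] at hle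
    rwa [hit_of_eq he] at hle

theorem exists_isRC_colDelta (h1 : 1 ≤ k) (h2 : k ≤ n) (h : IsRC (cartan n) (addBox M k) lam nu) :
    ∃ mu, IsRC (cartan n) (addBox M (k - 1)) mu (colDelta M k nu) := by
  obtain ⟨x, hx⟩ :=
    (isChain_ell (cartan n) (splitBox M k) (iBar (cartan n) (splitBox M k) k nu)).exists_isLetter
  obtain ⟨mu, hmu, _⟩ := exists_isRC_deltaA (one_mem_splitBox M k) (isRC_iBar h1 h2 h) hx
  rw [lhArray_splitBox] at hmu
  exact ⟨mu, hmu⟩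

end ColStep

end TypeA

end PathRC

namespace PathRC

open Selection

/-! ## Highest weight paths -/

section Paths

variable {I X K : Type} {E : K → Type} {C : Crystal I X} {read : ∀ k, E k → List X}

/-- The path `b` is a classical highest weight vector of weight `lam`. -/
def IsHW (C : Crystal I X) (read : ∀ k, E k → List X) (B : List K) (lam : I → ℕ)
    (b : Path E B) : Prop :=
  (∀ i, C.words.eps i (b.word read B) = 0) ∧ ∀ i, C.words.wt (b.word read B) i = lam i

theorem isHW_nil {lam : I → ℕ} {b : Path E []} : IsHW C read [] lam b ↔ lam = fun _ => 0 := by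
  constructor
  · rintro ⟨_, h⟩
    funext i
    have := h i
    simp [Crystal.wt, Path.word, Crystal.words, Crystal.wordStr] at this
    omega
  · rintro rfl
    exact ⟨fun _ => rfl, fun _ => rfl⟩

/-- By the signature rule `x ⊗ b` is a highest weight vector if and only if `b` is one and `ε_i(x) ≤
φ_i(b)` for all `i`; on a highest weight vector `φ` is the weight. -/
theorem isHW_cons {k : K} {B : List K} {lam : I → ℕ} {T : E k} {b : Path E B} {x : X}
    (hx : read k T = [x]) : IsHW C read (k :: B) lam (T, b) ↔
      ∃ mu, IsHW C read B mu b ∧ (∀ i, C.eps i x ≤ mu i) ∧ ∀ i, (mu i : ℤ) + C.wt x i = lam i := by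
  simp only [IsHW, Path.word, hx, List.cons_append, List.nil_append, Crystal.words,
    Crystal.wordStr, Crystal.wt]
  constructor
  · rintro ⟨h1, h2⟩
    refine ⟨fun i => (C.wordStr i (Path.word read B b)).2, ⟨fun i => ?_, fun i => ?_⟩,
      fun i => ?_, fun i => ?_⟩
    all_goals have := h1 i
    all_goals have := h2 i
    all_goals beta_reduce
    all_goals omega
  · rintro ⟨mu, ⟨h1, h2⟩, h3, h4⟩
    refine ⟨fun i => ?_, fun i => ?_⟩
    all_goals have := h1 i
    all_goals have := h2 i
    all_goals have := h3 i
    all_goals have := h4 i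
    all_goals omega

theorem IsHW.weight_unique {B : List K} {lam mu : I → ℕ} {b : Path E B}
    (h : IsHW C read B lam b) (h' : IsHW C read B mu b) : lam = mu := by
  funext i
  have := (h.2 i).symm.trans (h'.2 i)
  exact_mod_cast this

theorem word_split {k k₁ k₂ : K} {T : E k} {T₁ : E k₁} {T₂ : E k₂}
    (h : read k T = read k₁ T₁ ++ read k₂ T₂) (B : List K) (b : Path E B) :
    Path.word read (k₁ :: k₂ :: B) (T₁, T₂, b) = Path.word read (k :: B) (T, b) := by
  simp [Path.word, h]

theorem isHW_split {k k₁ k₂ : K} {T : E k} {T₁ : E k₁} {T₂ : E k₂}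
    (h : read k T = read k₁ T₁ ++ read k₂ T₂) {B : List K} {b : Path E B} {lam : I → ℕ} :
    IsHW C read (k₁ :: k₂ :: B) lam (T₁, T₂, b) ↔ IsHW C read (k :: B) lam (T, b) := by
  simp only [IsHW, word_split h]

end Paths

/-! ## Comparison of multiplicity arrays -/

section Arrays

variable {I : Type} [Fintype I] {A : I → I → ℤ} {L L' : I → Multiset ℕ} {lam : I → ℕ}
  {nu : Rigged I}

theorem IsRC.weight_unique {mu : I → ℕ} (h : IsRC A L lam nu) (h' : IsRC A L mu nu) :
    lam = mu := by
  funext i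
  have h1 := h.weight i
  have h2 := h'.weight i
  omega

theorem isRC_zero (A : I → I → ℤ) : IsRC A (fun _ => 0) (fun _ => 0) (fun _ => 0) where
  length_pos a s hs := absurd hs (Multiset.notMem_zero s)
  weight b := by simp [Rigged.shape]
  admissible a i _ := by simp [vacancy, Rigged.shape]
  rigging a s hs := absurd hs (Multiset.notMem_zero s)

/-- The rigged configurations for the smaller vacancy numbers of an array `L'` in which a factor has
not been split are those without short singular strings. -/
theorem isRC_split_iff [DecidableEq I] (hA : IsCartan A) {r : I} {t : ℕ}
    (hL : ∀ a i, trunc (L a) i = trunc (L' a) i + if a = r ∧ 1 ≤ i ∧ i ≤ t then 1 else 0)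
    (h1 : 1 ∈ L r) : IsRC A L' lam nu ↔
      IsRC A L lam nu ∧ ∀ i, i ≤ t → (nu r).count (i, vac A L nu r i) = 0 := by
  have hv : ∀ a i, vacancy A L nu.shape a i =
      vacancy A L' nu.shape a i + if a = r ∧ 1 ≤ i ∧ i ≤ t then 1 else 0 := by
    intro a i
    rw [vacancy_eq_trunc, vacancy_eq_trunc, hL]
    ring
  have hbig : ∀ i, t + 1 ≤ i → ∀ a, vacancy A L nu.shape a i = vacancy A L' nu.shape a i := by
    intro i hi a
    rw [hv, if_neg (by omega), add_zero]
  constructor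
  · intro h
    refine ⟨⟨h.length_pos, weight_of_vacancy_eventually ?_, fun a i hi => ?_, fun a s hs => ?_⟩,
      fun i hi => ?_⟩
    · obtain ⟨N, hN⟩ := h.vacancy_eventually
      exact ⟨N + t + 1, fun i hi b => by rw [hbig i (by omega), hN i (by omega)]⟩
    · have := h.admissible a i hi
      rw [hv]
      split_ifs <;> omega
    · have := h.rigging a s hs
      rw [hv]
      split_ifs <;> omega
    · rw [Multiset.count_eq_zero]
      intro hmem
      have h2 := h.rigging r _ hmem
      have h3 := h.length_pos r _ hmem
      have h4 := hv r i
      rw [if_pos ⟨rfl, h3, hi⟩] at h4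
      simp only [vac] at h2
      omega
  · rintro ⟨h, hs⟩
    -- Lowering the vacancy numbers needs room. At a zero every string would be singular, hence
    -- absent, and concavity moves the zero down to length one. There the factor of width one makes
    -- the second difference strictly positive, which is a contradiction.
    have hpos : ∀ i, i + 1 ≤ t → 1 ≤ vac A L nu r (i + 1) := by
      intro i
      induction i with
      | zero =>
        intro hi
        have h2 := vacancy_second_difference A L nu.shape r 0
        have h3 := hA.sum_le (fun b => ((nu.shape b).count 1 : ℤ)) (fun _ => by positivity) r
        have h4 : 1 ≤ (L r).count 1 := Multiset.one_le_count_iff_mem.2 h1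
        have h5 := h.vac_nonneg r 2
        have h6 := vac_zero A L nu r
        simp only [zero_add] at h2 ⊢
        by_contra hlt
        have h7 := count_fst_le_of_nonpos (h.rigging r) (i := 1)
          (by simp only [vac] at hlt; omega)
        have h8 := hs 1 hi
        simp only [vac] at h5 h6 hlt h8
        rw [h8] at h7
        change (nu.shape r).count 1 ≤ 0 at h7
        omega
      | succ i ih =>
        intro hi
        have ih' := ih (by omega)
        have h2 := vacancy_second_difference A L nu.shape r (i + 1)
        have h3 := hA.sum_le (fun b => ((nu.shape b).count (i + 1 + 1) : ℤ))
          (fun _ => by positivity) r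
        have h5 := h.vac_nonneg r (i + 1 + 2)
        by_contra hlt
        have h7 := count_fst_le_of_nonpos (h.rigging r) (i := i + 1 + 1)
          (by simp only [vac] at hlt; omega)
        have h8 := hs _ hi
        simp only [vac] at h5 hlt h8 ih'
        rw [h8] at h7
        change (nu.shape r).count (i + 1 + 1) ≤ 0 at h7
        omega
    refine ⟨h.length_pos, weight_of_vacancy_eventually ?_, fun a i hi => ?_, fun a s hs' => ?_⟩
    · obtain ⟨N, hN⟩ := h.vacancy_eventually
      exact ⟨N + t + 1, fun i hi b => by rw [← hbig i (by omega), hN i (by omega)]⟩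
    · have h2 := h.admissible a i hi
      have h3 := hv a i
      split_ifs at h3 with hc
      · obtain ⟨rfl, hc⟩ := hc
        obtain ⟨j, rfl⟩ : ∃ j, i = j + 1 := ⟨i - 1, by omega⟩
        have := hpos j hc.2
        simp only [vac] at this
        omega
      · omega
    · have h2 := h.rigging a s hs'
      have h3 := hv a s.1
      split_ifs at h3 with hc
      · obtain ⟨rfl, hc⟩ := hc
        refine ⟨h2.1, ?_⟩
        by_contra hlt
        have h4 : s = (s.1, vac A L nu a s.1) := by
          refine Prod.ext rfl ?_
          simp only [vac]
          omega
        have h5 := hs s.1 hc.2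
        rw [Multiset.count_eq_zero] at h5
        exact h5 (h4 ▸ hs')
      · omega

end Arrays

/-! ### Multiplicity arrays and the recursive relation in type `A` -/

namespace TypeA

variable {n : ℕ}

theorem mult_cons (k : Index n) (B : List (Index n)) (a : Node n) :
    mult (k :: B) a = if k.r = a.1 then k.s ::ₘ mult B a else mult B a := by
  unfold mult
  rw [List.filter_cons]
  by_cases h : k.r = a.1 <;> simp [h]

theorem mult_cons_one {k : Index n} (h : k.s = 1) (B : List (Index n)) :
    mult (k :: B) = addBox (mult B) k.r := by
  funext a
  rw [mult_cons, addBox, h]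
  by_cases ha : k.r = a.1
  · rw [if_pos ha, if_pos ha.symm]
  · rw [if_neg ha, if_neg (Ne.symm ha)]

/-- Extended by zero, `c` is nonnegative, convex on the nodes, and vanishes at `0` and `n + 1`;
hence it vanishes. This makes the empty configuration the only one for the empty tensor product. -/
theorem sum_nonpos_of_cartan {c : Node n → ℕ} (h : ∀ b, ∑ a, (c a : ℤ) * cartan n b a ≤ 0)
    (a : Node n) : c a = 0 := by
  obtain ⟨g, hdef⟩ : ∃ g : ℕ → ℤ, ∀ k, g k = if h : k ∈ Finset.Icc 1 n then (c ⟨k, h⟩ : ℤ) else 0 :=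
    ⟨_, fun _ => rfl⟩
  have hg : ∀ a : Node n, g a = c a := fun a => (hdef a).trans (dif_pos a.2)
  have g0 : g 0 = 0 := (hdef 0).trans (dif_neg (by simp))
  have hn : ∀ k, 0 ≤ g k := fun k => by
    rw [hdef]; split_ifs <;> simp
  have hc : ∀ k, 1 ≤ k → k ≤ n → 2 * g k ≤ g (k - 1) + g (k + 1) := by
    intro k h1 h2
    have h3 := h ⟨k, Finset.mem_Icc.2 ⟨h1, h2⟩⟩
    have h4 := sum_cartan g ⟨k, Finset.mem_Icc.2 ⟨h1, h2⟩⟩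
    rw [Finset.sum_congr rfl fun a _ => by rw [mul_comm, ← hg a], h4] at h3
    have := hn (k - 1)
    have := hn (k + 1)
    simp only at h3
    split_ifs at h3 <;> omega
  have hd : ∀ d k, k + d = n + 1 → 1 ≤ k → g k ≤ g (k - 1) := by
    intro d
    induction d with
    | zero =>
      intro k hk _
      have : g k = 0 := (hdef k).trans (dif_neg (by simp; omega))
      rw [this]
      exact hn _
    | succ d ih =>
      intro k hk h1
      have h2 := ih (k + 1) (by omega) (by omega)
      have h3 := hc k h1 (by omega)
      rw [Nat.add_sub_cancel] at h2
      omega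
  have hz : ∀ k, k ≤ n → g k = 0 := by
    intro k
    induction k with
    | zero => exact fun _ => g0
    | succ k ih =>
      intro hk
      have h1 := ih (by omega)
      have h2 := hd (n - k) (k + 1) (by omega) (by omega)
      have h3 := hn (k + 1)
      rw [Nat.add_sub_cancel] at h2
      omega
  have := hz a.1 (Finset.mem_Icc.1 a.2).2
  rw [hg] at this
  exact_mod_cast this

/-- The relation between paths and rigged configurations that is defined by removing letters. -/
def Rel : (B : List (Index n)) → Path (Elt n) B → Rigged (Node n) → Prop
  | [], _, nu => nu = fun _ => 0
  | ⟨1, 1, h1, h2, h3⟩ :: B, b, nu =>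
    IsLetter (ell (cartan n) (mult (⟨1, 1, h1, h2, h3⟩ :: B)) nu) (b.1.1 0 0) ∧
      Rel B b.2 (deltaA (cartan n) (mult (⟨1, 1, h1, h2, h3⟩ :: B)) nu)
  | ⟨r + 2, 1, _, h2, _⟩ :: B, b, nu =>
    Rel (⟨1, 1, le_rfl, by omega, le_rfl⟩ :: ⟨r + 1, 1, by omega, by omega, le_rfl⟩ :: B)
      ((Tableau.lb b.1).1, (Tableau.lb b.1).2, b.2)
      (iBar (cartan n) (mult (⟨1, 1, le_rfl, by omega, le_rfl⟩ ::
        ⟨r + 1, 1, by omega, by omega, le_rfl⟩ :: B)) (r + 2) nu)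
  | ⟨r, s + 2, h1, h2, _⟩ :: B, b, nu =>
    Rel (⟨r, 1, h1, h2, le_rfl⟩ :: ⟨r, s + 1, h1, h2, by omega⟩ :: B)
      ((Tableau.ls b.1).1, (Tableau.ls b.1).2, b.2) nu
  | ⟨0, _, h1, _, _⟩ :: _, _, _ => absurd h1 (by omega)
  | ⟨_, 0, _, _, h3⟩ :: _, _, _ => absurd h3 (by omega)
-- Splitting preserves the number of boxes and increases the number of factors by one; with weight
-- `2rs - 1` per factor it still decreases the total.
termination_by B => (B.map fun k => 2 * k.r * k.s - 1).sum
decreasing_by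
  all_goals simp only [List.map_cons, List.sum_cons]
  · omega
  · omega
  · have : 2 * r * s.succ.succ = 2 * r * (s + 1) + 2 * r := Nat.mul_succ _ _
    have : 2 * r ≤ 2 * r * (s + 1) := Nat.le_mul_of_pos_right _ (by omega)
    omega

end TypeA

end PathRC

/-! ### Columns and rectangles through removal of letters -/

namespace PathRC

open Selection

namespace TypeA

variable {n : ℕ}

theorem rel_nil {b : Path (Elt n) []} {nu : Rigged (Node n)} : Rel [] b nu ↔ nu = fun _ => 0 := by
  rw [Rel]

theorem rel_hat {h1 : 1 ≤ 1} {h2 : 1 ≤ n} {h3 : 1 ≤ 1} {B : List (Index n)} {T : Tableau n 1 1}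
    {b : Path (Elt n) B} {nu : Rigged (Node n)} :
    Rel (⟨1, 1, h1, h2, h3⟩ :: B) (T, b) nu ↔
      IsLetter (ell (cartan n) (mult (⟨1, 1, h1, h2, h3⟩ :: B)) nu) (T.1 0 0) ∧
        Rel B b (deltaA (cartan n) (mult (⟨1, 1, h1, h2, h3⟩ :: B)) nu) :=
  Iff.of_eq (Rel.eq_2 ..)

theorem rel_lb {r : ℕ} {h1 : 1 ≤ r + 2} {h2 : r + 2 ≤ n} {h3 : 1 ≤ 1} {B : List (Index n)}
    {T : Tableau n (r + 2) 1} {b : Path (Elt n) B} {nu : Rigged (Node n)} :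
    Rel (⟨r + 2, 1, h1, h2, h3⟩ :: B) (T, b) nu ↔
      Rel (⟨1, 1, le_rfl, by omega, le_rfl⟩ :: ⟨r + 1, 1, by omega, by omega, le_rfl⟩ :: B)
        (T.lb.1, T.lb.2, b) (iBar (cartan n) (splitBox (mult B) (r + 2)) (r + 2) nu) := by
  refine Iff.of_eq ((Rel.eq_3 ..).trans ?_)
  rw [mult_cons_one rfl, mult_cons_one rfl]
  rfl

theorem rel_ls {r s : ℕ} {h1 : 1 ≤ r} {h2 : r ≤ n} {h3 : 1 ≤ s + 2} {B : List (Index n)}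
    {T : Tableau n r (s + 2)} {b : Path (Elt n) B} {nu : Rigged (Node n)} :
    Rel (⟨r, s + 2, h1, h2, h3⟩ :: B) (T, b) nu ↔
      Rel (⟨r, 1, h1, h2, le_rfl⟩ :: ⟨r, s + 1, h1, h2, by omega⟩ :: B)
        (T.ls.1, T.ls.2, b) nu :=
  Iff.of_eq (Rel.eq_4 ..)

/-- A uniform description of the relation at a column: for height one the box splitting is trivial
and what remains is the bare tensor product. -/
theorem rel_col {k : ℕ} {h1 : 1 ≤ k + 1} {h2 : k + 1 ≤ n} {B : List (Index n)}
    {T : Tableau n (k + 1) 1} {b : Path (Elt n) B} {nu : Rigged (Node n)}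
    (h : Rel (⟨k + 1, 1, h1, h2, le_rfl⟩ :: B) (T, b) nu) :
    IsLetter (colEll (mult B) (k + 1) nu) (T.1 (Fin.last k) 0) ∧
      (k = 0 → Rel B b (colDelta (mult B) (k + 1) nu)) ∧
      ∀ hk : 1 ≤ k, Rel (⟨k, 1, hk, by omega, le_rfl⟩ :: B) (T.lb.2, b)
        (colDelta (mult B) (k + 1) nu) := by
  obtain _ | k := k
  · have e1 : mult (⟨1, 1, h1, h2, le_rfl⟩ :: B) = splitBox (mult B) 1 := by
      rw [mult_cons_one rfl, splitBox, addBox_zero]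
    replace h := rel_hat.1 h
    rw [e1] at h
    unfold colEll colDelta
    simp only [zero_add, iBar_one]
    exact ⟨h.1, fun _ => h.2, fun hk => by omega⟩
  · replace h := rel_hat.1 (rel_lb.1 h)
    rw [mult_cons_one rfl, mult_cons_one rfl] at h
    exact ⟨h.1, fun hk => by omega, fun _ => h.2⟩

/-- Unrolls the relation along one column: `rho j` is the configuration at the moment when the top
`j` entries remain. -/
theorem exists_columns {B : List (Index n)} {b : Path (Elt n) B} : ∀ {k : ℕ} (h1 : 1 ≤ k)
    (h2 : k ≤ n) {T : Tableau n k 1} {nu : Rigged (Node n)} {lam : Node n → ℕ},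
    IsRC (cartan n) (addBox (mult B) k) lam nu → Rel (⟨k, 1, h1, h2, le_rfl⟩ :: B) (T, b) nu →
    ∃ rho : ℕ → Rigged (Node n), rho k = nu ∧
      (∀ j, 1 ≤ j → j ≤ k → rho (j - 1) = colDelta (mult B) j (rho j)) ∧
      (∃ mu, IsRC (cartan n) (mult B) mu (rho 0)) ∧ Rel B b (rho 0) ∧
      (∀ j : Fin k, IsLetter (colEll (mult B) (j + 1) (rho (j + 1))) (T.1 j 0)) ∧
      ∀ j, 1 ≤ j → j ≤ k → ∃ mu, IsRC (cartan n) (addBox (mult B) j) mu (rho j) := by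
  intro k
  induction k with
  | zero => intro h1; omega
  | succ k ih =>
    intro h1 h2 T nu lam hrc hrel
    obtain ⟨hx, h0, hk⟩ := rel_col hrel
    obtain ⟨mu, hmu⟩ := exists_isRC_colDelta h1 h2 hrc
    rw [Nat.add_sub_cancel] at hmu
    obtain rfl | hk1 := Nat.eq_zero_or_pos k
    · rw [addBox_zero] at hmu
      refine ⟨fun j => if j = 0 then colDelta (mult B) 1 nu else nu, rfl, fun j hj hj' => ?_,
        ⟨mu, hmu⟩, h0 rfl, fun j => ?_, fun j hj hj' => ?_⟩
      · obtain rfl : j = 1 := by omega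
        rfl
      · obtain rfl : j = Fin.last 0 := Fin.ext (by omega)
        exact hx
      · obtain rfl : j = 1 := by omega
        exact ⟨lam, hrc⟩
    · obtain ⟨rho, r1, r2, r3, r4, r5, r6⟩ := ih hk1 (by omega) hmu (hk hk1)
      refine ⟨fun j => if j = k + 1 then nu else rho j, if_pos rfl, fun j hj hj' => ?_, ?_, ?_,
        fun j => ?_, fun j hj hj' => ?_⟩
      · beta_reduce
        by_cases hjk : j = k + 1
        · subst hjk
          rw [if_neg (by omega), if_pos rfl, Nat.add_sub_cancel, r1]
        · rw [if_neg (by omega), if_neg hjk, r2 j hj (by omega)]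
      · beta_reduce
        rwa [if_neg (by omega)]
      · beta_reduce
        rwa [if_neg (by omega)]
      · beta_reduce
        refine Fin.lastCases ?_ (fun j => ?_) j
        · rw [Fin.val_last, if_pos rfl]
          exact hx
        · rw [Fin.val_castSucc, if_neg (by omega)]
          exact r5 j
      · beta_reduce
        by_cases hjk : j = k + 1
        · subst hjk
          rw [if_pos rfl]
          exact ⟨lam, hrc⟩
        · rw [if_neg hjk]
          exact r6 j hj (by omega)

theorem colChain_of_columns {M : Node n → Multiset ℕ} {k : ℕ} (h2 : k ≤ n)
    {rho : ℕ → Rigged (Node n)}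
    (hd : ∀ j, 1 ≤ j → j ≤ k → rho (j - 1) = colDelta M j (rho j))
    (hrc : ∀ j, 1 ≤ j → j ≤ k → ∃ mu, IsRC (cartan n) (addBox M j) mu (rho j)) :
    ColChain n k (fun j => singCount (cartan n) (addBox M j) (rho j))
      fun j => colEll M j (rho j) := by
  intro j hj hj'
  obtain ⟨mu, hmu⟩ := hrc j hj hj'
  beta_reduce
  rw [hd j hj hj']
  exact colStep hj (by omega) hmu

/-- The sum `min(i, 1) + min(i, s + 1)` exceeds `min(i, s + 2)` by one exactly for `1 ≤ i ≤ s + 1`.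
-/
theorem trunc_mult_split {r s : ℕ} {h1 : 1 ≤ r} {h2 : r ≤ n} {h3 h4 h5} {B : List (Index n)}
    (a : Node n) (i : ℕ) :
    trunc (mult (⟨r, 1, h1, h2, h3⟩ :: ⟨r, s + 1, h1, h2, h4⟩ :: B) a) i =
      trunc (mult (⟨r, s + 2, h1, h2, h5⟩ :: B) a) i +
        if a = ⟨r, Finset.mem_Icc.2 ⟨h1, h2⟩⟩ ∧ 1 ≤ i ∧ i ≤ s + 1 then 1 else 0 := by
  rw [mult_cons, mult_cons, mult_cons]
  by_cases ha : r = a.1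
  · rw [if_pos ha, if_pos ha, if_pos ha, trunc_cons, trunc_cons, trunc_cons]
    have ha' : a = ⟨r, Finset.mem_Icc.2 ⟨h1, h2⟩⟩ := Subtype.ext ha.symm
    simp only [ha', true_and]
    split_ifs <;> push_cast <;> omega
  · rw [if_neg ha, if_neg ha, if_neg ha, if_neg, add_zero]
    rintro ⟨rfl, _⟩
    exact ha rfl

theorem isRC_ls_iff {r s : ℕ} {h1 : 1 ≤ r} {h2 : r ≤ n} {h3 h4 h5} {B : List (Index n)}
    {lam : Node n → ℕ} {nu : Rigged (Node n)} :
    IsRC (cartan n) (mult (⟨r, s + 2, h3, h4, h5⟩ :: B)) lam nu ↔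
      IsRC (cartan n) (mult (⟨r, 1, h1, h2, le_rfl⟩ :: ⟨r, s + 1, h1, h2, by omega⟩ :: B)) lam nu ∧
      ∀ i, i ≤ s + 1 → singCount (cartan n)
        (mult (⟨r, 1, h1, h2, le_rfl⟩ :: ⟨r, s + 1, h1, h2, by omega⟩ :: B)) nu r i = 0 := by
  rw [isRC_split_iff (isCartan_cartan n) (trunc_mult_split (h3 := le_rfl) (h4 := by omega)) ?_]
  · refine and_congr_right fun _ => forall_congr' fun i => ?_
    rw [singCount_eq _ _ _ ⟨r, Finset.mem_Icc.2 ⟨h1, h2⟩⟩]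
  · rw [mult_cons, if_pos rfl]
    exact Multiset.mem_cons_self _ _

theorem singCount_ls {r s : ℕ} {h1 : 1 ≤ r} {h2 : r ≤ n} {h3 h4 h5} {B : List (Index n)}
    {nu : Rigged (Node n)} {a i : ℕ} (ha : 1 ≤ a) (ha' : a ≤ n) (h : a ≠ r ∨ s + 2 ≤ i) :
    singCount (cartan n) (mult (⟨r, 1, h1, h2, h3⟩ :: ⟨r, s + 1, h1, h2, h4⟩ :: B)) nu a i =
      singCount (cartan n) (mult (⟨r, s + 2, h1, h2, h5⟩ :: B)) nu a i := by
  have hn : a ∈ Finset.Icc 1 n := Finset.mem_Icc.2 ⟨ha, ha'⟩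
  rw [singCount_eq _ _ _ ⟨a, hn⟩, singCount_eq _ _ _ ⟨a, hn⟩]
  congr 2
  simp only [vac]
  rw [vacancy_eq_trunc, vacancy_eq_trunc, trunc_mult_split (h5 := h5), if_neg, add_zero]
  rintro ⟨hc, h6, h7⟩
  have : a = r := congrArg Subtype.val hc
  omega

/-- The removal of the first column of a rectangle. -/
theorem exists_first_column {B : List (Index n)} {b : Path (Elt n) B} {r s : ℕ} {h1 : 1 ≤ r}
    {h2 : r ≤ n} {h3 : 1 ≤ s + 1} {T : Tableau n r (s + 1)} {nu : Rigged (Node n)}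
    {lam : Node n → ℕ} (h : IsRC (cartan n) (mult (⟨r, s + 1, h1, h2, h3⟩ :: B)) lam nu)
    (hrel : Rel (⟨r, s + 1, h1, h2, h3⟩ :: B) (T, b) nu) :
    ∃ (S : ℕ → ℕ → ℕ → ℕ) (F : ℕ → ℕ → ℕ∞), ColChain n r S F ∧
      (∀ a i, 1 ≤ a → a ≤ n → (a ≠ r ∨ s + 1 ≤ i) →
        S r a i = singCount (cartan n) (mult (⟨r, s + 1, h1, h2, h3⟩ :: B)) nu a i) ∧
      ((s + 1 : ℕ) : ℕ∞) ≤ F r r ∧ ∀ j : Fin r, IsLetter (F (j + 1)) (T.1 j 0) := by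
  obtain _ | s := s
  · have e1 : mult (⟨r, 1, h1, h2, h3⟩ :: B) = addBox (mult B) r := mult_cons_one rfl B
    simp only [zero_add] at h
    rw [e1] at h
    obtain ⟨rho, r1, r2, r3, r4, r5, r6⟩ := exists_columns h1 h2 h hrel
    refine ⟨_, _, colChain_of_columns h2 r2 r6, fun a i _ _ _ => ?_, ?_, r5⟩
    · simp only [r1, zero_add, e1]
    · have := (colChain_of_columns h2 r2 r6 r h1 le_rfl).chain.one_le r
      exact_mod_cast this
  · replace hrel := rel_ls.1 hrel
    have h' := (isRC_ls_iff (h1 := h1) (h2 := h2)).1 h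
    have e1 : mult (⟨r, 1, h1, h2, le_rfl⟩ :: ⟨r, s + 1, h1, h2, by omega⟩ :: B) =
        addBox (mult (⟨r, s + 1, h1, h2, by omega⟩ :: B)) r := mult_cons_one rfl _
    have h4 := h'.1
    rw [e1] at h4
    obtain ⟨rho, r1, r2, r3, r4, r5, r6⟩ := exists_columns h1 h2 h4 hrel
    have hc := colChain_of_columns h2 r2 r6
    refine ⟨_, _, hc, fun a i ha ha' hi => ?_, ?_, r5⟩
    · simp only [r1]
      rw [← singCount_ls (h3 := le_rfl) (h4 := by omega) ha ha' hi, e1]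
    · by_contra hlt
      rw [not_le] at hlt
      obtain ⟨i, hi⟩ := ENat.ne_top_iff_exists.1 (ne_top_of_lt hlt)
      have h5 := (hc r h1 le_rfl).sing r i le_rfl h2 hi.symm
      simp only [r1] at h5
      rw [← hi, Nat.cast_lt] at hlt
      have h6 := h'.2 i (by omega)
      rw [e1] at h6
      omega

/-- A column and a rectangle form a larger rectangle if and only if the rigged configuration does
not have short singular strings. -/
theorem le_iff_isRC {B : List (Index n)} {b : Path (Elt n) B} {r s : ℕ} {h1 : 1 ≤ r}
    {h2 : r ≤ n} {h3 : 1 ≤ s + 1} {h4 : 1 ≤ s + 2} {T₁ : Tableau n r 1} {T₂ : Tableau n r (s + 1)}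
    {nu : Rigged (Node n)} {lam : Node n → ℕ}
    (h : IsRC (cartan n) (mult (⟨r, 1, h1, h2, le_rfl⟩ :: ⟨r, s + 1, h1, h2, h3⟩ :: B)) lam nu)
    (hrel : Rel (⟨r, 1, h1, h2, le_rfl⟩ :: ⟨r, s + 1, h1, h2, h3⟩ :: B) (T₁, T₂, b) nu) :
    (∀ i, T₁.1 i 0 ≤ T₂.1 i 0) ↔ IsRC (cartan n) (mult (⟨r, s + 2, h1, h2, h4⟩ :: B)) lam nu := by
  have e1 : mult (⟨r, 1, h1, h2, le_rfl⟩ :: ⟨r, s + 1, h1, h2, h3⟩ :: B) =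
      addBox (mult (⟨r, s + 1, h1, h2, h3⟩ :: B)) r := mult_cons_one rfl _
  rw [isRC_ls_iff (h1 := h1) (h2 := h2)]
  simp only [h, true_and]
  rw [e1] at h ⊢
  obtain ⟨rho, r1, r2, ⟨mu, r3⟩, r4, r5, r6⟩ := exists_columns h1 h2 h hrel
  have hE := colChain_of_columns h2 r2 r6
  obtain ⟨S, F, hF, f1, f2, f3⟩ := exists_first_column r3 r4
  have hS : ∀ a i, 1 ≤ a → a ≤ n → (a ≠ r ∨ s + 1 ≤ i) →
      S r a i = (fun j => singCount (cartan n)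
        (addBox (mult (⟨r, s + 1, h1, h2, h3⟩ :: B)) j) (rho j)) 0 a i := by
    intro a i ha ha' hi
    beta_reduce
    rw [f1 a i ha ha' hi, addBox_zero]
  constructor
  · intro hle i hi
    -- A finite length at node `a` means that `a` is below the entry of the first column, hence
    -- below the larger entry of the second one.
    have h5 := hE.lt_of_fin hF h2 h1 hS f2 fun k a hk hk' => by
      have g1 := r5 ⟨k - 1, by omega⟩ a
      have g2 := f3 ⟨k - 1, by omega⟩ a
      have g3 : (T₁.1 ⟨k - 1, by omega⟩ 0).1 ≤ (T₂.1 ⟨k - 1, by omega⟩ 0).1 := hle ⟨k - 1, by omega⟩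
      simp only [Nat.sub_add_cancel hk] at g1 g2
      intro hne
      exact g2.2 ((g1.1 hne).trans_le g3)
    have hstep := hE r h1 le_rfl
    by_contra hne
    have hi1 : 1 ≤ i := by
      by_contra hi0
      obtain rfl : i = 0 := by omega
      rw [singCount_eq _ _ _ ⟨r, Finset.mem_Icc.2 ⟨h1, h2⟩⟩, Multiset.count_eq_zero] at hne
      exact hne fun hmem => by
        have := h.length_pos _ _ hmem
        simp only at this
        omega
    -- The first removal selects length one below node `r`, so any singular string at `r` bounds its
    -- selection there.
    have h6 := hstep.least r i le_rfl h2
      (by rw [hstep.one _ (by omega)]; exact_mod_cast hi1) (by simp only [r1]; omega)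
    rcases h5 with h5 | h5
    · have h7 := h5.trans_le h6
      rw [Nat.cast_lt] at h7
      omega
    · beta_reduce at h5 h6
      rw [h5] at h6
      exact absurd h6 (by simp)
  · intro hs j
    have hEr : ((s + 1 + 1 : ℕ) : ℕ∞) ≤ (fun j => colEll (mult (⟨r, s + 1, h1, h2, h3⟩ :: B)) j
        (rho j)) r r := by
      by_contra hlt
      rw [not_le] at hlt
      obtain ⟨i, hi⟩ := ENat.ne_top_iff_exists.1 (ne_top_of_lt hlt)
      have h5 := (hE r h1 le_rfl).sing r i le_rfl h2 hi.symm
      simp only [r1] at h5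
      rw [← hi, Nat.cast_lt] at hlt
      have h6 := hs i (by omega)
      omega
    -- A descent in row `j` gives a contradiction at the node equal to the smaller entry: there `F`
    -- is infinite, `E` is finite, and `F + 1 ≤ E`.
    by_contra hlt
    have hlt' : (T₂.1 j 0).1 < (T₁.1 j 0).1 := not_le.1 hlt
    have g1 := (r5 j _).2 hlt'
    have g2 := mt (f3 j (T₂.1 j 0).1).1 (lt_irrefl _)
    have g3 : j.1 < (T₂.1 j 0).1 := (f3 j j.1).1 (by
      rw [(hF (j + 1) (by omega) (by omega)).one _ (by omega)]
      exact ENat.one_ne_top)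
    have g4 := hE.add_one_le hF h2 (by omega) hS hEr (k := j + 1) (by omega) (by omega) g3
    have g5 := not_not.1 g2
    rw [g5] at g4
    exact g1 (top_le_iff.1 g4)

/-- A letter and a column form a larger column if and only if the rigged configuration has the
singular strings of length one that are required for box splitting. -/
theorem lt_iff_singCount {B : List (Index n)} {b : Path (Elt n) B} {r : ℕ} {h0 : 1 ≤ n}
    {h1 : 1 ≤ r + 1} {h2 : r + 1 ≤ n} (hr : r + 2 ≤ n) {T₁ : Tableau n 1 1}
    {T₂ : Tableau n (r + 1) 1} {nu : Rigged (Node n)} {lam : Node n → ℕ}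
    (h : IsRC (cartan n) (splitBox (mult B) (r + 2)) lam nu)
    (hrel : Rel (⟨1, 1, le_rfl, h0, le_rfl⟩ :: ⟨r + 1, 1, h1, h2, le_rfl⟩ :: B) (T₁, T₂, b) nu) :
    T₂.1 (Fin.last r) 0 < T₁.1 0 0 ↔ ∀ a : Node n, a.1 < r + 2 →
      1 ≤ singCount (cartan n) (splitBox (mult B) (r + 2)) nu a 1 := by
  obtain ⟨hx, hrel⟩ := rel_hat.1 hrel
  have e1 : mult (⟨1, 1, le_rfl, h0, le_rfl⟩ :: ⟨r + 1, 1, h1, h2, le_rfl⟩ :: B) =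
      splitBox (mult B) (r + 2) := by
    rw [mult_cons_one rfl, mult_cons_one rfl]
    rfl
  rw [e1] at hx hrel
  obtain ⟨hy, -, -⟩ := rel_col hrel
  constructor
  · intro hlt
    -- The single box is regarded as a column of height one to the left of the column of height `r +
    -- 1`, so that its removal is a `ColStep`.
    have e2 : addBox (addBox (mult B) (r + 1)) 1 = splitBox (addBox (mult B) (r + 1)) 1 := by
      rw [splitBox, addBox_zero]
    have h' : IsRC (cartan n) (addBox (addBox (mult B) (r + 1)) 1) lam nu := h
    have hs := colStep le_rfl h0 h'
    have e3 : colEll (addBox (mult B) (r + 1)) 1 nu =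
        ell (cartan n) (splitBox (mult B) (r + 2)) nu := by
      rw [colEll, iBar_one, ← e2]
      rfl
    have e4 : colDelta (addBox (mult B) (r + 1)) 1 nu =
        deltaA (cartan n) (splitBox (mult B) (r + 2)) nu := by
      rw [colDelta, iBar_one, ← e2]
      rfl
    rw [e3, e4, addBox_zero] at hs
    obtain ⟨mu, hmu⟩ := exists_isRC_colDelta le_rfl h0 h'
    rw [e4, addBox_zero] at hmu
    have hs' := colStep h1 h2 hmu
    -- If the box selected a length of at least two at node `r + 1`, the lengths selected next would
    -- be smaller from that node on. At the node equal to the bottom entry of the column this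
    -- contradicts that entry being smaller than the box.
    have hone : ell (cartan n) (splitBox (mult B) (r + 2)) nu (r + 1) = 1 := by
      by_contra hne
      have h2le : 2 ≤ ell (cartan n) (splitBox (mult B) (r + 2)) nu (r + 1) := by
        have := Order.add_one_le_of_lt (lt_of_le_of_ne (hs.chain.one_le (r + 1)) (Ne.symm hne))
        rwa [one_add_one_eq_two] at this
      have g1 := (hx _).2 hlt
      have g3 : r < (T₂.1 (Fin.last r) 0).1 := (hy r).1 (by
        rw [hs'.one _ (by omega)]
        exact ENat.one_ne_top)
      have g2 := not_not.1 (mt (hy (T₂.1 (Fin.last r) 0).1).1 (lt_irrefl _))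
      have g4 := hs.add_one_le h1 hs' h2le (a := (T₂.1 (Fin.last r) 0).1) g3
      change colEll (mult B) (r + 1) (deltaA (cartan n) (splitBox (mult B) (r + 2)) nu) _ = ⊤ at g2
      rw [g2] at g4
      exact g1 (top_le_iff.1 g4)
    intro a ha
    have ha' := Finset.mem_Icc.1 a.2
    -- The chain starts at one and is still one at node `r + 1`, so it selects a singular string of
    -- length one at every node in between.
    refine hs.sing a 1 ha'.1 ha'.2 (le_antisymm ?_ (hs.chain.one_le _))
    rw [Nat.cast_one, ← hone]
    exact hs.chain.monotone (by omega)
  · intro hs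
    obtain ⟨rho, hrho, rfl⟩ := exists_iBar_eq (by omega) hr h hs
    have hs := colStep (by omega) hr hrho
    obtain ⟨mu, hmu⟩ := exists_isRC_colDelta (by omega) hr hrho
    have hs' := colStep h1 h2 hmu
    -- The configuration now comes from a genuine column of height `r + 2`, so the box and the
    -- column below the cut are successive entries and interlace.
    have hint := hs.interlace (k := r + 1) h1 hs'
    by_contra hlt
    rw [not_lt] at hlt
    have hx0 := (Finset.mem_Icc.1 (T₁.1 0 0).2).1
    have hle : (T₁.1 0 0).1 ≤ (T₂.1 (Fin.last r) 0).1 := hlt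
    have g1 := not_not.1 (mt (hx (T₁.1 0 0).1).1 (lt_irrefl _))
    have g2 := (hy ((T₁.1 0 0).1 - 1)).2 (by omega)
    have g3 := hint ((T₁.1 0 0).1 - 1)
    rw [Nat.sub_add_cancel hx0] at g3
    change colEll (mult B) (r + 2) rho _ = ⊤ at g1
    rw [g1] at g3
    exact g2 (top_le_iff.1 g3)

end TypeA

end PathRC

namespace PathRC

/-! ## Bijections from a recursive relation -/

section Good

variable {I X K : Type} [Fintype I] {E : K → Type} {C : Crystal I X}
  {read : ∀ k, E k → List X} {A : I → I → ℤ} {m : List K → I → Multiset ℕ}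
  {R : (B : List K) → Path E B → Rigged I → Prop} {B : List K}

/-- The relation `R` is a bijection from the highest weight paths in `B` to rigged configurations
that preserves weights. -/
structure Good (C : Crystal I X) (read : ∀ k, E k → List X) (A : I → I → ℤ)
    (m : List K → I → Multiset ℕ) (R : (B : List K) → Path E B → Rigged I → Prop)
    (B : List K) : Prop where
  exists_rc : ∀ {lam b}, IsHW C read B lam b → ∃ nu, IsRC A (m B) lam nu ∧ R B b nu
  exists_path : ∀ {lam nu}, IsRC A (m B) lam nu → ∃ b, IsHW C read B lam b ∧ R B b nu
  rc_unique : ∀ {lam mu b nu rho}, IsRC A (m B) lam nu → IsRC A (m B) mu rho →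
    R B b nu → R B b rho → nu = rho
  path_unique : ∀ {lam b c nu}, IsRC A (m B) lam nu → R B b nu → R B c nu → b = c

/-- For the empty product the weight equation says that a nonnegative combination of simple roots
equals `-λ`; the hypothesis on the Cartan matrix then leaves only the empty configuration and `λ =
0`. -/
theorem good_nil (hm : m [] = fun _ => 0) (hR : ∀ b nu, R [] b nu ↔ nu = fun _ => 0)
    (hA : ∀ c : I → ℕ, (∀ b, ∑ a, (c a : ℤ) * A b a ≤ 0) → ∀ a, c a = 0) :
    Good C read A m R [] := by
  have key : ∀ {lam nu}, IsRC A (m []) lam nu → nu = (fun _ => 0) ∧ lam = fun _ => 0 := by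
    intro lam nu h
    have h0 := hA (fun a => (nu.shape a).sum) fun b => by
      rw [h.weight b, hm]
      simp
    have hnu : nu = fun _ => 0 := by
      funext a
      refine Multiset.eq_zero_of_forall_notMem fun s hs => ?_
      have h1 := h.length_pos a s hs
      have h2 : s.1 ≤ (nu.shape a).sum :=
        Multiset.single_le_sum (fun _ _ => Nat.zero_le _) _ (Multiset.mem_map_of_mem _ hs)
      have := h0 a
      omega
    subst hnu
    rw [hm] at h
    exact ⟨rfl, h.weight_unique (isRC_zero A)⟩
  refine ⟨fun {lam b} h => ?_, fun {lam nu} h => ?_, fun {lam mu b nu rho} h h' _ _ => ?_,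
    fun _ _ _ => rfl⟩
  · obtain rfl := isHW_nil.1 h
    exact ⟨_, hm ▸ isRC_zero A, (hR _ _).2 rfl⟩
  · obtain ⟨rfl, rfl⟩ := key h
    exact ⟨(), isHW_nil.2 rfl, (hR _ _).2 rfl⟩
  · rw [(key h).1, (key h').1]

/-- Both sides decompose in the same way: a highest weight path is a letter and a shorter path
subject to `ε ≤ μ`, and a configuration is a letter and its image under `delta` subject to the same
condition. -/
theorem Good.hat (hB : Good C read A m R B) {k : K} {x : E k → X} (hx : Function.Bijective x)
    (hread : ∀ T, read k T = [x T]) {delta : Rigged I → Rigged I} {IsLet : Rigged I → X → Prop}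
    (hR : ∀ T b nu, R (k :: B) (T, b) nu ↔ IsLet nu (x T) ∧ R B b (delta nu))
    (hex : ∀ {lam nu}, IsRC A (m (k :: B)) lam nu → ∃ y, IsLet nu y)
    (huniq : ∀ {nu y z}, IsLet nu y → IsLet nu z → y = z)
    (hdelta : ∀ {lam nu y}, IsRC A (m (k :: B)) lam nu → IsLet nu y → ∃ mu,
      IsRC A (m B) mu (delta nu) ∧ (∀ a, (mu a : ℤ) + C.wt y a = lam a) ∧ ∀ a, C.eps a y ≤ mu a)
    (hsurj : ∀ {lam mu nu y}, IsRC A (m B) mu nu → (∀ a, (mu a : ℤ) + C.wt y a = lam a) →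
      (∀ a, C.eps a y ≤ mu a) →
      ∃ rho, IsRC A (m (k :: B)) lam rho ∧ delta rho = nu ∧ IsLet rho y)
    (hinj : ∀ {lam mu nu rho y}, IsRC A (m (k :: B)) lam nu → IsRC A (m (k :: B)) mu rho →
      IsLet nu y → IsLet rho y → delta nu = delta rho → nu = rho) :
    Good C read A m R (k :: B) := by
  refine ⟨?_, fun {lam nu} h => ?_, ?_, ?_⟩
  · rintro lam ⟨T, b⟩ h
    obtain ⟨mu, h1, h2, h3⟩ := (isHW_cons (hread T)).1 h
    obtain ⟨nu, h4, h5⟩ := hB.exists_rc h1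
    obtain ⟨rho, h6, h7, h8⟩ := hsurj h4 h3 h2
    exact ⟨rho, h6, (hR _ _ _).2 ⟨h8, h7.symm ▸ h5⟩⟩
  · obtain ⟨y, hy⟩ := hex h
    obtain ⟨mu, h1, h2, h3⟩ := hdelta h hy
    obtain ⟨b, h4, h5⟩ := hB.exists_path h1
    obtain ⟨T, rfl⟩ := hx.2 y
    exact ⟨(T, b), (isHW_cons (hread T)).2 ⟨mu, h4, h3, h2⟩, (hR _ _ _).2 ⟨hy, h5⟩⟩
  · rintro lam mu ⟨T, b⟩ nu rho h h' hr hr'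
    rw [hR] at hr hr'
    obtain ⟨_, h1, _⟩ := hdelta h hr.1
    obtain ⟨_, h2, _⟩ := hdelta h' hr'.1
    exact hinj h h' hr.1 hr'.1 (hB.rc_unique h1 h2 hr.2 hr'.2)
  · rintro lam ⟨T, b⟩ ⟨T', b'⟩ nu h hr hr'
    rw [hR] at hr hr'
    obtain ⟨_, h1, _⟩ := hdelta h hr.1
    obtain rfl := hx.1 (huniq hr.1 hr'.1)
    rw [hB.path_unique h1 hr.2 hr'.2]

/-- Since `s` and `g` are injective, everything is inherited from the finer tensor product as soon
as their images correspond under the relation. That is `himage`, the combinatorial content of a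
splitting. -/
theorem Good.split {k k₁ k₂ : K} (hB : Good C read A m R (k₁ :: k₂ :: B))
    {s : E k → E k₁ × E k₂} (hs : ∀ T, read k T = read k₁ (s T).1 ++ read k₂ (s T).2)
    (hs' : Function.Injective s) {g : Rigged I → Rigged I} (hg : Function.Injective g)
    (hR : ∀ T b nu, R (k :: B) (T, b) nu ↔ R (k₁ :: k₂ :: B) ((s T).1, (s T).2, b) (g nu))
    (hrc : ∀ {lam nu}, IsRC A (m (k :: B)) lam nu → IsRC A (m (k₁ :: k₂ :: B)) lam (g nu))
    (himage : ∀ {lam rho T₁ T₂ b}, IsRC A (m (k₁ :: k₂ :: B)) lam rho →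
      R (k₁ :: k₂ :: B) (T₁, T₂, b) rho →
      ((∃ T, s T = (T₁, T₂)) ↔ ∃ nu, IsRC A (m (k :: B)) lam nu ∧ g nu = rho)) :
    Good C read A m R (k :: B) := by
  refine ⟨?_, fun {lam nu} h => ?_, ?_, ?_⟩
  · rintro lam ⟨T, b⟩ h
    obtain ⟨rho, h1, h2⟩ := hB.exists_rc ((isHW_split (hs T)).2 h)
    obtain ⟨nu, h3, rfl⟩ := (himage h1 h2).1 ⟨T, rfl⟩
    exact ⟨nu, h3, (hR _ _ _).2 h2⟩
  · obtain ⟨⟨T₁, T₂, b⟩, h1, h2⟩ := hB.exists_path (hrc h)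
    obtain ⟨T, hT⟩ := (himage (hrc h) h2).2 ⟨nu, h, rfl⟩
    obtain ⟨rfl, rfl⟩ : T₁ = (s T).1 ∧ T₂ = (s T).2 := by rw [hT]; exact ⟨rfl, rfl⟩
    exact ⟨(T, b), (isHW_split (hs T)).1 h1, (hR _ _ _).2 h2⟩
  · rintro lam mu ⟨T, b⟩ nu rho h h' hr hr'
    rw [hR] at hr hr'
    exact hg (hB.rc_unique (hrc h) (hrc h') hr hr')
  · rintro lam ⟨T, b⟩ ⟨T', b'⟩ nu h hr hr'
    rw [hR] at hr hr'
    have h1 := hB.path_unique (hrc h) hr hr'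
    obtain ⟨h2, h5⟩ := Prod.mk.inj h1
    obtain ⟨h3, h4⟩ := Prod.mk.inj h5
    obtain rfl := hs' (Prod.ext h2 h3)
    rw [h4]

/-- The map from paths to rigged configurations that is defined by a good relation. -/
noncomputable def Good.map (hB : Good C read A m R B) {lam : I → ℕ} (b : HW C read B lam) :
    RC A (m B) lam :=
  ⟨(hB.exists_rc b.2).choose, (hB.exists_rc b.2).choose_spec.1⟩

theorem Good.rel_map (hB : Good C read A m R B) {lam : I → ℕ} (b : HW C read B lam) :
    R B b.1 (hB.map b).1 :=
  (hB.exists_rc b.2).choose_spec.2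

theorem Good.eq_map (hB : Good C read A m R B) {lam mu : I → ℕ} (b : HW C read B lam)
    {nu : Rigged I} (h : IsRC A (m B) mu nu) (hr : R B b.1 nu) : (hB.map b).1 = nu :=
  hB.rc_unique (hB.map b).2 h (hB.rel_map b) hr

theorem Good.bijective_map (hB : Good C read A m R B) (lam : I → ℕ) :
    Function.Bijective (hB.map (lam := lam)) := by
  constructor
  · intro b c h
    have h1 := hB.rel_map c
    rw [← h] at h1
    exact Subtype.ext (hB.path_unique (hB.map b).2 (hB.rel_map b) h1)
  · intro nu
    obtain ⟨b, h1, h2⟩ := hB.exists_path nu.2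
    exact ⟨⟨b, h1⟩, Subtype.ext (hB.eq_map ⟨b, h1⟩ nu.2 h2)⟩

/-- A rigged configuration whose image under `delta` has the weight of a shortened path determines
the removed letter. -/
theorem letter_eq {k : K} {x : E k → X} (hread : ∀ T, read k T = [x T])
    (hwt : ∀ y z : X, (∀ a, C.wt y a = C.wt z a) → y = z)
    {delta : Rigged I → Rigged I} {nu : Rigged I} {y : X} {lam mu : I → ℕ}
    (hk : ∀ T : E k, ∃ x, read k T = [x]) (b : HW C read (k :: B) lam)
    (hdelta : IsRC A (m B) mu (delta nu)) (hmu : ∀ a, (mu a : ℤ) + C.wt y a = lam a)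
    (h : IsRC A (m B) (HW.lh C read k B lam hk b).1.1 (delta nu)) : y = x b.1.1 := by
  refine hwt _ _ fun a => ?_
  obtain rfl := hdelta.weight_unique h
  obtain ⟨mu', h1, -, h3⟩ := (isHW_cons (T := b.1.1) (b := b.1.2) (hread b.1.1)).1 b.2
  have h4 := h1.weight_unique (HW.lh C read k B lam hk b).2.2
  have h5 := hmu a
  have h6 := h3 a
  rw [h4] at h6
  omega

theorem Good.map_lh {k : K} (hB' : Good C read A m R B) (hB : Good C read A m R (k :: B))
    {x : E k → X} {delta : Rigged I → Rigged I} {IsLet : Rigged I → X → Prop}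
    (hR : ∀ T b nu, R (k :: B) (T, b) nu ↔ IsLet nu (x T) ∧ R B b (delta nu))
    (hdelta : ∀ {lam nu y}, IsRC A (m (k :: B)) lam nu → IsLet nu y → ∃ mu,
      IsRC A (m B) mu (delta nu) ∧ (∀ a, (mu a : ℤ) + C.wt y a = lam a) ∧ ∀ a, C.eps a y ≤ mu a)
    (hk : ∀ T : E k, ∃ x, read k T = [x]) {lam : I → ℕ} (b : HW C read (k :: B) lam) :
    (hB'.map (HW.lh C read k B lam hk b).2).1 = delta (hB.map b).1 := by
  obtain ⟨h1, h2⟩ := (hR b.1.1 b.1.2 _).1 (hB.rel_map b)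
  obtain ⟨mu, h3, -⟩ := hdelta (hB.map b).2 h1
  exact hB'.eq_map _ h3 h2

theorem Good.map_split {k k₁ k₂ : K} (hB : Good C read A m R (k :: B))
    (hB' : Good C read A m R (k₁ :: k₂ :: B))
    {s : E k → E k₁ × E k₂} (hs : ∀ T, read k T = read k₁ (s T).1 ++ read k₂ (s T).2)
    {g : Rigged I → Rigged I}
    (hR : ∀ T b nu, R (k :: B) (T, b) nu ↔ R (k₁ :: k₂ :: B) ((s T).1, (s T).2, b) (g nu))
    (hrc : ∀ {lam nu}, IsRC A (m (k :: B)) lam nu → IsRC A (m (k₁ :: k₂ :: B)) lam (g nu))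
    {lam : I → ℕ} (b : HW C read (k :: B) lam) :
    (hB'.map (HW.split C read s hs B lam b)).1 = g (hB.map b).1 :=
  hB'.eq_map _ (hrc (hB.map b).2) ((hR b.1.1 b.1.2 _).1 (hB.rel_map b))

end Good

end PathRC

/-! ### The bijection in type `A` -/

namespace PathRC

open Selection

namespace TypeA

variable {n : ℕ}

theorem lhArray_mult_hat {h1 : 1 ≤ 1} {h2 : 1 ≤ n} {h3 : 1 ≤ 1} (B : List (Index n)) :
    lhArray (mult (⟨1, 1, h1, h2, h3⟩ :: B)) = mult B := by
  funext a
  rw [lhArray, mult_cons]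
  by_cases ha : a.1 = 1
  · rw [if_pos ha, if_pos ha.symm, Multiset.erase_cons_head]
  · rw [if_neg ha, if_neg (Ne.symm ha)]

theorem one_mem_mult_hat {h1 : 1 ≤ 1} {h2 : 1 ≤ n} {h3 : 1 ≤ 1} (B : List (Index n))
    (a : Node n) (ha : a.1 = 1) : 1 ∈ mult (⟨1, 1, h1, h2, h3⟩ :: B) a := by
  rw [mult_cons, if_pos ha.symm]
  exact Multiset.mem_cons_self _ _

/-- For `y < z` the coordinate at node `y` separates the weights: it is `1` for `y` and nonpositive
for `z`. -/
theorem letter_eq_of_wt (y z : Node (n + 1)) (h : ∀ a, (letters n).wt y a = (letters n).wt z a) :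
    y = z := by
  have hy := Finset.mem_Icc.1 y.2
  have hz := Finset.mem_Icc.1 z.2
  have key : ∀ y z : Node (n + 1), (∀ a, (letters n).wt y a = (letters n).wt z a) →
      ¬ y.1 < z.1 := by
    intro y z h hlt
    have hy := Finset.mem_Icc.1 y.2
    have hz := Finset.mem_Icc.1 z.2
    have := h ⟨y.1, Finset.mem_Icc.2 ⟨hy.1, by omega⟩⟩
    rw [wt_letters, wt_letters] at this
    simp only at this
    split_ifs at this <;> omega
  have h1 := key y z h
  have h2 := key z y fun a => (h a).symm
  exact Subtype.ext (by omega)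

theorem bijective_entry {h1 : 1 ≤ 1} {h2 : 1 ≤ n} {h3 : 1 ≤ 1} :
    Function.Bijective fun T : Elt n ⟨1, 1, h1, h2, h3⟩ => T.1 (0 : Fin 1) (0 : Fin 1) := by
  constructor
  · intro T T' h
    refine Subtype.ext (funext fun i => funext fun j => ?_)
    obtain rfl : i = (0 : Fin 1) := Fin.ext (Nat.lt_one_iff.1 i.2)
    obtain rfl : j = (0 : Fin 1) := Fin.ext (Nat.lt_one_iff.1 j.2)
    exact h
  · intro y
    exact ⟨⟨fun _ _ => y, fun _ _ _ _ => le_rfl, fun _ (i : Fin 1) (j : Fin 1) hij =>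
      absurd hij (by simp [Subsingleton.elim i j])⟩, rfl⟩

theorem ls_injective {r s : ℕ} :
    Function.Injective (Tableau.ls : Tableau n r (s + 1) → Tableau n r 1 × Tableau n r s) := by
  intro T T' h
  obtain ⟨h1, h2⟩ := Prod.mk.inj h
  refine Subtype.ext (funext fun i => funext fun j => ?_)
  refine Fin.cases ?_ (fun j => ?_) j
  · exact congrFun (congrFun (congrArg Subtype.val h1) i) 0
  · exact congrFun (congrFun (congrArg Subtype.val h2) i) j

theorem lb_injective {r : ℕ} :
    Function.Injective (Tableau.lb : Tableau n (r + 1) 1 → Tableau n 1 1 × Tableau n r 1) := by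
  intro T T' h
  obtain ⟨h1, h2⟩ := Prod.mk.inj h
  refine Subtype.ext (funext fun i => funext fun j => ?_)
  obtain rfl : j = 0 := Subsingleton.elim _ _
  refine Fin.lastCases ?_ (fun i => ?_) i
  · exact congrFun (congrFun (congrArg Subtype.val h1) 0) 0
  · exact congrFun (congrFun (congrArg Subtype.val h2) i) 0

theorem exists_ls_eq_iff {r s : ℕ} {T₁ : Tableau n r 1} {T₂ : Tableau n r (s + 1)} :
    (∃ T : Tableau n r (s + 2), T.ls = (T₁, T₂)) ↔ ∀ i, T₁.1 i 0 ≤ T₂.1 i 0 := by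
  constructor
  · rintro ⟨T, hT⟩ i
    obtain ⟨rfl, rfl⟩ := Prod.mk.inj hT
    exact T.2.1 i (Fin.zero_le _)
  · intro h
    refine ⟨⟨fun i => Fin.cons (T₁.1 i 0) (T₂.1 i), fun i => ?_, fun j => ?_⟩, ?_⟩
    · refine Fin.monotone_iff_le_succ.2 fun j => ?_
      refine Fin.cases ?_ (fun j => ?_) j
      · exact h i
      · exact T₂.2.1 i (Fin.castSucc_le_succ j)
    · refine Fin.cases ?_ (fun j => ?_) j
      · exact T₁.2.2 0
      · exact T₂.2.2 j
    · refine Prod.ext (Subtype.ext (funext fun i => funext fun j => ?_))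
        (Subtype.ext (funext fun i => funext fun j => rfl))
      obtain rfl : j = 0 := Subsingleton.elim _ _
      rfl

theorem exists_lb_eq_iff {r : ℕ} {T₁ : Tableau n 1 1} {T₂ : Tableau n (r + 1) 1} :
    (∃ T : Tableau n (r + 2) 1, T.lb = (T₁, T₂)) ↔ T₂.1 (Fin.last r) 0 < T₁.1 0 0 := by
  constructor
  · rintro ⟨T, hT⟩
    obtain ⟨rfl, rfl⟩ := Prod.mk.inj hT
    exact T.2.2 0 (Fin.castSucc_lt_last _)
  · intro h
    refine ⟨⟨Fin.snoc (α := fun _ => Fin 1 → Node (n + 1)) T₂.1 (T₁.1 0), fun i => ?_,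
      fun j => ?_⟩, ?_⟩
    · intro j j' _
      rw [Subsingleton.elim j j']
    · obtain rfl : j = 0 := Subsingleton.elim _ _
      refine Fin.strictMono_iff_lt_succ.2 fun i => ?_
      refine Fin.lastCases ?_ (fun i => ?_) i
      · rw [Fin.succ_last, Fin.snoc_last, Fin.snoc_castSucc]
        exact h
      · rw [Fin.succ_castSucc, Fin.snoc_castSucc, Fin.snoc_castSucc]
        exact T₂.2.2 0 (Fin.castSucc_lt_succ)
    · refine Prod.ext (Subtype.ext (funext fun i => funext fun j => ?_))
        (Subtype.ext (funext fun i => funext fun j => ?_))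
      · obtain rfl : j = 0 := Subsingleton.elim _ _
        obtain rfl : i = 0 := Subsingleton.elim _ _
        simp [Tableau.lb]
      · obtain rfl : j = 0 := Subsingleton.elim _ _
        simp [Tableau.lb]

theorem mult_lb {r : ℕ} {h3 : 1 ≤ 1} {h4 : 1 ≤ n} {h5 : 1 ≤ r + 1} {h6 : r + 1 ≤ n}
    (B : List (Index n)) : mult (⟨1, 1, h3, h4, h3⟩ :: ⟨r + 1, 1, h5, h6, h3⟩ :: B) =
      splitBox (mult B) (r + 2) := by
  rw [mult_cons_one rfl, mult_cons_one rfl]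
  rfl

theorem isRC_lb {r : ℕ} {h1 : 1 ≤ r + 2} {h2 : r + 2 ≤ n} {h3 : 1 ≤ 1} {h4 : 1 ≤ n}
    {h5 : 1 ≤ r + 1} {h6 : r + 1 ≤ n} {B : List (Index n)} {lam : Node n → ℕ}
    {nu : Rigged (Node n)} (h : IsRC (cartan n) (mult (⟨r + 2, 1, h1, h2, h3⟩ :: B)) lam nu) :
    IsRC (cartan n) (mult (⟨1, 1, h3, h4, h3⟩ :: ⟨r + 1, 1, h5, h6, h3⟩ :: B)) lam
      (iBar (cartan n) (splitBox (mult B) (r + 2)) (r + 2) nu) := by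
  rw [mult_lb]
  rw [mult_cons_one rfl] at h
  exact isRC_iBar h1 h2 h

theorem isRC_ls {r s : ℕ} {h1 : 1 ≤ r} {h2 : r ≤ n} {h3 : 1 ≤ s + 2} {h4 : 1 ≤ 1}
    {h5 : 1 ≤ s + 1} {B : List (Index n)} {lam : Node n → ℕ}
    {nu : Rigged (Node n)} (h : IsRC (cartan n) (mult (⟨r, s + 2, h1, h2, h3⟩ :: B)) lam nu) :
    IsRC (cartan n) (mult (⟨r, 1, h1, h2, h4⟩ :: ⟨r, s + 1, h1, h2, h5⟩ :: B)) lam nu :=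
  ((isRC_ls_iff (h1 := h1) (h2 := h2)).1 h).1

/-- The cost of removing all letters of a tensor product. -/
def size (B : List (Index n)) : ℕ := (B.map fun k => 2 * k.r * k.s - 1).sum

theorem size_hat {h1 : 1 ≤ 1} {h2 : 1 ≤ n} {h3 : 1 ≤ 1} (B : List (Index n)) :
    size B < size (⟨1, 1, h1, h2, h3⟩ :: B) := by
  simp only [size, List.map_cons, List.sum_cons]
  omega

theorem size_lb {r : ℕ} {h1 : 1 ≤ r + 2} {h2 : r + 2 ≤ n} {h3 : 1 ≤ 1} {h4 : 1 ≤ n}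
    {h5 : 1 ≤ r + 1} {h6 : r + 1 ≤ n} (B : List (Index n)) :
    size (⟨1, 1, h3, h4, h3⟩ :: ⟨r + 1, 1, h5, h6, h3⟩ :: B) <
      size (⟨r + 2, 1, h1, h2, h3⟩ :: B) := by
  simp only [size, List.map_cons, List.sum_cons]
  omega

theorem size_ls {r s : ℕ} {h1 : 1 ≤ r} {h2 : r ≤ n} {h3 : 1 ≤ s + 2} {h4 : 1 ≤ 1}
    {h5 : 1 ≤ s + 1} (B : List (Index n)) :
    size (⟨r, 1, h1, h2, h4⟩ :: ⟨r, s + 1, h1, h2, h5⟩ :: B) <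
      size (⟨r, s + 2, h1, h2, h3⟩ :: B) := by
  simp only [size, List.map_cons, List.sum_cons]
  have : 2 * r * (s + 2) = 2 * r * (s + 1) + 2 * r := Nat.mul_succ _ _
  have : 2 * r ≤ 2 * r * (s + 1) := Nat.le_mul_of_pos_right _ (by omega)
  omega

/-- Induction on tensor products along the maps `lh`, `lb` and `ls`. -/
theorem split_induction {motive : List (Index n) → Prop} (nil : motive [])
    (hat : ∀ h1 h2 h3 B, motive B → motive (⟨1, 1, h1, h2, h3⟩ :: B))
    (lb : ∀ r h1 h2 h3 h4 h5 h6 B,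
      motive (⟨1, 1, h3, h4, h3⟩ :: ⟨r + 1, 1, h5, h6, h3⟩ :: B) →
      motive (⟨r + 2, 1, h1, h2, h3⟩ :: B))
    (ls : ∀ r s h1 h2 h3 h4 h5 B, motive (⟨r, 1, h1, h2, h4⟩ :: ⟨r, s + 1, h1, h2, h5⟩ :: B) →
      motive (⟨r, s + 2, h1, h2, h3⟩ :: B)) (B : List (Index n)) : motive B := by
  induction hN : size B using Nat.strong_induction_on generalizing B with
  | _ N ih =>
    subst hN
    match B with
    | [] => exact nil
    | ⟨1, 1, h1, h2, h3⟩ :: B => exact hat h1 h2 h3 B (ih _ (size_hat B) B rfl)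
    | ⟨r + 2, 1, h1, h2, h3⟩ :: B =>
      exact lb r h1 h2 h3 (by omega) (by omega) (by omega) B (ih _ (size_lb B) _ rfl)
    | ⟨r, s + 2, h1, h2, h3⟩ :: B =>
      exact ls r s h1 h2 h3 (by omega) (by omega) B (ih _ (size_ls B) _ rfl)

theorem good (B : List (Index n)) :
    Good (letters n) (read n) (cartan n) mult Rel B := by
  induction B using split_induction with
  | nil => exact good_nil rfl (fun _ _ => rel_nil) fun c hc => sum_nonpos_of_cartan hc
  | hat h1 h2 h3 B ih =>
    refine ih.hat bijective_entry (Tableau.read_one (n := n))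
      (delta := deltaA (cartan n) (mult (⟨1, 1, h1, h2, h3⟩ :: B)))
      (IsLet := fun nu => IsLetter (ell (cartan n) (mult (⟨1, 1, h1, h2, h3⟩ :: B)) nu))
      (fun T b nu => rel_hat) (fun _ => (isChain_ell _ _ _).exists_isLetter)
      (fun h h' => h.unique h') (fun h hy => ?_) (fun h h' h'' => ?_)
      fun h h' hy hy' heq => deltaA_injective (one_mem_mult_hat B) h h' hy hy' heq
    · have := exists_isRC_deltaA (one_mem_mult_hat B) h hy
      rwa [lhArray_mult_hat] at this
    · rw [← lhArray_mult_hat (h1 := h1) (h2 := h2) (h3 := h3) B] at h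
      exact exists_deltaA_eq (one_mem_mult_hat B) h h' h''
  | lb r h1 h2 h3 h4 h5 h6 B ih =>
    refine ih.split (s := Tableau.lb) Tableau.read_lb lb_injective
      (fun _ _ h => iBar_injective (M := mult B) h1 h2 h) (fun T b nu => rel_lb) isRC_lb ?_
    intro lam rho T₁ T₂ b h hr
    rw [mult_lb] at h
    refine (exists_lb_eq_iff.trans (lt_iff_singCount h2 h hr)).trans ⟨fun hs => ?_, ?_⟩
    · obtain ⟨nu, h7, h8⟩ := exists_iBar_eq h1 h2 h hs
      refine ⟨nu, ?_, h8⟩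
      rw [mult_cons_one rfl]
      exact h7
    · rintro ⟨nu, h7, rfl⟩ a ha
      rw [count_iBar h1 h2, if_pos ha, hit_of_eq (by simp)]
      exact Nat.le_add_left _ _
  | ls r s h1 h2 h3 h4 h5 B ih =>
    refine ih.split (s := Tableau.ls) (g := id) Tableau.read_ls ls_injective
      Function.injective_id (fun T b nu => rel_ls) isRC_ls ?_
    intro lam rho T₁ T₂ b h hr
    refine (exists_ls_eq_iff.trans (le_iff_isRC (h4 := h3) h hr)).trans ?_
    simp

/-- A family of bijections with the required compatibilities satisfies the recursive relation. -/
theorem IsBijectionFamily.rel {hn : 1 ≤ n}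
    {phi : ∀ (B : List (Index n)) (lam : Node n → ℕ), P n B lam → RCs n B lam}
    (h : IsBijectionFamily hn phi) (B : List (Index n)) :
    ∀ (lam : Node n → ℕ) (b : P n B lam), Rel B b.1 (phi B lam b).1 := by
  induction B using split_induction with
  | nil =>
    rintro lam ⟨b, hb⟩
    obtain rfl := isHW_nil.1 hb
    exact rel_nil.2 h.empty
  | hat h1 h2 h3 B ih =>
    intro lam b
    have h4 := h.left_hat B lam b
    obtain ⟨y, hy⟩ := (isChain_ell (cartan n) (mult (⟨1, 1, h1, h2, h3⟩ :: B))
      (phi _ lam b).1).exists_isLetter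
    obtain ⟨mu, h5, h6, -⟩ := exists_isRC_deltaA (one_mem_mult_hat B) (phi _ lam b).2 hy
    rw [lhArray_mult_hat] at h5
    have h7 := (phi B (lh hn B lam b).1 (lh hn B lam b).2).2
    rw [h4] at h7
    -- The configuration has some removed letter `y`; the weight of the shortened path forces `y` to
    -- be the leftmost letter of the path.
    obtain rfl := letter_eq (read := read n) (k := ⟨1, 1, h1, h2, h3⟩)
      (x := fun T => T.1 (0 : Fin 1) (0 : Fin 1)) (Tableau.read_one (n := n)) letter_eq_of_wt
      (fun T => ⟨_, Tableau.read_one (n := n) T⟩) b h5 h6 h7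
    refine rel_hat.2 ⟨hy, ?_⟩
    rw [← h4]
    exact ih _ (lh hn B lam b).2
  | lb r h1 h2 h3 h4 h5 h6 B ih =>
    intro lam b
    refine rel_lb.2 ?_
    have h7 := h.box_split (r + 1) h5 h2 B lam b
    have h8 := ih lam (TypeA.lb h5 h2 B lam b)
    rw [h7, mult_lb] at h8
    exact h8
  | ls r s h1 h2 h3 h4 h5 B ih =>
    intro lam b
    refine rel_ls.2 ?_
    have h7 := h.left_split r (s + 1) h1 h2 h5 B lam b
    have h8 := ih lam (TypeA.ls h1 h2 h5 B lam b)
    rw [h7] at h8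
    exact h8

theorem isBijectionFamily_map (hn : 1 ≤ n) :
    IsBijectionFamily hn fun B _ b => (good B).map b where
  bijective B lam := (good B).bijective_map lam
  empty := rel_nil.1 ((good []).rel_map (HW.empty (letters n) (read n)))
  left_hat B lam b := (good B).map_lh (good _) (fun T b nu => rel_hat) (fun h hy => by
    have := exists_isRC_deltaA (one_mem_mult_hat B) h hy
    rwa [lhArray_mult_hat] at this) _ b
  left_split r s h1 hr hs B lam b := by
    obtain ⟨s, rfl⟩ : ∃ t, s = t + 1 := ⟨s - 1, by omega⟩
    exact (good (⟨r, s + 1 + 1, h1, hr, by omega⟩ :: B)).map_split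
      (good (⟨r, 1, h1, hr, le_rfl⟩ :: ⟨r, s + 1, h1, hr, hs⟩ :: B)) (s := Tableau.ls) (g := id)
      Tableau.read_ls (fun T b nu => rel_ls) isRC_ls b
  box_split r h1 hr B lam b := by
    obtain ⟨r, rfl⟩ : ∃ t, r = t + 1 := ⟨r - 1, by omega⟩
    refine Eq.trans ?_ (congrArg (fun L => iBar (cartan n) L (r + 2) _) (mult_lb B)).symm
    exact (good (⟨r + 1 + 1, 1, by omega, hr, le_rfl⟩ :: B)).map_split
      (good (⟨1, 1, le_rfl, hn, le_rfl⟩ :: ⟨r + 1, 1, h1, by omega, le_rfl⟩ :: B))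
      (s := Tableau.lb) Tableau.read_lb (fun T b nu => rel_lb) isRC_lb b

theorem existsUnique_isBijectionFamily (hn : 1 ≤ n) :
    ∃! phi : (∀ (B : List (Index n)) (lam : Node n → ℕ), P n B lam → RCs n B lam),
      IsBijectionFamily hn phi := by
  refine ⟨_, isBijectionFamily_map hn, fun phi h => ?_⟩
  funext B lam b
  exact (Subtype.ext ((good B).eq_map b (phi B lam b).2 (h.rel B lam b))).symm

end TypeA

end PathRC

namespace PathRC

open Selection

namespace TypeD

/-! ## Selected lengths in type `D` -/

variable {n : ℕ}

theorem sum_cartan (hn : 4 ≤ n) (g : ℕ → ℤ) (a : Node n) :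
    ∑ b : Node n, cartan n a b * g b =
      2 * g a - (if a.1 = 1 then 0 else if a.1 = n then g (n - 2) else g (a - 1)) -
        (if a.1 ≤ n - 2 then g (a + 1) else 0) - (if a.1 = n - 2 then g n else 0) := by
  have ha := Finset.mem_Icc.1 a.2
  have h1 : ∀ b : Node n, cartan n a b * g b =
      (if a.1 = b.1 then 2 * g a else 0) -
        (if (if a.1 = n then n - 2 else a.1 - 1) = b.1 then
          (if a.1 = n then g (n - 2) else g (a - 1)) else 0) -
        (if a.1 + 1 = b.1 then (if a.1 ≤ n - 2 then g (a + 1) else 0) else 0) -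
        (if n = b.1 then (if a.1 = n - 2 then g n else 0) else 0) := by
    intro b
    have hb := Finset.mem_Icc.1 b.2
    simp only [cartan, Subtype.ext_iff]
    by_cases c1 : a.1 = b.1
    · rw [if_pos c1, if_pos c1, c1, if_neg (by split_ifs <;> omega), if_neg (by omega)]
      split_ifs <;> omega
    by_cases c2 : (if a.1 = n then n - 2 else a.1 - 1) = b.1
    · have c3 : ((a.1 + 1 = b.1 ∧ b.1 < n) ∨ (b.1 + 1 = a.1 ∧ a.1 < n) ∨
          (a.1 + 2 = n ∧ b.1 = n) ∨ (b.1 + 2 = n ∧ a.1 = n)) := by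
        split_ifs at c2 <;> omega
      rw [if_neg c1, if_pos c3, if_neg c1, if_pos c2,
        if_neg (show ¬ a.1 + 1 = b.1 by split_ifs at c2 <;> omega),
        if_neg (show ¬ n = b.1 by split_ifs at c2 <;> omega)]
      by_cases c5 : a.1 = n
      · rw [if_pos c5] at c2 ⊢
        rw [← c2]
        ring
      · rw [if_neg c5] at c2 ⊢
        rw [← c2]
        ring
    by_cases c3 : a.1 + 1 = b.1 ∧ a.1 ≤ n - 2
    · rw [if_neg c1, if_pos (by omega), if_neg c1, if_neg c2, if_pos c3.1, if_pos c3.2,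
        if_neg (by omega), c3.1]
      ring
    by_cases c4 : n = b.1 ∧ a.1 = n - 2
    · rw [if_neg c1, if_pos (by omega), if_neg c1, if_neg c2, if_neg (by omega), if_pos c4.1,
        if_pos c4.2, ← c4.1]
      ring
    · rw [if_neg c1, if_neg (by split_ifs at c2 <;> omega), if_neg c1, if_neg c2]
      split_ifs <;> omega
  rw [Finset.sum_congr rfl fun b _ => h1 b]
  have h2 : ∀ (k : ℕ) (z : ℤ), ∑ b : Node n, (if k = b.1 then z else 0) =
      if k ∈ Finset.Icc 1 n then z else 0 := by
    intro k z
    rw [Finset.sum_coe_sort (Finset.Icc 1 n) (fun b => if k = b then z else 0), Finset.sum_ite_eq]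
  rw [Finset.sum_sub_distrib, Finset.sum_sub_distrib, Finset.sum_sub_distrib, h2, h2, h2, h2]
  simp only [Finset.mem_Icc]
  rw [if_pos ha, if_pos (show 1 ≤ n ∧ n ≤ n by omega)]
  split_ifs <;> omega

theorem isCartan_cartan (n : ℕ) : IsCartan (cartan n) where
  diag a := by simp [cartan]
  offdiag a b h := by
    simp only [cartan, if_neg h]
    split_ifs <;> simp

/-- The inequalities at the two tips bound `g (n - 1) + g n` by `g (n - 2)`, so the one at the fork
gives `g (n - 2) ≤ g (n - 3)`. Convexity carries this monotonicity down the tail to `g 0 = 0`. -/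
theorem sum_nonpos_of_cartan (hn : 4 ≤ n) {c : Node n → ℕ}
    (h : ∀ b, ∑ a, (c a : ℤ) * cartan n b a ≤ 0) (a : Node n) : c a = 0 := by
  obtain ⟨g, hdef⟩ : ∃ g : ℕ → ℤ, ∀ k, g k = if h : k ∈ Finset.Icc 1 n then (c ⟨k, h⟩ : ℤ) else 0 :=
    ⟨_, fun _ => rfl⟩
  have hg : ∀ a : Node n, g a = c a := fun a => (hdef a).trans (dif_pos a.2)
  have g0 : g 0 = 0 := (hdef 0).trans (dif_neg (by simp))
  have hpos : ∀ k, 0 ≤ g k := fun k => by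
    rw [hdef]; split_ifs <;> simp
  have hc : ∀ k, 1 ≤ k → k ≤ n → 2 * g k -
      (if k = 1 then 0 else if k = n then g (n - 2) else g (k - 1)) -
        (if k ≤ n - 2 then g (k + 1) else 0) - (if k = n - 2 then g n else 0) ≤ 0 := by
    intro k h1 h2
    have h3 := h ⟨k, Finset.mem_Icc.2 ⟨h1, h2⟩⟩
    have h4 := sum_cartan hn g ⟨k, Finset.mem_Icc.2 ⟨h1, h2⟩⟩
    rw [Finset.sum_congr rfl fun a _ => by rw [mul_comm, ← hg a], h4] at h3
    exact h3
  have e1 := hc n (by omega) le_rfl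
  have e2 := hc (n - 1) (by omega) (by omega)
  have e3 := hc (n - 2) (by omega) (by omega)
  rw [if_neg (by omega), if_pos rfl, if_neg (by omega), if_neg (by omega)] at e1
  rw [if_neg (by omega), if_neg (by omega), if_neg (by omega), if_neg (by omega),
    show n - 1 - 1 = n - 2 by omega] at e2
  rw [if_neg (by omega), if_neg (by omega), if_pos (by omega), if_pos rfl,
    show n - 2 + 1 = n - 1 by omega] at e3
  have hd : ∀ d k, k + d = n - 2 → 1 ≤ k → g k ≤ g (k - 1) := by
    intro d
    induction d with
    | zero =>
      intro k hk _
      obtain rfl : k = n - 2 := by omega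
      omega
    | succ d ih =>
      intro k hk h1
      have h2 := ih (k + 1) (by omega) (by omega)
      have h3 := hc k h1 (by omega)
      rw [if_neg (show ¬ k = n by omega), if_pos (show k ≤ n - 2 by omega),
        if_neg (show ¬ k = n - 2 by omega)] at h3
      rw [Nat.add_sub_cancel] at h2
      have := hpos (k - 1)
      split_ifs at h3 <;> omega
  have hz : ∀ k, k ≤ n - 2 → g k = 0 := by
    intro k
    induction k with
    | zero => exact fun _ => g0
    | succ k ih =>
      intro hk
      have h1 := ih (by omega)
      have h2 := hd (n - 2 - (k + 1)) (k + 1) (by omega) (by omega)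
      have h3 := hpos (k + 1)
      rw [Nat.add_sub_cancel] at h2
      omega
  have hz2 := hz (n - 2) le_rfl
  have := hpos n
  have := hpos (n - 1)
  have ha := Finset.mem_Icc.1 a.2
  have h5 : g a = 0 := by
    by_cases c1 : a.1 ≤ n - 2
    · exact hz _ c1
    by_cases c2 : a.1 = n
    · rw [c2]; omega
    · rw [show a.1 = n - 1 by omega]; omega
  rw [hg] at h5
  exact_mod_cast h5

/-- The selection at the node `a` for the selected lengths `e` on the way up and `b` on the way
down. -/
noncomputable def selection (e b : ℕ → ℕ∞) (a : Node n) : Selection :=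
  if a.1 ≤ n - 2 then
    ⟨e (a - 1), e a, if a.1 = n - 2 then min (e (n - 1)) (e n) else e (a + 1), b (a + 1), b a,
      b (a - 1)⟩
  else ⟨e (n - 2), e a, b (n - 2), ⊤, ⊤, ⊤⟩

theorem selection_of_le {e b : ℕ → ℕ∞} {a : Node n} (h : a.1 ≤ n - 2) : selection e b a =
    ⟨e (a - 1), e a, if a.1 = n - 2 then min (e (n - 1)) (e n) else e (a + 1), b (a + 1), b a,
      b (a - 1)⟩ := if_pos h

theorem selection_of_lt {e b : ℕ → ℕ∞} {a : Node n} (h : n - 2 < a.1) : selection e b a =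
    ⟨e (n - 2), e a, b (n - 2), ⊤, ⊤, ⊤⟩ := if_neg (not_le.2 h)

theorem lengths_selection (e b : ℕ → ℕ∞) (a : Node n) : (selection e b a).lengths =
    finiteIndex (e a) + if a.1 ≤ n - 2 then finiteIndex (b a) else 0 := by
  by_cases h : a.1 ≤ n - 2
  · rw [selection_of_le h, if_pos h]
    rfl
  · rw [selection_of_lt (not_le.1 h), if_neg h]
    simp [lengths, finiteIndex_top]

/-- Weakly increasing lengths that start with `1`, go up to the nodes `n - 1` and `n`, go down
again and end with `∞`. -/
structure IsChain (n : ℕ) (e b : ℕ → ℕ∞) : Prop where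
  zero : e 0 = 1
  up : ∀ a, a < n - 1 → e a ≤ e (a + 1)
  fork : e (n - 2) ≤ e n
  turn : b (n - 1) = max (e (n - 1)) (e n)
  down : ∀ a, a < n - 1 → b (a + 1) ≤ b a
  top : b 0 = ⊤

namespace IsChain

variable {e b : ℕ → ℕ∞}

theorem up_le (h : IsChain n e b) {a c : ℕ} (hac : a ≤ c) (hc : c ≤ n - 1) : e a ≤ e c := by
  induction c, hac using Nat.le_induction with
  | base => exact le_rfl
  | succ c _ ih => exact (ih (by omega)).trans (h.up c (by omega))

theorem down_le (h : IsChain n e b) {a c : ℕ} (hac : a ≤ c) (hc : c ≤ n - 1) : b c ≤ b a := by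
  induction c, hac using Nat.le_induction with
  | base => exact le_rfl
  | succ c _ ih => exact (h.down c (by omega)).trans (ih (by omega))

theorem le_bar (h : IsChain n e b) {a c : ℕ} (ha : a ≤ n - 1) (hc : c ≤ n - 1) : e a ≤ b c :=
  (h.up_le ha le_rfl).trans ((le_max_left _ _).trans (h.turn ▸ h.down_le hc le_rfl))

theorem last_le_bar (h : IsChain n e b) {c : ℕ} (hc : c ≤ n - 1) : e n ≤ b c :=
  (le_max_right _ _).trans (h.turn ▸ h.down_le hc le_rfl)

theorem one_le (h : IsChain n e b) {a : ℕ} (ha : a ≤ n - 1) : 1 ≤ e a :=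
  h.zero ▸ h.up_le (Nat.zero_le a) ha

theorem ordered (h : IsChain n e b) (hn : 4 ≤ n) (a : Node n) : (selection e b a).Ordered := by
  have ha := Finset.mem_Icc.1 a.2
  by_cases c : a.1 ≤ n - 2
  · rw [selection_of_le c]
    refine ⟨h.one_le (by omega), h.up_le (by omega) (by omega), ?_, ?_, h.down _ (by omega),
      h.down_le (by omega) (by omega)⟩
    · dsimp only
      split_ifs with c1
      · rw [c1]
        exact le_min (h.up_le (by omega) (by omega)) h.fork
      · exact h.up _ (by omega)
    · dsimp only
      split_ifs with c1
      · exact (min_le_left _ _).trans (h.le_bar le_rfl (by omega))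
      · exact h.le_bar (by omega) (by omega)
  · rw [selection_of_lt (not_le.1 c)]
    have h1 : e (n - 2) ≤ e a ∧ e a ≤ b (n - 2) := by
      by_cases c1 : a.1 = n
      · rw [c1]
        exact ⟨h.fork, h.last_le_bar (by omega)⟩
      · exact ⟨h.up_le (by omega) (by omega), h.le_bar (by omega) (by omega)⟩
    exact ⟨h.one_le (by omega), h1.1, h1.2, le_top, le_top, le_top⟩

end IsChain

/-- At node `n - 2` the two tips are unordered neighbours. They enter the selection as minimum and
maximum, which makes the lengths ordered without changing the gain, and the maximum is the length
from which the way down starts. -/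
theorem step_min_add_step_max (s t : ℕ∞) (i : ℕ) :
    step (min s t) i + step (max s t) i = step s i + step t i := by
  rcases le_total s t with h | h
  · rw [min_eq_left h, max_eq_right h]
  · rw [min_eq_right h, max_eq_left h, add_comm]

theorem IsChain.isMove {e b : ℕ → ℕ∞} (h : IsChain n e b) (hn : 4 ≤ n) :
    IsMove (cartan n) (hatArray n) (selection e b) where
  ordered := h.ordered hn
  hat := eq_one_of_mem_hatArray
  compat a i := by
    have ha := Finset.mem_Icc.1 a.2
    have h1 : ∀ c : Node n, ((selection e b c).lengths.countP (· ≤ i) : ℤ) =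
        step (e c) i + if c.1 ≤ n - 2 then step (b c) i else 0 := fun c => by
      rw [countP_lengths]
      by_cases hc : c.1 ≤ n - 2
      · rw [selection_of_le hc, if_pos hc]
      · rw [selection_of_lt (not_le.1 hc), if_neg hc]
        simp
    simp only [h1, countP_hatArray, gain]
    rw [sum_cartan hn (fun c => step (e c) i + if c ≤ n - 2 then step (b c) i else 0)]
    have h2 := step_min_add_step_max (e (n - 1)) (e n) i
    rw [← h.turn] at h2
    by_cases c : a.1 ≤ n - 2
    · rw [selection_of_le c]
      have h3 : (if a.1 = 1 then step 1 i else 0) + (if a.1 = 1 then 0 else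
          if a.1 = n then step (e (n - 2)) i + (if n - 2 ≤ n - 2 then step (b (n - 2)) i else 0)
          else step (e (a.1 - 1)) i + if a.1 - 1 ≤ n - 2 then step (b (a.1 - 1)) i else 0) =
            step (e (a.1 - 1)) i + step (b (a.1 - 1)) i := by
        by_cases c1 : a.1 = 1
        · rw [if_pos c1, if_pos c1, c1, h.zero, h.top, step_top]
        · rw [if_neg c1, if_neg c1, if_neg (by omega), if_pos (by omega)]
          ring
      by_cases c1 : a.1 = n - 2
      · simp only [c1, if_true, le_refl, show ¬ n - 1 ≤ n - 2 by omega,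
          show ¬ n ≤ n - 2 by omega, if_false, show n - 2 + 1 = n - 1 by omega] at h3 ⊢
        linarith
      · simp only [c, c1, if_true, if_false, show a.1 + 1 ≤ n - 2 by omega]
        linarith
    · rw [selection_of_lt (not_le.1 c)]
      have h3 : (if a.1 = n then step (e (n - 2)) i + (if n - 2 ≤ n - 2 then step (b (n - 2)) i else 0)
          else step (e (a.1 - 1)) i + if a.1 - 1 ≤ n - 2 then step (b (a.1 - 1)) i else 0) =
            step (e (n - 2)) i + step (b (n - 2)) i := by
        split_ifs with c1 c2 c2
        · rfl
        · omega
        · rw [show a.1 - 1 = n - 2 by omega]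
        · omega
      simp only [c, show ¬ a.1 = 1 by omega, show ¬ a.1 = n - 2 by omega, if_false, h3, step_top]
      ring

end TypeD

end PathRC

namespace PathRC

open Selection

namespace TypeD

variable {n : ℕ}

/-! ## Letters in type `D` -/

/-- On the way up to the letter `x` one passes the node `a`. -/
def Letter.Fwd : Letter n → ℕ → Prop
  | pos k, a => a < k.1
  | bar k, a => ¬ (k.1 = n ∧ a = n - 1)

/-- On the way down to the letter `x` one passes the node `a`. -/
def Letter.Bwd : Letter n → ℕ → Prop
  | pos _, _ => False
  | bar k, a => k.1 ≤ a

/-- The letter `x` is the one that is removed if the selected lengths are `e` and `b`. -/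
structure IsLetter (e b : ℕ → ℕ∞) (x : Letter n) : Prop where
  fwd : ∀ a, a ≤ n → (e a ≠ ⊤ ↔ x.Fwd a)
  bwd : ∀ a, a ≤ n - 2 → (b a ≠ ⊤ ↔ x.Bwd a)

/-- The order of letters is inclusion of the sets of passed nodes. For instance `n` passes `n - 1`
but not `n`, while `n̄` passes `n` but not `n - 1`, which makes them incomparable. Comparing letters
thus becomes comparing finiteness of selected lengths. -/
theorem le_iff_fwd_bwd (hn : 4 ≤ n) (x y : Letter n) :
    x.Le y ↔ (∀ a, a ≤ n → x.Fwd a → y.Fwd a) ∧ ∀ a, a ≤ n - 2 → x.Bwd a → y.Bwd a := by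
  rcases x with x | x <;> rcases y with y | y <;>
    have hx := Finset.mem_Icc.1 x.2 <;> have hy := Finset.mem_Icc.1 y.2 <;>
    simp only [Letter.Le, Letter.rank, Letter.Fwd, Letter.Bwd, Letter.pos.injEq, Letter.bar.injEq,
      Subtype.ext_iff, reduceCtorEq, false_or]
  · constructor
    · exact fun h => ⟨fun a _ ha => by omega, fun a _ ha => ha⟩
    · intro h
      have := h.1 y.1 (by omega)
      omega
  · constructor
    · exact fun h => ⟨fun a _ ha => by omega, fun a _ ha => ha.elim⟩
    · intro h
      have := h.1 (n - 1) (by omega)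
      omega
  · constructor
    · intro h
      omega
    · intro h
      have := h.1 n le_rfl
      omega
  · constructor
    · exact fun h => ⟨fun a _ ha => by omega, fun a _ ha => by omega⟩
    · intro h
      have h1 := h.1 (n - 1) (by omega)
      have h2 := h.2 x.1
      omega

theorem le_antisymm_of_le {x y : Letter n} (h : x.Le y) (h' : y.Le x) : x = y := by
  rcases h with h | h
  · exact h
  · rcases h' with h' | h'
    · exact h'.symm
    · omega

theorem IsLetter.unique (hn : 4 ≤ n) {e b : ℕ → ℕ∞} {x y : Letter n} (hx : IsLetter e b x)
    (hy : IsLetter e b y) : x = y :=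
  le_antisymm_of_le
    ((le_iff_fwd_bwd hn x y).2 ⟨fun a h h1 => (hy.fwd a h).1 ((hx.fwd a h).2 h1),
      fun a h h1 => (hy.bwd a h).1 ((hx.bwd a h).2 h1)⟩)
    ((le_iff_fwd_bwd hn y x).2 ⟨fun a h h1 => (hx.fwd a h).1 ((hy.fwd a h).2 h1),
      fun a h h1 => (hx.bwd a h).1 ((hy.bwd a h).2 h1)⟩)

/-- If the way down never starts, the letter is the first node with infinite length on the way up,
or `n̄` if only the tip `n - 1` is blocked. Otherwise it is the bar of the smallest node reached on
the way down. -/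
theorem IsChain.exists_isLetter {e b : ℕ → ℕ∞} (h : IsChain n e b) (hn : 4 ≤ n) :
    ∃ x : Letter n, IsLetter e b x := by
  classical
  by_cases hb : b (n - 1) = ⊤
  · have hb' : ∀ a, a ≤ n - 2 → (b a ≠ ⊤ ↔ False) := fun a ha => by
      have := h.down_le (a := a) (c := n - 1) (by omega) le_rfl
      rw [hb, top_le_iff] at this
      simp [this]
    have hex : ∃ a, 1 ≤ a ∧ e a = ⊤ := by
      rw [h.turn, max_eq_top] at hb
      rcases hb with hb | hb
      · exact ⟨_, by omega, hb⟩
      · exact ⟨_, by omega, hb⟩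
    have hk := Nat.find_spec hex
    have hk' := fun a => Nat.find_min (H := hex) (m := a)
    set k := Nat.find hex with hkdef
    have hkn : k ≤ n := by
      rw [h.turn, max_eq_top] at hb
      rcases hb with hb | hb
      · exact (Nat.find_min' hex ⟨by omega, hb⟩).trans (by omega)
      · exact Nat.find_min' hex ⟨by omega, hb⟩
    have hlt : ∀ a, a < k → e a ≠ ⊤ := by
      intro a ha hea
      obtain rfl | ha0 := Nat.eq_zero_or_pos a
      · rw [h.zero] at hea
        exact ENat.one_ne_top hea
      · exact hk' a ha ⟨ha0, hea⟩
    by_cases hc : k = n - 1 ∧ e n ≠ ⊤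
    · refine ⟨.bar ⟨n, Finset.mem_Icc.2 (by omega)⟩, fun a ha => ?_, fun a ha => ?_⟩
      · simp only [Letter.Fwd, true_and]
        by_cases h1 : a = n - 1
        · simp only [h1, not_true_eq_false, iff_false, not_not]
          rw [← hc.1]
          exact hk.2
        · simp only [h1, not_false_eq_true, iff_true]
          by_cases h2 : a = n
          · rw [h2]
            exact hc.2
          · exact hlt a (by omega)
      · rw [hb' a ha]
        simp only [Letter.Bwd, false_iff]
        omega
    · refine ⟨.pos ⟨k, Finset.mem_Icc.2 ⟨hk.1, hkn⟩⟩, fun a ha => ?_, fun a ha => ?_⟩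
      · simp only [Letter.Fwd]
        constructor
        · intro hea
          by_contra hka
          by_cases h1 : a ≤ n - 1
          · have := h.up_le (not_lt.1 hka) h1
            rw [hk.2, top_le_iff] at this
            exact hea this
          · obtain rfl : a = n := by omega
            by_cases h2 : k ≤ a - 2
            · have := (h.up_le h2 (by omega)).trans h.fork
              rw [hk.2, top_le_iff] at this
              exact hea this
            · by_cases h3 : k = a
              · rw [h3] at hk
                exact hea hk.2
              · exact hc ⟨by omega, hea⟩
        · exact hlt a
      · rw [hb' a ha]
        rfl
  · have hex : ∃ a, b a ≠ ⊤ := ⟨_, hb⟩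
    have hk := Nat.find_spec hex
    have hkn : Nat.find hex ≤ n - 1 := Nat.find_min' hex hb
    have hk0 : Nat.find hex ≠ 0 := by
      intro h0
      rw [h0] at hk
      exact hk h.top
    rw [h.turn, max_eq_top, not_or] at hb
    refine ⟨.bar ⟨Nat.find hex, Finset.mem_Icc.2 (by omega)⟩, fun a ha => ?_, fun a ha => ?_⟩
    · simp only [Letter.Fwd]
      refine iff_of_true ?_ (by omega)
      by_cases h1 : a = n
      · rw [h1]
        exact hb.2
      · exact ne_top_of_le_ne_top hb.1 (h.up_le (by omega) le_rfl)
    · simp only [Letter.Bwd]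
      constructor
      · exact fun h1 => Nat.find_min' hex h1
      · exact fun h1 => ne_top_of_le_ne_top hk (h.down_le h1 (by omega))

theorem eps_pos (hn : 4 ≤ n) (k a : Node n) : (k.1 = a.1 + 1 ∧ (letters n hn).eps a (.pos k) = 1) ∨
    (k.1 ≠ a.1 + 1 ∧ (letters n hn).eps a (.pos k) = 0) := by
  by_cases h : k.1 = a.1 + 1 <;> simp [letters, Letter.e, h]

theorem phi_bar (hn : 4 ≤ n) (k a : Node n) : (k.1 = a.1 + 1 ∧ (letters n hn).phi a (.bar k) = 1) ∨
    (k.1 ≠ a.1 + 1 ∧ (letters n hn).phi a (.bar k) = 0) := by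
  by_cases h : k.1 = a.1 + 1 <;> simp [letters, Letter.f, h]

theorem eps_bar (hn : 4 ≤ n) (k a : Node n) :
    (((k.1 = a.1 ∧ a.1 < n) ∨ (a.1 = n ∧ (k.1 = n ∨ k.1 + 1 = n))) ∧
      (letters n hn).eps a (.bar k) = 1) ∨
    (¬ ((k.1 = a.1 ∧ a.1 < n) ∨ (a.1 = n ∧ (k.1 = n ∨ k.1 + 1 = n))) ∧
      (letters n hn).eps a (.bar k) = 0) := by
  by_cases h1 : k.1 = a.1 ∧ a.1 < n
  · have h : Letter.e hn a (.bar k) = some _ := dif_pos h1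
    exact Or.inl ⟨Or.inl h1, if_pos (by rw [h]; rfl)⟩
  by_cases h2 : a.1 = n ∧ k.1 = n
  · have h : Letter.e hn a (.bar k) = some _ := (dif_neg h1).trans (if_pos h2)
    exact Or.inl ⟨Or.inr ⟨h2.1, Or.inl h2.2⟩, if_pos (by rw [h]; rfl)⟩
  by_cases h3 : a.1 = n ∧ k.1 + 1 = n
  · have h : Letter.e hn a (.bar k) = some _ :=
      (dif_neg h1).trans ((if_neg h2).trans (if_pos h3))
    exact Or.inl ⟨Or.inr ⟨h3.1, Or.inr h3.2⟩, if_pos (by rw [h]; rfl)⟩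
  · have h : Letter.e hn a (.bar k) = none :=
      (dif_neg h1).trans ((if_neg h2).trans (if_neg h3))
    exact Or.inr ⟨by omega, if_neg (by rw [h]; exact Bool.false_ne_true)⟩

theorem phi_pos (hn : 4 ≤ n) (k a : Node n) :
    (((k.1 = a.1 ∧ a.1 < n) ∨ (a.1 = n ∧ (k.1 = n ∨ k.1 + 1 = n))) ∧
      (letters n hn).phi a (.pos k) = 1) ∨
    (¬ ((k.1 = a.1 ∧ a.1 < n) ∨ (a.1 = n ∧ (k.1 = n ∨ k.1 + 1 = n))) ∧
      (letters n hn).phi a (.pos k) = 0) := by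
  by_cases h1 : k.1 = a.1 ∧ a.1 < n
  · have h : Letter.f hn a (.pos k) = some _ := dif_pos h1
    exact Or.inl ⟨Or.inl h1, if_pos (by rw [h]; rfl)⟩
  by_cases h2 : a.1 = n ∧ k.1 + 1 = n
  · have h : Letter.f hn a (.pos k) = some _ := (dif_neg h1).trans (if_pos h2)
    exact Or.inl ⟨Or.inr ⟨h2.1, Or.inr h2.2⟩, if_pos (by rw [h]; rfl)⟩
  by_cases h3 : a.1 = n ∧ k.1 = n
  · have h : Letter.f hn a (.pos k) = some _ :=
      (dif_neg h1).trans ((if_neg h2).trans (if_pos h3))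
    exact Or.inl ⟨Or.inr ⟨h3.1, Or.inl h3.2⟩, if_pos (by rw [h]; rfl)⟩
  · have h : Letter.f hn a (.pos k) = none :=
      (dif_neg h1).trans ((if_neg h2).trans (if_neg h3))
    exact Or.inr ⟨by omega, if_neg (by rw [h]; exact Bool.false_ne_true)⟩

theorem fin_min (s t : ℕ∞) : fin (min s t) = max (fin s) (fin t) := by
  rcases le_total s t with h | h
  · rw [min_eq_left h]
    unfold fin
    split_ifs with h1 h2 <;> simp_all
  · rw [min_eq_right h]
    unfold fin
    split_ifs with h1 h2 <;> simp_all

theorem fin_max (s t : ℕ∞) : fin (max s t) = min (fin s) (fin t) := by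
  rcases le_total s t with h | h
  · rw [max_eq_right h]
    unfold fin
    split_ifs with h1 h2 <;> simp_all
  · rw [max_eq_left h]
    unfold fin
    split_ifs with h1 h2 <;> simp_all

theorem fin_cases (t : ℕ∞) {p : Prop} (h : t ≠ ⊤ ↔ p) : (p ∧ fin t = 1) ∨ (¬ p ∧ fin t = 0) := by
  by_cases ht : t = ⊤
  · exact Or.inr ⟨fun hp => h.2 hp ht, if_pos ht⟩
  · exact Or.inl ⟨h.1 ht, if_neg ht⟩

theorem IsLetter.gainInf (hn : 4 ≤ n) {e b : ℕ → ℕ∞} {x : Letter n} (he : IsChain n e b)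
    (hx : IsLetter e b x) (a : Node n) :
    (selection e b a).gainInf = -(letters n hn).wt x a := by
  have ha := Finset.mem_Icc.1 a.2
  have h1 := fun c hc => fin_cases (e c) (hx.fwd c hc)
  have h2 := fun c hc => fin_cases (b c) (hx.bwd c hc)
  have h3 : fin (b (n - 1)) = min (fin (e (n - 1))) (fin (e n)) := by rw [he.turn, fin_max]
  rw [Crystal.wt]
  by_cases c : a.1 ≤ n - 2
  · rw [selection_of_le c]
    simp only [Selection.gainInf]
    have g1 := h1 (a - 1) (by omega)
    have g2 := h1 a (by omega)
    have g3 := h2 a c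
    have g4 := h2 (a - 1) (by omega)
    by_cases c1 : a.1 = n - 2
    · rw [if_pos c1, fin_min, show a.1 + 1 = n - 1 by omega, h3]
      have g5 := h1 (n - 1) (by omega)
      have g6 := h1 n le_rfl
      rcases x with k | k
      · have hk := Finset.mem_Icc.1 k.2
        have g7 := eps_pos hn k a
        have g8 := phi_pos hn k a
        simp only [Letter.Fwd, Letter.Bwd, false_and, not_false_eq_true, true_and, false_or]
          at g1 g2 g3 g4 g5 g6
        omega
      · have hk := Finset.mem_Icc.1 k.2
        have g7 := eps_bar hn k a
        have g8 := phi_bar hn k a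
        simp only [Letter.Fwd, Letter.Bwd, and_true] at g1 g2 g3 g4 g5 g6
        omega
    · rw [if_neg c1]
      have g5 := h1 (a + 1) (by omega)
      have g6 := h2 (a + 1) (by omega)
      rcases x with k | k
      · have hk := Finset.mem_Icc.1 k.2
        have g7 := eps_pos hn k a
        have g8 := phi_pos hn k a
        simp only [Letter.Fwd, Letter.Bwd, false_and, not_false_eq_true, true_and, false_or]
          at g1 g2 g3 g4 g5 g6
        omega
      · have hk := Finset.mem_Icc.1 k.2
        have g7 := eps_bar hn k a
        have g8 := phi_bar hn k a
        simp only [Letter.Fwd, Letter.Bwd] at g1 g2 g3 g4 g5 g6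
        omega
  · rw [selection_of_lt (not_le.1 c)]
    simp only [Selection.gainInf]
    have g0 : fin ⊤ = 0 := if_pos rfl
    have g1 := h1 (n - 2) (by omega)
    have g2 := h1 a (by omega)
    have g3 := h2 (n - 2) le_rfl
    rcases x with k | k
    · have hk := Finset.mem_Icc.1 k.2
      have g7 := eps_pos hn k a
      have g8 := phi_pos hn k a
      simp only [Letter.Fwd, Letter.Bwd, false_and, not_false_eq_true, true_and, false_or]
        at g1 g2 g3
      omega
    · have hk := Finset.mem_Icc.1 k.2
      have g7 := eps_bar hn k a
      have g8 := phi_bar hn k a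
      simp only [Letter.Fwd, Letter.Bwd] at g1 g2 g3
      omega

/-- In orthogonal coordinates these weights are a unit vector and the negative of one; the
coordinates at the nodes `y`, `z`, `n - 1` and `n` are enough to tell them apart. -/
theorem wt_pos_ne_wt_bar (hn : 4 ≤ n) (y z : Node n) :
    ∃ a, (letters n hn).wt (.pos y) a ≠ (letters n hn).wt (.bar z) a := by
  have hmem : ∀ a, 1 ≤ a → a ≤ n → a ∈ Finset.Icc 1 n := fun a h1 h2 => Finset.mem_Icc.2 ⟨h1, h2⟩
  by_contra hne
  push Not at hne
  have hy := Finset.mem_Icc.1 y.2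
  have hz := Finset.mem_Icc.1 z.2
  have key := fun a => And.intro (hne a) (And.intro (And.intro (eps_pos hn y a) (phi_pos hn y a))
    (And.intro (eps_bar hn z a) (phi_bar hn z a)))
  simp only [Crystal.wt] at key
  have h1 := key z
  have h2 := key y
  have h3 := key ⟨n, hmem n (by omega) le_rfl⟩
  have h4 := key ⟨n - 1, hmem (n - 1) (by omega) (by omega)⟩
  clear key hne
  dsimp only at h3 h4
  by_cases c1 : z.1 < n
  · clear h3 h4
    omega
  · clear h2
    omega

theorem letter_eq_of_wt (hn : 4 ≤ n) (y z : Letter n)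
    (h : ∀ a, (letters n hn).wt y a = (letters n hn).wt z a) : y = z := by
  rcases y with y | y <;> rcases z with z | z
  · have hy := Finset.mem_Icc.1 y.2
    have hz := Finset.mem_Icc.1 z.2
    have h1 := h y
    have h2 := h z
    simp only [Crystal.wt] at h1 h2
    have := eps_pos hn y y
    have := eps_pos hn y z
    have := eps_pos hn z y
    have := eps_pos hn z z
    have := phi_pos hn y y
    have := phi_pos hn y z
    have := phi_pos hn z y
    have := phi_pos hn z z
    exact congrArg Letter.pos (Subtype.ext (by omega))
  · obtain ⟨a, ha⟩ := wt_pos_ne_wt_bar hn y z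
    exact absurd (h a) ha
  · obtain ⟨a, ha⟩ := wt_pos_ne_wt_bar hn z y
    exact absurd (h a).symm ha
  · have hy := Finset.mem_Icc.1 y.2
    have hz := Finset.mem_Icc.1 z.2
    have h1 := h y
    have h2 := h z
    simp only [Crystal.wt] at h1 h2
    have := eps_bar hn y y
    have := eps_bar hn y z
    have := eps_bar hn z y
    have := eps_bar hn z z
    have := phi_bar hn y y
    have := phi_bar hn y z
    have := phi_bar hn z y
    have := phi_bar hn z z
    exact congrArg Letter.bar (Subtype.ext (by omega))

end TypeD

end PathRC

namespace PathRC

open Selection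

theorem eq_lastBelow {t u : ℕ∞} {q : ℕ → Prop} (h1 : 1 ≤ t) (ht : t ≠ ⊤) (htu : t ≤ u)
    (h2 : ∀ i : ℕ, 1 ≤ i → t = ((i + 1 : ℕ) : ℕ∞) → q i)
    (h3 : ∀ i : ℕ, t ≤ i → i < u → ¬ q i) : t = (lastBelow u q : ℕ) := by
  obtain ⟨s, rfl⟩ := ENat.ne_top_iff_exists.1 ht
  have hs : s ∈ {s | 1 ≤ s ∧ ∀ i : ℕ, s ≤ i → (i : ℕ∞) < u → ¬ q i} :=
    ⟨by exact_mod_cast h1, fun i hi hi' => h3 i (by exact_mod_cast hi) hi'⟩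
  rw [Nat.cast_inj]
  refine le_antisymm ?_ (Nat.sInf_le hs)
  have hm : 1 ≤ lastBelow u q ∧ ∀ i : ℕ, lastBelow u q ≤ i → (i : ℕ∞) < u → ¬ q i :=
    Nat.sInf_mem ⟨s, hs⟩
  by_contra hlt
  refine hm.2 (s - 1) (by omega) (lt_of_lt_of_le ?_ htu) (h2 _ (by omega) ?_)
  · exact_mod_cast (by omega : s - 1 < s)
  · rw [Nat.sub_add_cancel (by omega)]

/-- The value `lastBelow t q` if `p` holds, and `∞` otherwise. -/
noncomputable def lastBelowIf (p : Prop) (t : ℕ∞) (q : ℕ → Prop) : ℕ∞ :=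
  open Classical in if p then (lastBelow t q : ℕ) else ⊤

section LastBelowIf

variable {p : Prop} {t : ℕ∞} {q : ℕ → Prop}

theorem lastBelowIf_ne_top : lastBelowIf p t q ≠ ⊤ ↔ p := by
  unfold lastBelowIf
  split_ifs with h <;> simp [h]

theorem lastBelowIf_eq (h : p) : lastBelowIf p t q = (lastBelow t q : ℕ) := if_pos h

theorem one_le_lastBelowIf (hq : ∃ N, ∀ i, N ≤ i → ¬ q i) : 1 ≤ lastBelowIf p t q := by
  unfold lastBelowIf
  split_ifs with h
  · exact_mod_cast (lastBelow_mem hq).1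
  · exact le_top

theorem lastBelowIf_le (ht : 1 ≤ t) (hp : ¬ p → t = ⊤) : lastBelowIf p t q ≤ t := by
  unfold lastBelowIf
  split_ifs with h
  · exact lastBelow_le ht
  · rw [hp h]

theorem lastBelowIf_spec (hq : ∃ N, ∀ i, N ≤ i → ¬ q i) {i : ℕ} (hi : 1 ≤ i)
    (h : lastBelowIf p t q = ((i + 1 : ℕ) : ℕ∞)) : q i := by
  have hp : p := lastBelowIf_ne_top.1 (by rw [h]; exact ENat.natCast_ne_top _)
  rw [lastBelowIf_eq hp, Nat.cast_inj] at h
  exact lastBelow_spec hq hi h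

theorem not_of_lastBelowIf_le (hq : ∃ N, ∀ i, N ≤ i → ¬ q i) {i : ℕ}
    (h1 : lastBelowIf p t q ≤ i) (h2 : i < t) : ¬ q i := by
  have hp : p := lastBelowIf_ne_top.1 (ne_top_of_le_ne_top (ENat.natCast_ne_top i) h1)
  rw [lastBelowIf_eq hp, Nat.cast_le] at h1
  exact (lastBelow_mem hq).2 i h1 h2

theorem eq_lastBelowIf {s : ℕ∞} (h1 : 1 ≤ s) (hp : s ≠ ⊤ ↔ p) (hst : s ≤ t)
    (h2 : ∀ i : ℕ, 1 ≤ i → s = ((i + 1 : ℕ) : ℕ∞) → q i)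
    (h3 : ∀ i : ℕ, s ≤ i → i < t → ¬ q i) : s = lastBelowIf p t q := by
  by_cases h : p
  · rw [lastBelowIf_eq h]
    exact eq_lastBelow h1 (hp.2 h) hst h2 h3
  · have h4 := mt hp.1 h
    have h5 := mt (lastBelowIf_ne_top (p := p) (t := t) (q := q)).1 h
    rw [not_not.1 h4, not_not.1 h5]

end LastBelowIf

namespace TypeD

variable {n : ℕ} {nu : Rigged (Node n)} {p : Node n → ℕ → ℤ} {e b : ℕ → ℕ∞} {x : Letter n}

/-! ## Backward selections -/

/-- There are at least `k` strings of length `i` and rigging `p a i` at the node `a`. -/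
def HasStrings (nu : Rigged (Node n)) (p : Node n → ℕ → ℤ) (a k i : ℕ) : Prop :=
  ∃ h : a ∈ Finset.Icc 1 n, k ≤ (nu ⟨a, h⟩).count (i, p ⟨a, h⟩ i)

theorem hasStrings_iff (a : Node n) (k i : ℕ) :
    HasStrings nu p a k i ↔ k ≤ (nu a).count (i, p a i) :=
  ⟨fun ⟨_, h⟩ => h, fun h => ⟨a.2, h⟩⟩

theorem HasStrings.eventually (nu : Rigged (Node n)) (p : Node n → ℕ → ℤ) (a : ℕ) (k : ℕ → ℕ)
    (hk : ∀ i, 1 ≤ k i) : ∃ N, ∀ i, N ≤ i → ¬ HasStrings nu p a (k i) i := by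
  by_cases h : a ∈ Finset.Icc 1 n
  · obtain ⟨N, hN⟩ := eventually_count_eq_zero (nu ⟨a, h⟩) (p ⟨a, h⟩)
    refine ⟨N, fun i hi ⟨_, h'⟩ => ?_⟩
    rw [hN i hi] at h'
    have := hk i
    omega
  · exact ⟨0, fun i _ ⟨h', _⟩ => h h'⟩

/-- The conditions for the last singular strings on the way down, on the way up at the two ends, and
on the way up to the fork. -/
structure IsBackward (nu : Rigged (Node n)) (p : Node n → ℕ → ℤ) (e b : ℕ → ℕ∞)
    (x : Letter n) : Prop where
  down : ∀ a, 1 ≤ a → a ≤ n - 2 →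
    b a = lastBelowIf (x.Bwd a) (b (a - 1)) (HasStrings nu p a 1)
  tip : ∀ a, n - 2 < a → a ≤ n → e a = lastBelowIf (x.Fwd a) (b (n - 2)) (HasStrings nu p a 1)
  up : ∀ a, 1 ≤ a → a ≤ n - 2 → e a = lastBelowIf (x.Fwd a)
    (if a = n - 2 then min (e (n - 1)) (e n) else e (a + 1))
      fun i => HasStrings nu p a (1 + hit (b a) (i + 1)) i

/-- Rewrites the conditions at all nodes as an explicit recursion against the direction of `δ̄`: the
lengths `b` from node `1` to `n - 2`, then `e` at the two tips, then `e` from `n - 2` to `1`. The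
summand `hit (b a) (i + 1)` reserves the singular string that the way down already lengthens.
Existence and uniqueness of the choice follow from the recursive form. -/
theorem isBackward_iff (hn : 4 ≤ n) (he : IsChain n e b) (hx : IsLetter e b x) :
    IsBackward nu p e b x ↔ ∀ a, (selection e b a).Addable (nu a) (p a) := by
  constructor
  · intro h a
    have ha := Finset.mem_Icc.1 a.2
    by_cases c : a.1 ≤ n - 2
    · have hd := h.down a ha.1 c
      have hu := h.up a ha.1 c
      have ev1 := HasStrings.eventually nu p a (fun _ => 1) fun _ => le_rfl
      have ev2 := HasStrings.eventually nu p a (fun i => 1 + hit (b a) (i + 1)) fun _ => by omega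
      rw [selection_of_le c]
      refine ⟨map_decrement_lengths_le_iff.2 fun i hi => ?_, fun i h1 h2 => ?_, fun i h1 h2 => ?_⟩
      · dsimp only
        by_cases h1 : e a = ((i + 1 : ℕ) : ℕ∞)
        · rw [hu] at h1
          have := (hasStrings_iff _ _ _).1 (lastBelowIf_spec ev2 hi h1)
          have := hit_le_one (e a) (i + 1)
          omega
        · rw [hit_of_ne h1]
          by_cases h2 : b a = ((i + 1 : ℕ) : ℕ∞)
          · rw [hd] at h2
            have := (hasStrings_iff _ _ _).1 (lastBelowIf_spec ev1 hi h2)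
            have := hit_le_one (b a) (i + 1)
            omega
          · rw [hit_of_ne h2]
            exact Nat.zero_le _
      · dsimp only at h1 h2 ⊢
        rw [hu] at h1
        have := not_of_lastBelowIf_le ev2 h1 h2
        rw [hasStrings_iff] at this
        omega
      · dsimp only at h1 h2
        rw [hd] at h1
        have := not_of_lastBelowIf_le ev1 h1 h2
        rw [hasStrings_iff] at this
        omega
    · have ht := h.tip a (not_le.1 c) ha.2
      have ev1 := HasStrings.eventually nu p a (fun _ => 1) fun _ => le_rfl
      rw [selection_of_lt (not_le.1 c)]
      refine ⟨map_decrement_lengths_le_iff.2 fun i hi => ?_, fun i h1 h2 => ?_,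
        fun i h1 => absurd h1 (by simp)⟩
      · simp only [hit_top, add_zero]
        by_cases h2 : e a = ((i + 1 : ℕ) : ℕ∞)
        · rw [ht] at h2
          have := (hasStrings_iff _ _ _).1 (lastBelowIf_spec ev1 hi h2)
          have := hit_le_one (e a) (i + 1)
          omega
        · rw [hit_of_ne h2]
          exact Nat.zero_le _
      · dsimp only at h1 h2
        rw [ht] at h1
        have := not_of_lastBelowIf_le ev1 h1 h2
        rw [hasStrings_iff] at this
        omega
  · intro h
    refine ⟨fun a h1 h2 => ?_, fun a h1 h2 => ?_, fun a h1 h2 => ?_⟩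
    · have ho := he.ordered hn ⟨a, Finset.mem_Icc.2 ⟨h1, by omega⟩⟩
      have ha := h ⟨a, Finset.mem_Icc.2 ⟨h1, by omega⟩⟩
      rw [selection_of_le h2] at ho ha
      refine eq_lastBelowIf ho.one_le_l' (hx.bwd a h2) ho.lu (fun i hi hi' => ?_)
        fun i hi hi' => ?_
      · have := map_decrement_lengths_le_iff.1 ha.le i hi
        dsimp only at this
        rw [hit_of_eq hi'] at this
        exact ⟨Finset.mem_Icc.2 ⟨h1, by omega⟩, by omega⟩
      · rintro ⟨_, h5⟩
        have := ha.snd i hi hi'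
        omega
    · have ho := he.ordered hn ⟨a, Finset.mem_Icc.2 ⟨by omega, h2⟩⟩
      have ha := h ⟨a, Finset.mem_Icc.2 ⟨by omega, h2⟩⟩
      rw [selection_of_lt h1] at ho ha
      refine eq_lastBelowIf ho.one_le_l (hx.fwd a h2) ho.lv (fun i hi hi' => ?_)
        fun i hi hi' => ?_
      · have := map_decrement_lengths_le_iff.1 ha.le i hi
        dsimp only at this
        rw [hit_of_eq hi'] at this
        exact ⟨Finset.mem_Icc.2 ⟨by omega, h2⟩, by omega⟩
      · rintro ⟨_, h5⟩
        have := ha.fst i hi hi'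
        simp only [hit_top] at this
        omega
    · have ho := he.ordered hn ⟨a, Finset.mem_Icc.2 ⟨h1, by omega⟩⟩
      have ha := h ⟨a, Finset.mem_Icc.2 ⟨h1, by omega⟩⟩
      rw [selection_of_le h2] at ho ha
      refine eq_lastBelowIf ho.one_le_l (hx.fwd a (by omega)) ho.lv (fun i hi hi' => ?_)
        fun i hi hi' => ?_
      · have := map_decrement_lengths_le_iff.1 ha.le i hi
        dsimp only at this
        rw [hit_of_eq hi'] at this
        exact ⟨Finset.mem_Icc.2 ⟨h1, by omega⟩, by omega⟩
      · rintro ⟨_, h5⟩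
        have := ha.fst i hi hi'
        dsimp only at this
        omega

theorem IsBackward.unique {e' b' : ℕ → ℕ∞} (h : IsBackward nu p e b x)
    (h' : IsBackward nu p e' b' x) (he : IsChain n e b) (he' : IsChain n e' b') :
    (∀ a, a ≤ n → e a = e' a) ∧ ∀ a, a ≤ n - 1 → b a = b' a := by
  have hb : ∀ a, a ≤ n - 2 → b a = b' a := by
    intro a
    induction a with
    | zero => exact fun _ => he.top.trans he'.top.symm
    | succ a ih =>
      intro ha
      rw [h.down _ (by omega) ha, h'.down _ (by omega) ha, Nat.add_sub_cancel, ih (by omega)]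
  have ht : ∀ a, n - 2 < a → a ≤ n → e a = e' a := by
    intro a h1 h2
    rw [h.tip a h1 h2, h'.tip a h1 h2, hb _ le_rfl]
  have hu : ∀ d a, a + d = n - 2 → 1 ≤ a → e a = e' a := by
    intro d
    induction d with
    | zero =>
      intro a ha h1
      rw [h.up a h1 (by omega), h'.up a h1 (by omega), if_pos (by omega), if_pos (by omega),
        hb a (by omega), ht _ (by omega) (by omega), ht n (by omega) le_rfl]
    | succ d ih =>
      intro a ha h1
      rw [h.up a h1 (by omega), h'.up a h1 (by omega), if_neg (by omega), if_neg (by omega),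
        hb a (by omega), ih (a + 1) (by omega) (by omega)]
  have hall : ∀ a, a ≤ n → e a = e' a := by
    intro a ha
    obtain rfl | h0 := Nat.eq_zero_or_pos a
    · exact he.zero.trans he'.zero.symm
    · by_cases h1 : a ≤ n - 2
      · exact hu (n - 2 - a) a (by omega) h0
      · exact ht a (by omega) ha
  refine ⟨hall, fun a ha => ?_⟩
  by_cases h1 : a ≤ n - 2
  · exact hb a h1
  · rw [show a = n - 1 by omega, he.turn, he'.turn, hall _ (by omega), hall _ le_rfl]

/-- The recursion is run with infinite lengths at the nodes that `x` does not pass; what remains is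
to see that the result is a chain. -/
theorem exists_isBackward (hn : 4 ≤ n) (nu : Rigged (Node n)) (p : Node n → ℕ → ℤ)
    (x : Letter n) : ∃ e b, IsChain n e b ∧ IsLetter e b x ∧ IsBackward nu p e b x := by
  -- The nodes passed on the way to `x` are closed under going back along the route: up the tail,
  -- across the fork, and down again.
  have hxF : (∀ a, a < n - 2 → x.Fwd (a + 1) → x.Fwd a) ∧ (x.Fwd (n - 1) → x.Fwd (n - 2)) ∧
      (x.Fwd n → x.Fwd (n - 2)) ∧ x.Fwd 0 ∧ ¬ x.Bwd 0 ∧ (∀ a, x.Bwd a → x.Bwd (a + 1)) ∧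
      (x.Bwd (n - 2) → x.Fwd (n - 1) ∧ x.Fwd n) := by
    rcases x with k | k <;> have hk := Finset.mem_Icc.1 k.2 <;>
      simp only [Letter.Fwd, Letter.Bwd] <;> refine ⟨?_, ?_, ?_, ?_, ?_, ?_, ?_⟩ <;>
      first | omega | (intro a; omega) | simp
  obtain ⟨f1, f2, f3, f4, f5, f6, f7⟩ := hxF
  have ev1 : ∀ a, ∃ N, ∀ i, N ≤ i → ¬ HasStrings nu p a 1 i := fun a =>
    HasStrings.eventually nu p a (fun _ => 1) fun _ => le_rfl
  obtain ⟨b₀, hb0, hb1⟩ : ∃ b₀ : ℕ → ℕ∞, b₀ 0 = ⊤ ∧ ∀ a, b₀ (a + 1) =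
      lastBelowIf (x.Bwd (a + 1)) (b₀ a) (HasStrings nu p (a + 1) 1) :=
    ⟨fun k => Nat.rec ⊤ (fun a t =>
      lastBelowIf (x.Bwd (a + 1)) t (HasStrings nu p (a + 1) 1)) k, rfl, fun _ => rfl⟩
  obtain ⟨t, ht⟩ : ∃ t : ℕ → ℕ∞, ∀ a, t a = lastBelowIf (x.Fwd a) (b₀ (n - 2))
    (HasStrings nu p a 1) := ⟨_, fun _ => rfl⟩
  -- For `k ≥ 1`, `f k` is the length of the way up at node `n - 1 - k`; the initial value is the
  -- bound imposed by the two tips together.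
  obtain ⟨f, hf0, hf1⟩ : ∃ f : ℕ → ℕ∞, f 0 = min (t (n - 1)) (t n) ∧ ∀ k, f (k + 1) =
      lastBelowIf (x.Fwd (n - 2 - k)) (f k)
        fun i => HasStrings nu p (n - 2 - k) (1 + hit (b₀ (n - 2 - k)) (i + 1)) i :=
    ⟨fun k => Nat.rec (min (t (n - 1)) (t n)) (fun k s => lastBelowIf (x.Fwd (n - 2 - k)) s
        fun i => HasStrings nu p (n - 2 - k) (1 + hit (b₀ (n - 2 - k)) (i + 1)) i) k,
      rfl, fun _ => rfl⟩
  obtain ⟨e, he⟩ : ∃ e : ℕ → ℕ∞, ∀ a, e a = if a = 0 then 1 else if a ≤ n - 2 then f (n - 1 - a)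
    else t a := ⟨_, fun _ => rfl⟩
  obtain ⟨b, hb⟩ : ∃ b : ℕ → ℕ∞, ∀ a, b a = if a ≤ n - 2 then b₀ a else max (t (n - 1)) (t n) :=
    ⟨_, fun _ => rfl⟩
  have e0 : e 0 = 1 := (he 0).trans (if_pos rfl)
  have e1 : ∀ a, 1 ≤ a → a ≤ n - 2 → e a = f (n - 1 - a) := fun a h1 h2 => by
    rw [he, if_neg (by omega), if_pos h2]
  have e2 : ∀ a, n - 2 < a → e a = t a := fun a h => by rw [he, if_neg (by omega), if_neg (by omega)]
  have b1 : ∀ a, a ≤ n - 2 → b a = b₀ a := fun a h => by rw [hb, if_pos h]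
  have b2 : b (n - 1) = max (t (n - 1)) (t n) := by rw [hb, if_neg (by omega)]
  have hback : IsBackward nu p e b x := by
    refine ⟨fun a h1 h2 => ?_, fun a h1 h2 => ?_, fun a h1 h2 => ?_⟩
    · obtain ⟨a, rfl⟩ : ∃ c, a = c + 1 := ⟨a - 1, by omega⟩
      rw [b1 _ h2, Nat.add_sub_cancel, b1 a (by omega), hb1]
    · rw [e2 a h1, b1 _ le_rfl, ht]
    · obtain ⟨k, hk⟩ : ∃ k, n - 1 - a = k + 1 := ⟨n - 2 - a, by omega⟩
      have hk' : n - 2 - k = a := by omega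
      have hv : (if a = n - 2 then min (e (n - 1)) (e n) else e (a + 1)) = f k := by
        by_cases c : a = n - 2
        · obtain rfl : k = 0 := by omega
          rw [if_pos c, hf0, e2 _ (by omega), e2 _ (by omega)]
        · rw [if_neg c, e1 _ (by omega) (by omega)]
          congr 1
          omega
      rw [hv, e1 a h1 h2, hk, hf1, hk', b1 a h2]
  have hb1' : ∀ a, a ≤ n - 2 → 1 ≤ b a := by
    intro a ha
    obtain _ | a := a
    · rw [b1 _ ha, hb0]
      exact le_top
    · rw [hback.down _ (by omega) ha]
      exact one_le_lastBelowIf (ev1 _)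
  have hlet : IsLetter e b x := by
    refine ⟨fun a ha => ?_, fun a ha => ?_⟩
    · obtain _ | a := a
      · rw [e0]
        exact iff_of_true ENat.one_ne_top f4
      · by_cases h1 : a + 1 ≤ n - 2
        · rw [hback.up _ (by omega) h1]
          exact lastBelowIf_ne_top
        · rw [hback.tip _ (by omega) ha]
          exact lastBelowIf_ne_top
    · obtain _ | a := a
      · rw [b1 _ ha, hb0]
        exact iff_of_false (fun h => h rfl) f5
      · rw [hback.down _ (by omega) ha]
        exact lastBelowIf_ne_top
  have he1' : ∀ a, a ≤ n → 1 ≤ e a := by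
    intro a ha
    obtain _ | a := a
    · rw [e0]
    · by_cases h1 : a + 1 ≤ n - 2
      · rw [hback.up _ (by omega) h1]
        exact one_le_lastBelowIf (HasStrings.eventually nu p _ _ fun _ => by omega)
      · rw [hback.tip _ (by omega) ha]
        exact one_le_lastBelowIf (ev1 _)
  have htop : ∀ a, a ≤ n → ¬ x.Fwd a → e a = ⊤ := fun a ha h =>
    not_not.1 (mt (hlet.fwd a ha).1 h)
  have htip : ∀ a, n - 2 < a → a ≤ n → e a ≤ b (n - 2) := by
    intro a h1 h2
    rw [hback.tip a h1 h2]
    refine lastBelowIf_le (hb1' _ le_rfl) fun hF => not_not.1 (mt (hlet.bwd _ le_rfl).1 fun hB => ?_)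
    have := f7 hB
    by_cases c : a = n
    · exact hF (c ▸ this.2)
    · exact hF ((show a = n - 1 by omega) ▸ this.1)
  have hmid : ∀ a, 1 ≤ a → a ≤ n - 2 →
      e a ≤ if a = n - 2 then min (e (n - 1)) (e n) else e (a + 1) := by
    intro a h1 h2
    rw [hback.up a h1 h2]
    by_cases c : a = n - 2
    · rw [if_pos c]
      refine lastBelowIf_le (le_min (he1' _ (by omega)) (he1' _ le_rfl)) fun hF => ?_
      rw [c] at hF
      rw [htop _ (by omega) (mt f2 hF), htop _ le_rfl (mt f3 hF), min_self]
    · rw [if_neg c]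
      exact lastBelowIf_le (he1' _ (by omega)) fun hF => htop _ (by omega) (mt (f1 a (by omega)) hF)
  have hfork := hmid (n - 2) (by omega) le_rfl
  rw [if_pos rfl] at hfork
  have hturn : b (n - 1) = max (e (n - 1)) (e n) := by
    rw [b2, e2 _ (by omega), e2 _ (by omega)]
  refine ⟨e, b, ⟨e0, fun a ha => ?_, hfork.trans (min_le_right _ _), hturn, fun a ha => ?_, ?_⟩,
    hlet, hback⟩
  · obtain _ | a := a
    · rw [e0]
      exact he1' _ (by omega)
    · by_cases c : a + 1 = n - 2
      · rw [c, show n - 2 + 1 = n - 1 by omega]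
        exact hfork.trans (min_le_left _ _)
      · have := hmid (a + 1) (by omega) (by omega)
        rwa [if_neg c] at this
  · by_cases c : a = n - 2
    · rw [c, show n - 2 + 1 = n - 1 by omega, hturn]
      exact max_le (htip _ (by omega) (by omega)) (htip _ (by omega) le_rfl)
    · rw [hback.down (a + 1) (by omega) (by omega), Nat.add_sub_cancel]
      exact lastBelowIf_le (hb1' _ (by omega)) fun hB =>
        not_not.1 (mt (hlet.bwd a (by omega)).1 (mt (f6 a) hB))
  · rw [b1 _ (by omega), hb0]

end TypeD

end PathRC

namespace PathRC

open Selection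

namespace TypeD

/-! ## The left hat map on rigged configurations in type `D` -/

variable {n : ℕ} {L : Node n → Multiset ℕ} {lam mu : Node n → ℕ} {nu : Rigged (Node n)}

/-- The selected lengths on the way down. -/
noncomputable def ellBar (A : Node n → Node n → ℤ) (L : Node n → Multiset ℕ)
    (nu : Rigged (Node n)) (a : ℕ) : ℕ∞ :=
  if a = 0 then ⊤ else ellBarAux A L nu (n - 1 - a)

theorem ellD_of_lt (A : Node n → Node n → ℤ) (L : Node n → Multiset ℕ) (nu : Rigged (Node n))
    {a : ℕ} (h : a < n) : ellD A L nu a = ell A L nu a := if_neg (by omega)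

theorem ellD_succ (A : Node n → Node n → ℤ) (L : Node n → Multiset ℕ) (nu : Rigged (Node n))
    {a : ℕ} (h : a + 1 < n) : ellD A L nu (a + 1) =
      leastFrom (ellD A L nu a) fun i => 1 ≤ singCount A L nu (a + 1) i := by
  rw [ellD_of_lt A L nu h, ellD_of_lt A L nu (by omega), ell]

theorem ellD_last (hn : 4 ≤ n) (A : Node n → Node n → ℤ) (L : Node n → Multiset ℕ)
    (nu : Rigged (Node n)) {a : ℕ} (ha : a = n) : ellD A L nu a =
      leastFrom (ellD A L nu (n - 2)) fun i => 1 ≤ singCount A L nu a i := by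
  rw [ellD_of_lt A L nu (a := n - 2) (by omega), ellD, if_pos ha]
  simp only [ha]

theorem ellBar_of_le (A : Node n → Node n → ℤ) (L : Node n → Multiset ℕ) (nu : Rigged (Node n))
    {a : ℕ} (h1 : 1 ≤ a) (h2 : a ≤ n - 2) : ellBar A L nu a = leastFrom (ellBar A L nu (a + 1))
      fun i => 1 + hit (ellD A L nu a) i ≤ singCount A L nu a i := by
  obtain ⟨k, hk⟩ : ∃ k, n - 1 - a = k + 1 := ⟨n - 2 - a, by omega⟩
  have hk' : n - 1 - (a + 1) = k := by omega
  have hk'' : n - 1 - (k + 1) = a := by omega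
  rw [ellBar, ellBar, if_neg (by omega), if_neg (by omega), hk, hk', ellBarAux, hk'']
  congr 1
  funext i
  by_cases h : ellD A L nu a = i
  · rw [if_pos h.symm, hit_of_eq h]
  · rw [if_neg (Ne.symm h), hit_of_ne h]

theorem isChain_ellD (hn : 4 ≤ n) (A : Node n → Node n → ℤ) (L : Node n → Multiset ℕ)
    (nu : Rigged (Node n)) : IsChain n (ellD A L nu) (ellBar A L nu) where
  zero := ellD_of_lt A L nu (by omega)
  up a ha := by
    rw [ellD_succ A L nu (by omega)]
    exact le_leastFrom _ _
  fork := by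
    rw [ellD_last hn A L nu (a := n) rfl]
    exact le_leastFrom _ _
  turn := by
    rw [ellBar, if_neg (by omega), Nat.sub_self, ellBarAux]
  down a ha := by
    obtain rfl | h0 := Nat.eq_zero_or_pos a
    · exact le_top
    · rw [ellBar_of_le A L nu (a := a) h0 (by omega)]
      exact le_leastFrom _ _
  top := if_pos rfl

theorem removable_ellD (hn : 4 ≤ n) (A : Node n → Node n → ℤ) (L : Node n → Multiset ℕ)
    (nu : Rigged (Node n)) (a : Node n) :
    (selection (ellD A L nu) (ellBar A L nu) a).Removable (nu a) (vac A L nu a) := by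
  have ha := Finset.mem_Icc.1 a.2
  have key : ∀ {t : ℕ∞}, ellD A L nu a = leastFrom t (fun i => 1 ≤ singCount A L nu a i) →
      (∀ i : ℕ, hit (ellD A L nu a) i ≤ (nu a).count (i, vac A L nu a i)) ∧
      ∀ i : ℕ, t ≤ i → i < ellD A L nu a → (nu a).count (i, vac A L nu a i) = 0 := by
    intro t ht
    simp only [singCount_eq] at ht
    refine ⟨fun i => ?_, fun i h1 h2 => ?_⟩
    · by_cases h : ellD A L nu a = i
      · rw [hit_of_eq h]
        rw [ht] at h
        exact leastFrom_spec (p := fun i => 1 ≤ (nu a).count (i, vac A L nu a i)) h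
      · rw [hit_of_ne h]
        exact Nat.zero_le _
    · by_contra hne
      rw [ht] at h2
      exact absurd h2 (not_lt.2 (leastFrom_le h1 (Nat.one_le_iff_ne_zero.2 hne)))
  by_cases c : a.1 ≤ n - 2
  · have h1 : ellD A L nu a = leastFrom (ellD A L nu (a - 1))
        (fun i => 1 ≤ singCount A L nu a i) := by
      have := ellD_succ A L nu (a := a.1 - 1) (by omega)
      rwa [Nat.sub_add_cancel ha.1] at this
    obtain ⟨k1, k2⟩ := key h1
    have h2 := ellBar_of_le A L nu ha.1 c
    simp only [singCount_eq] at h2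
    rw [selection_of_le c]
    refine ⟨map_lengths_le_iff.2 fun i => ?_, k2, fun i h3 h4 => ?_⟩
    · dsimp only
      by_cases h : ellBar A L nu a = i
      · rw [hit_of_eq h]
        rw [h2] at h
        have := leastFrom_spec h
        omega
      · rw [hit_of_ne h]
        exact k1 i
    · dsimp only at h3 h4 ⊢
      by_contra hne
      rw [h2] at h4
      exact absurd h4 (not_lt.2 (leastFrom_le h3 (by omega)))
  · have h1 : ellD A L nu a = leastFrom (ellD A L nu (n - 2))
        (fun i => 1 ≤ singCount A L nu a i) := by
      by_cases h : a.1 = n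
      · exact ellD_last hn A L nu h
      · have := ellD_succ A L nu (a := n - 2) (by omega)
        have h3 : a.1 = n - 2 + 1 := by omega
        rwa [← h3] at this
    obtain ⟨k1, k2⟩ := key h1
    rw [selection_of_lt (not_le.1 c)]
    refine ⟨map_lengths_le_iff.2 fun i => ?_, k2, fun i h3 => absurd h3 (by simp)⟩
    simp only [hit_top, add_zero]
    exact k1 i

/-- The selected lengths are characterized by the choice of the first singular strings. -/
theorem eq_ellD (hn : 4 ≤ n) {A : Node n → Node n → ℤ} {e b : ℕ → ℕ∞} (he : IsChain n e b)
    (hR : ∀ a, (selection e b a).Removable (nu a) (vac A L nu a)) :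
    (∀ a, a ≤ n → e a = ellD A L nu a) ∧ ∀ a, a ≤ n - 1 → b a = ellBar A L nu a := by
  have key : ∀ (a : ℕ) (T : Selection) (h : a ∈ Finset.Icc 1 n), T.l = e a → T.u ≤ e a →
      T.Removable (nu ⟨a, h⟩) (vac A L nu ⟨a, h⟩) →
      e a = leastFrom T.u fun i => 1 ≤ singCount A L nu a i := by
    intro a T h hl hu hr
    refine eq_leastFrom hu (fun i hi => ?_) fun i h3 h4 => ?_
    · have := map_lengths_le_iff.1 hr.le i
      rw [singCount_eq A L nu ⟨a, h⟩]
      rw [hit_of_eq (hl.trans hi)] at this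
      omega
    · rw [singCount_eq A L nu ⟨a, h⟩, hr.fst i h3 (hl ▸ h4)]
      omega
  have hu : ∀ a, a ≤ n - 2 → e a = ellD A L nu a := by
    intro a
    induction a with
    | zero => exact fun _ => he.zero.trans (isChain_ellD hn A L nu).zero.symm
    | succ a ih =>
      intro ha
      rw [ellD_succ A L nu (by omega), ← ih (by omega)]
      have h := Finset.mem_Icc.2 (show 1 ≤ a + 1 ∧ a + 1 ≤ n by omega)
      have h2 := key (a + 1) _ h ?_ ?_ (hR ⟨a + 1, h⟩)
      · rwa [selection_of_le ha] at h2
      · rw [selection_of_le ha]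
      · rw [selection_of_le ha]
        exact he.up a (by omega)
  have ht : ∀ a, n - 2 < a → a ≤ n → e a = ellD A L nu a := by
    intro a h1 h2
    have h := Finset.mem_Icc.2 (show 1 ≤ a ∧ a ≤ n by omega)
    have h3 : e (n - 2) ≤ e a := by
      by_cases c : a = n
      · rw [c]
        exact he.fork
      · exact he.up_le (by omega) (by omega)
    have h4 := key a _ h ?_ ?_ (hR ⟨a, h⟩)
    · rw [selection_of_lt h1] at h4
      by_cases c : a = n
      · rwa [ellD_last hn A L nu c, ← hu _ le_rfl]
      · obtain rfl : a = n - 2 + 1 := by omega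
        rwa [ellD_succ A L nu (by omega), ← hu _ le_rfl]
    · rw [selection_of_lt h1]
    · rw [selection_of_lt h1]
      exact h3
  have hall : ∀ a, a ≤ n → e a = ellD A L nu a := fun a ha => by
    by_cases h1 : a ≤ n - 2
    · exact hu a h1
    · exact ht a (by omega) ha
  have hd : ∀ d a, a + d = n - 1 → 1 ≤ a → b a = ellBar A L nu a := by
    intro d
    induction d with
    | zero =>
      intro a h1 _
      obtain rfl : a = n - 1 := by omega
      rw [he.turn, (isChain_ellD hn A L nu).turn, hall _ (by omega), hall _ le_rfl]
    | succ d ih =>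
      intro a h1 h2
      have hr := hR ⟨a, Finset.mem_Icc.2 ⟨h2, by omega⟩⟩
      rw [selection_of_le (show a ≤ n - 2 by omega)] at hr
      rw [ellBar_of_le A L nu h2 (by omega), ← ih (a + 1) (by omega) (by omega),
        ← hall a (by omega)]
      refine eq_leastFrom (he.down a (by omega)) (fun i hi => ?_) fun i h3 h4 => ?_
      · have := map_lengths_le_iff.1 hr.le i
        rw [singCount_eq A L nu ⟨a, Finset.mem_Icc.2 ⟨h2, by omega⟩⟩]
        dsimp only at this
        rw [hit_of_eq hi] at this
        omega
      · have := hr.snd i h3 h4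
        rw [singCount_eq A L nu ⟨a, Finset.mem_Icc.2 ⟨h2, by omega⟩⟩]
        dsimp only at this
        omega
  refine ⟨hall, fun a ha => ?_⟩
  obtain rfl | h0 := Nat.eq_zero_or_pos a
  · exact he.top.trans (isChain_ellD hn A L nu).top.symm
  · exact hd (n - 1 - a) a (by omega) h0

/-- Chains are determined only at the nodes of the diagram and at `0`, so equality of selections
replaces equality of the functions. -/
theorem selection_congr (hn : 4 ≤ n) {e b e' b' : ℕ → ℕ∞} (h : ∀ a, a ≤ n → e a = e' a)
    (h' : ∀ a, a ≤ n - 1 → b a = b' a) :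
    (selection e b : Node n → Selection) = selection e' b' := by
  funext a
  have ha := Finset.mem_Icc.1 a.2
  by_cases c : a.1 ≤ n - 2
  · rw [selection_of_le c, selection_of_le c, h _ (by omega), h _ ha.2, h (a + 1) (by omega),
      h (n - 1) (by omega), h n le_rfl, h' _ (by omega), h' a (by omega), h' (a - 1) (by omega)]
  · rw [selection_of_lt (not_le.1 c), selection_of_lt (not_le.1 c), h _ (by omega), h _ ha.2,
      h' _ (by omega)]

theorem deltaD_eq_removal (A : Node n → Node n → ℤ) (L : Node n → Multiset ℕ)
    (nu : Rigged (Node n)) :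
    deltaD A L nu = removal A L (lhArray L) (selection (ellD A L nu) (ellBar A L nu)) nu := by
  have : ∀ a : Node n, ellBar A L nu a = ellBarAux A L nu (n - 1 - a) := fun a =>
    if_neg (by have := Finset.mem_Icc.1 a.2; omega)
  simp only [deltaD, removal, lengths_selection, this]

theorem exists_isRC_deltaD (hn : 4 ≤ n) (hL : ∀ a : Node n, a.1 = 1 → 1 ∈ L a)
    (h : IsRC (cartan n) L lam nu) {x : Letter n}
    (hx : IsLetter (ellD (cartan n) L nu) (ellBar (cartan n) L nu) x) :
    ∃ mu, IsRC (cartan n) (lhArray L) mu (deltaD (cartan n) L nu) ∧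
      (∀ a, (mu a : ℤ) + (letters n hn).wt x a = lam a) ∧
      ∀ a, (letters n hn).eps a x ≤ mu a := by
  have he := isChain_ellD hn (cartan n) L nu
  have hM := he.isMove hn
  have hR := removable_ellD hn (cartan n) L nu
  have hL' := lhArray_add_hatArray hL
  have h0 := hM.weight_nonneg (isCartan_cartan n) hL' h hR
  refine ⟨fun a => (lam a +
    (selection (ellD (cartan n) L nu) (ellBar (cartan n) L nu) a).gainInf : ℤ).toNat, ?_,
    fun a => ?_, fun a => ?_⟩
  · rw [deltaD_eq_removal]
    exact hM.isRC_removal (isCartan_cartan n) hL' h hR fun a => Int.toNat_of_nonneg (h0 a)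
  · rw [Int.toNat_of_nonneg (h0 a), hx.gainInf hn he]
    ring
  · have h1 := h0 a
    beta_reduce
    rw [hx.gainInf hn he, Crystal.wt] at h1 ⊢
    have ha := Finset.mem_Icc.1 a.2
    rcases x with k | k
    · have hk := Finset.mem_Icc.1 k.2
      have := eps_pos hn k a
      have := phi_pos hn k a
      omega
    · have hk := Finset.mem_Icc.1 k.2
      have := eps_bar hn k a
      have := phi_bar hn k a
      omega

/-- Unbounded intervals on which boxes are added, on the way up or down, occur only at nodes with
positive `ε`; there `ε ≤ μ` provides the positive weight needed by the inverse of `δ̄`. -/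
theorem one_le_eps (hn : 4 ≤ n) {e b : ℕ → ℕ∞} {x : Letter n} (hx : IsLetter e b x) (a : Node n)
    (h : ((selection e b a).l ≠ ⊤ ∧ (selection e b a).v = ⊤) ∨
      ((selection e b a).l' ≠ ⊤ ∧ (selection e b a).u' = ⊤)) :
    1 ≤ (letters n hn).eps a x := by
  have ha := Finset.mem_Icc.1 a.2
  by_cases c : a.1 ≤ n - 2
  · rw [selection_of_le c] at h
    dsimp only at h
    rw [hx.fwd a (by omega), hx.bwd a c, ← not_ne_iff (a := b (a.1 - 1)),
      hx.bwd (a - 1) (by omega)] at h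
    by_cases c1 : a.1 = n - 2
    · rw [if_pos c1, min_eq_top, ← not_ne_iff, ← not_ne_iff, hx.fwd _ (by omega),
        hx.fwd _ le_rfl] at h
      rcases x with k | k
      · have hk := Finset.mem_Icc.1 k.2
        have := eps_pos hn k a
        simp only [Letter.Fwd, Letter.Bwd, false_and, or_false] at h
        omega
      · have hk := Finset.mem_Icc.1 k.2
        have := eps_bar hn k a
        simp only [Letter.Fwd, Letter.Bwd, and_true] at h
        omega
    · rw [if_neg c1, ← not_ne_iff, hx.fwd _ (by omega)] at h
      rcases x with k | k
      · have hk := Finset.mem_Icc.1 k.2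
        have := eps_pos hn k a
        simp only [Letter.Fwd, Letter.Bwd, false_and, or_false] at h
        omega
      · have hk := Finset.mem_Icc.1 k.2
        have := eps_bar hn k a
        simp only [Letter.Fwd, Letter.Bwd] at h
        omega
  · rw [selection_of_lt (not_le.1 c)] at h
    simp only [ne_eq, not_true_eq_false, false_and, or_false] at h
    rw [← ne_eq, hx.fwd a ha.2, ← not_ne_iff, hx.bwd _ le_rfl] at h
    rcases x with k | k
    · have hk := Finset.mem_Icc.1 k.2
      have := eps_pos hn k a
      simp only [Letter.Fwd, Letter.Bwd, not_false_eq_true, and_true] at h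
      omega
    · have hk := Finset.mem_Icc.1 k.2
      have := eps_bar hn k a
      simp only [Letter.Fwd, Letter.Bwd] at h
      omega

theorem exists_deltaD_eq (hn : 4 ≤ n) (hL : ∀ a : Node n, a.1 = 1 → 1 ∈ L a)
    (h : IsRC (cartan n) (lhArray L) mu nu) {x : Letter n}
    (hlam : ∀ a, (mu a : ℤ) + (letters n hn).wt x a = lam a)
    (hmu : ∀ a, (letters n hn).eps a x ≤ mu a) :
    ∃ rho, IsRC (cartan n) L lam rho ∧ deltaD (cartan n) L rho = nu ∧
      IsLetter (ellD (cartan n) L rho) (ellBar (cartan n) L rho) x := by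
  obtain ⟨e, b, he, hx, hback⟩ := exists_isBackward hn nu (vac (cartan n) (lhArray L) nu) x
  have hadd := (isBackward_iff hn he hx).1 hback
  have hM := he.isMove hn
  have hL' := lhArray_add_hatArray hL
  obtain ⟨h1, h2⟩ := hM.isRC_addition (isCartan_cartan n) hL' h hadd (lam := lam)
    (fun a => by rw [hx.gainInf hn he, ← hlam]; ring)
    (fun a h1 h2 => (one_le_eps hn hx a (Or.inl ⟨h1, h2⟩)).trans (hmu a))
    fun a h1 h2 => (one_le_eps hn hx a (Or.inr ⟨h1, h2⟩)).trans (hmu a)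
  obtain ⟨h3, h4⟩ := eq_ellD hn he h2
  refine ⟨_, h1, ?_, fun a ha => ?_, fun a ha => ?_⟩
  · rw [deltaD_eq_removal, ← selection_congr hn h3 h4]
    exact hM.removal_addition hL' fun a => (hadd a).le
  · rw [← h3 a ha]
    exact hx.fwd a ha
  · rw [← h4 a (by omega)]
    exact hx.bwd a ha

theorem addable_deltaD (hn : 4 ≤ n) (hL : ∀ a : Node n, a.1 = 1 → 1 ∈ L a)
    (h : IsRC (cartan n) L lam nu) (a : Node n) :
    (selection (ellD (cartan n) L nu) (ellBar (cartan n) L nu) a).Addable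
      (deltaD (cartan n) L nu a) (vac (cartan n) (lhArray L) (deltaD (cartan n) L nu) a) := by
  rw [deltaD_eq_removal]
  exact ((isChain_ellD hn (cartan n) L nu).isMove hn).addable_removal (lhArray_add_hatArray hL) h
    (removable_ellD hn (cartan n) L nu) a

theorem deltaD_injective (hn : 4 ≤ n) (hL : ∀ a : Node n, a.1 = 1 → 1 ∈ L a)
    {nu' : Rigged (Node n)} {lam' : Node n → ℕ} (h : IsRC (cartan n) L lam nu)
    (h' : IsRC (cartan n) L lam' nu') {x : Letter n}
    (hx : IsLetter (ellD (cartan n) L nu) (ellBar (cartan n) L nu) x)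
    (hx' : IsLetter (ellD (cartan n) L nu') (ellBar (cartan n) L nu') x)
    (heq : deltaD (cartan n) L nu = deltaD (cartan n) L nu') : nu = nu' := by
  have he := isChain_ellD hn (cartan n) L nu
  have he' := isChain_ellD hn (cartan n) L nu'
  have h1 := (isBackward_iff hn he hx).2 (addable_deltaD hn hL h)
  have h2 := addable_deltaD hn hL h'
  rw [← heq] at h2
  obtain ⟨h3, h4⟩ := h1.unique ((isBackward_iff hn he' hx').2 h2) he he'
  have hL' := lhArray_add_hatArray hL
  rw [← (he.isMove hn).addition_removal hL'
    (fun a => (removable_ellD hn (cartan n) L nu a).le), ← deltaD_eq_removal, heq,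
    deltaD_eq_removal, selection_congr hn h3 h4]
  exact (he'.isMove hn).addition_removal hL' (fun a => (removable_ellD hn (cartan n) L nu' a).le)

end TypeD

end PathRC

namespace PathRC

open Selection

/-! ## Interlacing of successive selections -/

section Interlace

variable {S : Multiset (ℕ × ℤ)} {p p' : ℕ → ℤ} {T T' : Selection}

theorem add_one_le_of_coe {s t : ℕ∞} (h : ∀ i : ℕ, t = i → s + 1 ≤ i) : s + 1 ≤ t := by
  induction t using ENat.recTopCoe with
  | top => exact le_top
  | coe i => exact h i rfl

theorem add_one_le_of_forall_lt {s t : ℕ∞} (hfin : t ≠ ⊤ → s ≠ ⊤)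
    (h : ∀ i : ℕ, s = i → ¬ t ≤ i) : s + 1 ≤ t := by
  induction s using ENat.recTopCoe with
  | top =>
    by_contra hlt
    exact hfin (fun h => hlt (by rw [h]; exact le_top)) rfl
  | coe i => exact Order.add_one_le_of_lt (not_le.1 (h i rfl))

namespace Selection

/-- The first selected length of a removal is smaller than that of the preceding removal. -/
theorem Addable.fst_add_one_le (hA : T.Addable S p) (hR : T'.Removable S p') (h1 : 1 ≤ T'.u)
    (hu : T'.u + 1 ≤ T.l) (hp : ∀ i : ℕ, T.l = ((i + 1 : ℕ) : ℕ∞) → p i = p' i) :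
    T'.l + 1 ≤ T.l := by
  refine add_one_le_of_coe fun j hj => ?_
  rw [hj] at hu
  obtain ⟨i, rfl⟩ : ∃ i, j = i + 1 := by
    obtain _ | i := j
    · exact absurd (h1.trans (le_self_add.trans hu)) (by simp)
    · exact ⟨i, rfl⟩
  have hi := le_of_add_one_le_succ hu
  have h2 := map_decrement_lengths_le_iff.1 hA.le i (by exact_mod_cast h1.trans hi)
  rw [hit_of_eq hj, hp i hj] at h2
  -- The preceding removal left a singular string of length `i = T.l - 1`, which is within reach of
  -- the next one.
  by_contra hlt
  have h3 := hR.fst i hi (not_le.1 fun h => hlt (by push_cast; gcongr))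
  omega

/-- The second selected length of a removal is smaller than that of the preceding removal. -/
theorem Addable.snd_add_one_le (hA : T.Addable S p) (hR : T'.Removable S p') (h1 : 1 ≤ T'.v')
    (hT : T.l ≤ T.l') (hv : T'.v' + 1 ≤ T.l') (hl : T'.l + 1 ≤ T.l)
    (hp : ∀ i : ℕ, T.l' = ((i + 1 : ℕ) : ℕ∞) → p i = p' i) : T'.l' + 1 ≤ T.l' := by
  refine add_one_le_of_coe fun j hj => ?_
  rw [hj] at hv
  obtain ⟨i, rfl⟩ : ∃ i, j = i + 1 := by
    obtain _ | i := j
    · exact absurd (h1.trans (le_self_add.trans hv)) (by simp)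
    · exact ⟨i, rfl⟩
  have hi := le_of_add_one_le_succ hv
  have h2 := map_decrement_lengths_le_iff.1 hA.le i (by exact_mod_cast h1.trans hi)
  rw [hit_of_eq hj, hp i hj] at h2
  by_contra hlt
  have h3 := hR.snd i hi (not_le.1 fun h => hlt (by push_cast; gcongr))
  -- If the next removal has already used length `i`, a second singular string of that length is
  -- needed. Then `T.l` equals `i + 1` as well, so the preceding removal left two.
  by_cases h4 : T'.l = i
  · have h5 : T.l = ((i + 1 : ℕ) : ℕ∞) := le_antisymm (hj ▸ hT) (by rw [h4] at hl; exact_mod_cast hl)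
    rw [hit_of_eq h4] at h3
    rw [hit_of_eq h5] at h2
    omega
  · rw [hit_of_ne h4] at h3
    omega

/-- The converse direction for the second selected length. -/
theorem Addable.snd_add_one_le_of_fin (hA : T.Addable S p) (hR : T'.Removable S p')
    (hT : T'.l' ≤ T'.u') (hu : T'.u' + 1 ≤ T.u') (hfin : T.l' ≠ ⊤ → T'.l' ≠ ⊤)
    (hp : ∀ i : ℕ, T'.l' = i → p i = p' i) : T'.l' + 1 ≤ T.l' := by
  refine add_one_le_of_forall_lt hfin fun i hi hle => ?_
  have h1 := map_lengths_le_iff.1 hR.le i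
  rw [hit_of_eq hi, ← hp i hi] at h1
  have h2 : ((i + 1 : ℕ) : ℕ∞) ≤ T.u' := by
    push_cast
    rw [← hi]
    exact (add_le_add_left hT 1).trans hu
  have h3 := hA.snd i hle ((Nat.cast_lt.2 (Nat.lt_succ_self i)).trans_le h2)
  omega

/-- The converse direction for the first selected length. -/
theorem Addable.fst_add_one_le_of_fin (hA : T.Addable S p) (hR : T'.Removable S p')
    (hT : T'.l ≤ T'.v) (hT' : T'.l ≤ T'.l') (hv : T'.v + 1 ≤ T.v) (hl : T'.l' + 1 ≤ T.l')
    (hfin : T.l ≠ ⊤ → T'.l ≠ ⊤) (hp : ∀ i : ℕ, T'.l = i → p i = p' i) : T'.l + 1 ≤ T.l := by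
  refine add_one_le_of_forall_lt hfin fun i hi hle => ?_
  have h1 := map_lengths_le_iff.1 hR.le i
  rw [hit_of_eq hi, ← hp i hi] at h1
  have h2 : ((i + 1 : ℕ) : ℕ∞) ≤ T.v := by
    push_cast
    rw [← hi]
    exact (add_le_add_left hT 1).trans hv
  have h3 := hA.fst i hle ((Nat.cast_lt.2 (Nat.lt_succ_self i)).trans_le h2)
  -- `Addable` tolerates one singular string of length `T.l' - 1`, but in that case `T'.l'` also
  -- equals `i` and the next removal would require two.
  by_cases h4 : T.l' = ((i + 1 : ℕ) : ℕ∞)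
  · rw [h4] at hl
    have h5 : T'.l' = i := le_antisymm (le_of_add_one_le_succ hl) (hi ▸ hT')
    rw [hit_of_eq h5] at h1
    rw [hit_of_eq h4] at h3
    omega
  · rw [hit_of_ne h4] at h3
    omega

end Selection

end Interlace

/-! ### Comparison of two successive letters in type `D` -/

namespace TypeD

variable {n t : ℕ} {e b m d : ℕ → ℕ∞} {nu : Rigged (Node n)} {p p' : Node n → ℕ → ℤ}

theorem selection_mk_of_le {a : ℕ} (ha : a ∈ Finset.Icc 1 n) (h : a ≤ n - 2) :
    selection e b ⟨a, ha⟩ = ⟨e (a - 1), e a, if a = n - 2 then min (e (n - 1)) (e n) else e (a + 1),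
      b (a + 1), b a, b (a - 1)⟩ := if_pos h

theorem selection_mk_of_lt {a : ℕ} (ha : a ∈ Finset.Icc 1 n) (h : n - 2 < a) :
    selection e b ⟨a, ha⟩ = ⟨e (n - 2), e a, b (n - 2), ⊤, ⊤, ⊤⟩ := if_neg (not_le.2 h)

theorem min_add_one_le {s s' u u' : ℕ∞} (h : s + 1 ≤ s') (h' : u + 1 ≤ u') :
    min s u + 1 ≤ min s' u' :=
  le_min ((add_le_add_left (min_le_left _ _) 1).trans h)
    ((add_le_add_left (min_le_right _ _) 1).trans h')

theorem max_add_one_le {s s' u u' : ℕ∞} (h : s + 1 ≤ s') (h' : u + 1 ≤ u') :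
    max s u + 1 ≤ max s' u' := by
  rcases le_total s u with h1 | h1
  · rw [max_eq_right h1]
    exact h'.trans (le_max_right _ _)
  · rw [max_eq_left h1]
    exact h.trans (le_max_left _ _)

/-- If the first selected length is large, then the next selected lengths are smaller. -/
theorem IsChain.add_one_le (hn : 4 ≤ n) (he : IsChain n e b) (hm : IsChain n m d)
    (hA : ∀ a, (selection e b a).Addable (nu a) (p a))
    (hR : ∀ a, (selection m d a).Removable (nu a) (p' a)) (ht : 1 ≤ t)
    (hp : ∀ a i, (a.1 = 1 → t ≤ i) → p a i = p' a i) (h1 : (t : ℕ∞) + 1 ≤ e 1) :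
    (∀ a, a ≤ n → 1 ≤ a → m a + 1 ≤ e a) ∧ ∀ a, a ≤ n - 2 → d a + 1 ≤ b a := by
  have hmem : ∀ {a}, 1 ≤ a → a ≤ n → a ∈ Finset.Icc 1 n := fun h h' => Finset.mem_Icc.2 ⟨h, h'⟩
  have hup : ∀ a, a ≤ n - 1 → 1 ≤ a → m a + 1 ≤ e a := by
    intro a ha h0
    induction a, h0 using Nat.le_induction with
    | base =>
      have h2 := (hA ⟨1, hmem le_rfl (by omega)⟩).fst_add_one_le (hR ⟨1, hmem le_rfl (by omega)⟩)
      rw [selection_mk_of_le _ (by omega), selection_mk_of_le _ (by omega)] at h2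
      -- The vacancy numbers `p` and `p'` may differ at node `1` below length `t`; the bound on `e
      -- 1` keeps the shortened strings out of that range.
      refine h2 (hm.zero ▸ le_rfl) ?_ fun i hi => hp _ _ fun _ => ?_
      · refine le_trans ?_ h1
        simp only [Nat.sub_self, hm.zero]
        gcongr
        exact_mod_cast ht
      · dsimp only at hi
        rw [hi] at h1
        exact_mod_cast le_of_add_one_le_succ h1
    | succ a h0 ih =>
      have h2 := (hA ⟨a + 1, hmem (by omega) (by omega)⟩).fst_add_one_le
        (hR ⟨a + 1, hmem (by omega) (by omega)⟩)
      have h3 := ih (by omega)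
      have h4 := he.up a (by omega)
      by_cases c : a + 1 ≤ n - 2
      · rw [selection_mk_of_le _ c, selection_mk_of_le _ c] at h2
        exact h2 (hm.one_le (by omega)) (h3.trans h4) fun i _ => hp _ _ fun h => by simp at h; omega
      · rw [selection_mk_of_lt _ (not_le.1 c), selection_mk_of_lt _ (not_le.1 c)] at h2
        obtain rfl : a = n - 2 := by omega
        exact h2 (hm.one_le (by omega)) (h3.trans h4) fun i _ => hp _ _ fun h => by simp at h; omega
  have hlast : m n + 1 ≤ e n := by
    have h2 := (hA ⟨n, hmem (by omega) le_rfl⟩).fst_add_one_le (hR ⟨n, hmem (by omega) le_rfl⟩)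
    rw [selection_mk_of_lt _ (by omega), selection_mk_of_lt _ (by omega)] at h2
    exact h2 (hm.one_le (by omega)) ((hup (n - 2) (by omega) (by omega)).trans he.fork)
      fun i _ => hp _ _ fun h => by simp only at h; omega
  have hall : ∀ a, a ≤ n → 1 ≤ a → m a + 1 ≤ e a := fun a ha h0 => by
    by_cases c : a = n
    · rw [c]
      exact hlast
    · exact hup a (by omega) h0
  have hdown : ∀ k a, a + k = n - 1 → 1 ≤ a → d a + 1 ≤ b a := by
    intro k
    induction k with
    | zero =>
      intro a ha _
      obtain rfl : a = n - 1 := by omega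
      rw [hm.turn, he.turn]
      exact max_add_one_le (hup _ le_rfl (by omega)) hlast
    | succ k ih =>
      intro a ha h0
      have h2 := (hA ⟨a, hmem h0 (by omega)⟩).snd_add_one_le (hR ⟨a, hmem h0 (by omega)⟩)
      rw [selection_mk_of_le _ (by omega), selection_mk_of_le _ (by omega)] at h2
      refine h2 ((hm.one_le (a := a) (by omega)).trans (hm.le_bar (by omega) (by omega)))
        (he.le_bar (by omega) (by omega))
        ((ih (a + 1) (by omega) (by omega)).trans (he.down a (by omega))) (hup a (by omega) h0)
        fun i hi => hp _ _ fun h => ?_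
      dsimp only at h hi
      have h3 := h1.trans ((he.up_le h0 (by omega)).trans (he.le_bar (c := a) (by omega) (by omega)))
      rw [hi] at h3
      exact_mod_cast le_of_add_one_le_succ h3
  refine ⟨hall, fun a ha => ?_⟩
  obtain rfl | h0 := Nat.eq_zero_or_pos a
  · rw [he.top]
    exact le_top
  · exact hdown (n - 1 - a) a (by omega) h0

/-- If the next selected lengths are finite wherever the selected lengths are, then they are
smaller. -/
theorem IsChain.add_one_le_of_fin (hn : 4 ≤ n) (he : IsChain n e b) (hm : IsChain n m d)
    (hA : ∀ a, (selection e b a).Addable (nu a) (p a))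
    (hR : ∀ a, (selection m d a).Removable (nu a) (p' a))
    (hp : ∀ a i, (a.1 = 1 → t ≤ i) → p a i = p' a i) (h1 : (t : ℕ∞) ≤ m 1)
    (hfin : ∀ a, a ≤ n → e a ≠ ⊤ → m a ≠ ⊤) (hfin' : ∀ a, a ≤ n - 2 → b a ≠ ⊤ → d a ≠ ⊤) :
    m 1 + 1 ≤ e 1 := by
  have hmem : ∀ {a}, 1 ≤ a → a ≤ n → a ∈ Finset.Icc 1 n := fun h h' => Finset.mem_Icc.2 ⟨h, h'⟩
  -- The comparison runs against the direction of selection, starting from `b 0 = ∞`.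
  have hdown : ∀ a, a ≤ n - 2 → d a + 1 ≤ b a := by
    intro a
    induction a with
    | zero =>
      intro _
      rw [he.top]
      exact le_top
    | succ a ih =>
      intro ha
      have h2 := (hA ⟨a + 1, hmem (by omega) (by omega)⟩).snd_add_one_le_of_fin
        (hR ⟨a + 1, hmem (by omega) (by omega)⟩)
      rw [selection_mk_of_le _ ha, selection_mk_of_le _ ha] at h2
      refine h2 (hm.down a (by omega)) (ih (by omega)) (hfin' _ ha)
        fun i hi => hp _ _ fun h => ?_
      dsimp only at hi
      have h3 := h1.trans (hm.le_bar (a := 1) (c := a + 1) (by omega) (by omega))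
      rw [hi] at h3
      exact_mod_cast h3
  have htop : ∀ a, a ≤ n → n - 2 < a → m a + 1 ≤ e a := by
    intro a ha h0
    have h2 := (hA ⟨a, hmem (by omega) ha⟩).fst_add_one_le_of_fin (hR ⟨a, hmem (by omega) ha⟩)
    rw [selection_mk_of_lt _ h0, selection_mk_of_lt _ h0] at h2
    refine h2 ?_ le_top (hdown _ le_rfl) le_top (hfin a ha) fun i _ => hp _ _ fun h => ?_
    · by_cases c : a = n
      · simp only [c]
        exact hm.last_le_bar (by omega)
      · exact hm.le_bar (by omega) (by omega)
    · dsimp only at h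
      omega
  have hup : ∀ k a, a + k = n - 2 → 1 ≤ a → m a + 1 ≤ e a := by
    intro k
    induction k with
    | zero =>
      intro a ha h0
      obtain rfl : a = n - 2 := by omega
      have h2 := (hA ⟨n - 2, hmem h0 (by omega)⟩).fst_add_one_le_of_fin
        (hR ⟨n - 2, hmem h0 (by omega)⟩)
      rw [selection_mk_of_le _ le_rfl, selection_mk_of_le _ le_rfl, if_pos rfl, if_pos rfl] at h2
      exact h2 (le_min (hm.up_le (by omega) (by omega)) hm.fork) (hm.le_bar (by omega) (by omega))
        (min_add_one_le (htop _ (by omega) (by omega)) (htop _ le_rfl (by omega)))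
        (hdown _ le_rfl) (hfin _ (by omega)) fun i _ => hp _ _ fun h => by simp only at h; omega
    | succ k ih =>
      intro a ha h0
      have h2 := (hA ⟨a, hmem h0 (by omega)⟩).fst_add_one_le_of_fin (hR ⟨a, hmem h0 (by omega)⟩)
      rw [selection_mk_of_le _ (by omega), selection_mk_of_le _ (by omega),
        if_neg (by omega), if_neg (by omega)] at h2
      refine h2 (hm.up a (by omega)) (hm.le_bar (by omega) (by omega))
        (ih (a + 1) (by omega) (by omega)) (hdown a (by omega)) (hfin a (by omega))
        fun i hi => hp _ _ fun h => ?_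
      dsimp only at h hi
      rw [← h, hi] at h1
      exact_mod_cast h1
  exact hup (n - 3) 1 (by omega) le_rfl

end TypeD

end PathRC

/-! ### Rows and the recursive relation in type `D` -/

namespace PathRC

open Selection

namespace TypeD

variable {n : ℕ}

theorem mult_cons (k : Index) (B : List Index) (a : Node n) :
    mult n (k :: B) a = if a.1 = 1 then k.s ::ₘ mult n B a else mult n B a := by
  unfold mult
  split_ifs <;> simp

theorem lhArray_mult_hat {h1 : 1 ≤ 1} (B : List Index) :
    lhArray (mult n (⟨1, h1⟩ :: B)) = mult n B := by
  funext a
  rw [lhArray, mult_cons]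
  by_cases ha : a.1 = 1
  · rw [if_pos ha, if_pos ha, Multiset.erase_cons_head]
  · rw [if_neg ha, if_neg ha]

theorem one_mem_mult_hat {h1 : 1 ≤ 1} (B : List Index) (a : Node n) (ha : a.1 = 1) :
    1 ∈ mult n (⟨1, h1⟩ :: B) a := by
  rw [mult_cons, if_pos ha]
  exact Multiset.mem_cons_self _ _

theorem trunc_mult_split {s : ℕ} {h1 h2 h3} {B : List Index} (a : Node n) (i : ℕ) :
    trunc (mult n (⟨1, h1⟩ :: ⟨s + 1, h2⟩ :: B) a) i =
      trunc (mult n (⟨s + 2, h3⟩ :: B) a) i + if a.1 = 1 ∧ 1 ≤ i ∧ i ≤ s + 1 then 1 else 0 := by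
  rw [mult_cons, mult_cons, mult_cons]
  by_cases ha : a.1 = 1
  · rw [if_pos ha, if_pos ha, if_pos ha, trunc_cons, trunc_cons, trunc_cons]
    simp only [ha, true_and]
    split_ifs <;> push_cast <;> omega
  · rw [if_neg ha, if_neg ha, if_neg ha, if_neg (fun h => ha h.1), add_zero]

theorem vac_split {s : ℕ} {h1 h2 h3} {B : List Index} {nu : Rigged (Node n)} (a : Node n) (i : ℕ)
    (hi : a.1 = 1 → s + 2 ≤ i) : vac (cartan n) (mult n (⟨1, h1⟩ :: ⟨s + 1, h2⟩ :: B)) nu a i =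
      vac (cartan n) (mult n (⟨s + 2, h3⟩ :: B)) nu a i := by
  simp only [vac]
  rw [vacancy_eq_trunc, vacancy_eq_trunc, trunc_mult_split (h3 := h3), if_neg, add_zero]
  rintro ⟨ha, -, h⟩
  have := hi ha
  omega

theorem isRC_ls_iff {s : ℕ} {h1 h2 h3} {B : List Index} {lam : Node n → ℕ} {nu : Rigged (Node n)}
    {r : Node n} (hr : r.1 = 1) : IsRC (cartan n) (mult n (⟨s + 2, h3⟩ :: B)) lam nu ↔
      IsRC (cartan n) (mult n (⟨1, h1⟩ :: ⟨s + 1, h2⟩ :: B)) lam nu ∧ ∀ i, i ≤ s + 1 →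
        (nu r).count (i, vac (cartan n) (mult n (⟨1, h1⟩ :: ⟨s + 1, h2⟩ :: B)) nu r i) = 0 := by
  refine isRC_split_iff (isCartan_cartan n) (fun a i => ?_) (one_mem_mult_hat _ _ hr)
  rw [trunc_mult_split (h3 := h3)]
  simp only [← hr, Subtype.ext_iff]

/-- The relation between paths and rigged configurations that is defined by removing letters. -/
def Rel : (B : List Index) → Path (Elt n) B → Rigged (Node n) → Prop
  | [], _, nu => nu = fun _ => 0
  | ⟨1, h1⟩ :: B, b, nu =>
    IsLetter (ellD (cartan n) (mult n (⟨1, h1⟩ :: B)) nu)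
        (ellBar (cartan n) (mult n (⟨1, h1⟩ :: B)) nu) (b.1.1 0) ∧
      Rel B b.2 (deltaD (cartan n) (mult n (⟨1, h1⟩ :: B)) nu)
  | ⟨s + 2, _⟩ :: B, b, nu =>
    Rel (⟨1, le_rfl⟩ :: ⟨s + 1, by omega⟩ :: B) ((Row.ls b.1).1, (Row.ls b.1).2, b.2) nu
  | ⟨0, h⟩ :: _, _, _ => absurd h (by omega)
termination_by B => (B.map fun k => 2 * k.s - 1).sum
decreasing_by
  all_goals simp only [List.map_cons, List.sum_cons]
  all_goals omega

theorem rel_nil {b : Path (Elt n) []} {nu : Rigged (Node n)} : Rel [] b nu ↔ nu = fun _ => 0 := by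
  rw [Rel]

theorem rel_hat {h1 : 1 ≤ 1} {B : List Index} {w : Row n 1} {b : Path (Elt n) B}
    {nu : Rigged (Node n)} : Rel (⟨1, h1⟩ :: B) (w, b) nu ↔
      IsLetter (ellD (cartan n) (mult n (⟨1, h1⟩ :: B)) nu)
        (ellBar (cartan n) (mult n (⟨1, h1⟩ :: B)) nu) (w.1 0) ∧
      Rel B b (deltaD (cartan n) (mult n (⟨1, h1⟩ :: B)) nu) :=
  Iff.of_eq (Rel.eq_2 ..)

theorem rel_ls {s : ℕ} {h1 : 1 ≤ 1} {h2 : 1 ≤ s + 1} {h3 : 1 ≤ s + 2} {B : List Index}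
    {w : Row n (s + 2)} {b : Path (Elt n) B} {nu : Rigged (Node n)} :
    Rel (⟨s + 2, h3⟩ :: B) (w, b) nu ↔
      Rel (⟨1, h1⟩ :: ⟨s + 1, h2⟩ :: B) (w.ls.1, w.ls.2, b) nu :=
  Iff.of_eq (Rel.eq_3 ..)

/-- At node `1` the selection starts from length one, so its value is the least length of any
singular string there. -/
theorem short_iff (hn : 4 ≤ n) {L : Node n → Multiset ℕ} {lam : Node n → ℕ}
    {nu : Rigged (Node n)} (h : IsRC (cartan n) L lam nu) {r : Node n} (hr : r.1 = 1) (t : ℕ) :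
    (∀ i, i ≤ t → (nu r).count (i, vac (cartan n) L nu r i) = 0) ↔
      (t : ℕ∞) + 1 ≤ ellD (cartan n) L nu 1 := by
  have h1 := removable_ellD hn (cartan n) L nu r
  rw [selection_of_le (by omega), hr] at h1
  constructor
  · intro hs
    refine Order.add_one_le_of_lt (not_le.1 fun hle => ?_)
    obtain ⟨i, hi⟩ := ENat.ne_top_iff_exists.1 (ne_top_of_le_ne_top (ENat.natCast_ne_top t) hle)
    have h2 := map_lengths_le_iff.1 h1.le i
    dsimp only at h2
    rw [hit_of_eq hi.symm, hs i (by rw [← hi] at hle; exact_mod_cast hle)] at h2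
    omega
  · intro hle i hi
    obtain rfl | h0 := Nat.eq_zero_or_pos i
    · rw [Multiset.count_eq_zero]
      intro hmem
      have := h.length_pos r _ hmem
      simp at this
    · refine h1.fst i ?_ (lt_of_lt_of_le ?_ hle)
      · simp only [Nat.sub_self, (isChain_ellD hn (cartan n) L nu).zero]
        exact_mod_cast h0
      · exact_mod_cast Nat.lt_succ_of_le hi

/-- The removal of the first letter of a row. -/
theorem exists_first_letter (hn : 4 ≤ n) {B : List Index} {b : Path (Elt n) B} {s : ℕ}
    {h2 : 1 ≤ s + 1} {w : Row n (s + 1)} {nu : Rigged (Node n)} {lam : Node n → ℕ}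
    (h : IsRC (cartan n) (mult n (⟨s + 1, h2⟩ :: B)) lam nu)
    (hrel : Rel (⟨s + 1, h2⟩ :: B) (w, b) nu) :
    ∃ (m d : ℕ → ℕ∞) (p : Node n → ℕ → ℤ), IsChain n m d ∧
      (∀ a, (selection m d a).Removable (nu a) (p a)) ∧
      (∀ a i, (a.1 = 1 → s + 1 ≤ i) →
        vac (cartan n) (mult n (⟨s + 1, h2⟩ :: B)) nu a i = p a i) ∧
      ((s + 1 : ℕ) : ℕ∞) ≤ m 1 ∧ IsLetter m d (w.1 0) := by
  obtain _ | s := s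
  · have hc := isChain_ellD hn (cartan n) (mult n (⟨1, h2⟩ :: B)) nu
    exact ⟨_, _, _, hc, removable_ellD hn _ _ nu, fun _ _ _ => rfl,
      by exact_mod_cast hc.one_le (a := 1) (by omega), (rel_hat.1 hrel).1⟩
  · have h' := (isRC_ls_iff (h1 := le_rfl) (h2 := by omega)
      (r := ⟨1, Finset.mem_Icc.2 ⟨le_rfl, by omega⟩⟩) rfl).1 h
    refine ⟨_, _, _, isChain_ellD hn _ _ nu, removable_ellD hn _ _ nu,
      fun a i hi => (vac_split a i hi).symm, ?_,
      (rel_hat.1 ((rel_ls (h1 := le_rfl) (h2 := by omega)).1 hrel)).1⟩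
    exact_mod_cast (short_iff hn h'.1 rfl (s + 1)).1 h'.2

/-- A letter and a row form a longer row if and only if the rigged configuration does not have
short singular strings. -/
theorem le_iff_isRC (hn : 4 ≤ n) {B : List Index} {b : Path (Elt n) B} {s : ℕ} {h1 : 1 ≤ 1}
    {h2 : 1 ≤ s + 1} {h3 : 1 ≤ s + 2} {w₁ : Row n 1} {w₂ : Row n (s + 1)} {nu : Rigged (Node n)}
    {lam : Node n → ℕ} (h : IsRC (cartan n) (mult n (⟨1, h1⟩ :: ⟨s + 1, h2⟩ :: B)) lam nu)
    (hrel : Rel (⟨1, h1⟩ :: ⟨s + 1, h2⟩ :: B) (w₁, w₂, b) nu) :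
    (w₁.1 0).Le (w₂.1 0) ↔ IsRC (cartan n) (mult n (⟨s + 2, h3⟩ :: B)) lam nu := by
  have hr : (1 : ℕ) ∈ Finset.Icc 1 n := Finset.mem_Icc.2 ⟨le_rfl, by omega⟩
  rw [isRC_ls_iff (h1 := h1) (h2 := h2) (r := ⟨1, hr⟩) rfl, short_iff hn h rfl]
  simp only [h, true_and]
  obtain ⟨hx, hrel⟩ := rel_hat.1 hrel
  have he := isChain_ellD hn (cartan n) (mult n (⟨1, h1⟩ :: ⟨s + 1, h2⟩ :: B)) nu
  have hA := addable_deltaD hn (one_mem_mult_hat _) h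
  obtain ⟨mu, hmu, -⟩ := exists_isRC_deltaD hn (one_mem_mult_hat _) h hx
  rw [lhArray_mult_hat] at hA hmu
  obtain ⟨m, d, p, hm, hR, hp, h4, hy⟩ := exists_first_letter hn hmu hrel
  rw [le_iff_fwd_bwd hn]
  constructor
  · rintro ⟨h5, h6⟩
    refine le_trans ?_ (he.add_one_le_of_fin hn hm hA hR hp h4
      (fun a ha hfin => (hy.fwd a ha).2 (h5 a ha ((hx.fwd a ha).1 hfin)))
      fun a ha hfin => (hy.bwd a ha).2 (h6 a ha ((hx.bwd a ha).1 hfin)))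
    gcongr
  · intro hle
    obtain ⟨h5, h6⟩ := he.add_one_le hn hm hA hR h2 hp hle
    have key : ∀ {x y : ℕ∞}, x + 1 ≤ y → y ≠ ⊤ → x ≠ ⊤ := fun hxy hy' hx' => by
      rw [hx', top_add, top_le_iff] at hxy
      exact hy' hxy
    refine ⟨fun a ha hf => (hy.fwd a ha).1 ?_, fun a ha hf =>
      (hy.bwd a ha).1 (key (h6 a ha) ((hx.bwd a ha).2 hf))⟩
    obtain rfl | h0 := Nat.eq_zero_or_pos a
    · rw [hm.zero]
      exact ENat.one_ne_top
    · exact key (h5 a ha h0) ((hx.fwd a ha).2 hf)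

/-! ### The bijection in type `D` -/

theorem bijective_entry {h1 : 1 ≤ 1} :
    Function.Bijective fun w : Elt n ⟨1, h1⟩ => w.1 (0 : Fin 1) := by
  constructor
  · intro w w' h
    refine Subtype.ext (funext fun i => ?_)
    obtain rfl : i = (0 : Fin 1) := Fin.ext (Nat.lt_one_iff.1 i.2)
    exact h
  · intro y
    exact ⟨⟨fun _ => y, fun (i : Fin 1) (j : Fin 1) hij =>
      absurd hij (by simp [Subsingleton.elim i j])⟩, rfl⟩

theorem ls_injective {s : ℕ} :
    Function.Injective (Row.ls : Row n (s + 1) → Row n 1 × Row n s) := by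
  intro w w' h
  obtain ⟨h1, h2⟩ := Prod.mk.inj h
  refine Subtype.ext (funext fun j => ?_)
  refine Fin.cases ?_ (fun j => ?_) j
  · exact congrFun (congrArg Subtype.val h1) 0
  · exact congrFun (congrArg Subtype.val h2) j

theorem le_trans_of_le {x y z : Letter n} (h : x.Le y) (h' : y.Le z) : x.Le z := by
  rcases h with rfl | h
  · exact h'
  · rcases h' with rfl | h'
    · exact Or.inr h
    · exact Or.inr (h.trans h')

theorem exists_ls_eq_iff {s : ℕ} {w₁ : Row n 1} {w₂ : Row n (s + 1)} :
    (∃ w : Row n (s + 2), w.ls = (w₁, w₂)) ↔ (w₁.1 0).Le (w₂.1 0) := by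
  constructor
  · rintro ⟨w, hw⟩
    obtain ⟨rfl, rfl⟩ := Prod.mk.inj hw
    exact w.2 _ _ (Fin.succ_pos _)
  · intro h
    have h0 : ∀ j, (w₁.1 0).Le (w₂.1 j) := fun j => by
      obtain rfl | hj := eq_or_ne j 0
      · exact h
      · exact le_trans_of_le h (w₂.2 _ _ (Fin.pos_iff_ne_zero.2 hj))
    refine ⟨⟨Fin.cons (w₁.1 0) w₂.1, fun i j => ?_⟩, ?_⟩
    · refine Fin.cases (fun hij => absurd hij (Fin.not_lt_zero _)) (fun j => ?_) j
      refine Fin.cases (fun _ => h0 j) (fun i hij => ?_) i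
      exact w₂.2 _ _ (Fin.succ_lt_succ_iff.1 hij)
    · refine Prod.ext (Subtype.ext (funext fun j => ?_)) rfl
      obtain rfl : j = 0 := Subsingleton.elim _ _
      rfl

theorem isRC_ls (hn : 4 ≤ n) {s : ℕ} {h1 : 1 ≤ 1} {h2 : 1 ≤ s + 1} {h3 : 1 ≤ s + 2}
    {B : List Index} {lam : Node n → ℕ} {nu : Rigged (Node n)}
    (h : IsRC (cartan n) (mult n (⟨s + 2, h3⟩ :: B)) lam nu) :
    IsRC (cartan n) (mult n (⟨1, h1⟩ :: ⟨s + 1, h2⟩ :: B)) lam nu :=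
  ((isRC_ls_iff (r := ⟨1, Finset.mem_Icc.2 ⟨le_rfl, by omega⟩⟩) rfl).1 h).1

/-- The cost of removing all letters of a tensor product. -/
def size (B : List Index) : ℕ := (B.map fun k => 2 * k.s - 1).sum

theorem size_hat {h1 : 1 ≤ 1} (B : List Index) : size B < size (⟨1, h1⟩ :: B) := by
  simp only [size, List.map_cons, List.sum_cons]
  omega

theorem size_ls {s : ℕ} {h1 : 1 ≤ 1} {h2 : 1 ≤ s + 1} {h3 : 1 ≤ s + 2} (B : List Index) :
    size (⟨1, h1⟩ :: ⟨s + 1, h2⟩ :: B) < size (⟨s + 2, h3⟩ :: B) := by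
  simp only [size, List.map_cons, List.sum_cons]
  omega

/-- Induction on tensor products along the maps `lh` and `ls`. -/
theorem split_induction {motive : List Index → Prop} (nil : motive [])
    (hat : ∀ h1 B, motive B → motive (⟨1, h1⟩ :: B))
    (ls : ∀ s h1 h2 h3 B, motive (⟨1, h1⟩ :: ⟨s + 1, h2⟩ :: B) → motive (⟨s + 2, h3⟩ :: B))
    (B : List Index) : motive B := by
  induction hN : size B using Nat.strong_induction_on generalizing B with
  | _ N ih =>
    subst hN
    match B with
    | [] => exact nil
    | ⟨1, h1⟩ :: B => exact hat h1 B (ih _ (size_hat B) B rfl)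
    | ⟨s + 2, h3⟩ :: B => exact ls s le_rfl (by omega) h3 B (ih _ (size_ls B) _ rfl)

theorem good (hn : 4 ≤ n) (B : List Index) :
    Good (letters n hn) (read n) (cartan n) (mult n) Rel B := by
  induction B using split_induction with
  | nil =>
    refine good_nil (funext fun a => ?_) (fun _ _ => rel_nil) fun c hc => sum_nonpos_of_cartan hn hc
    simp [mult]
  | hat h1 B ih =>
    refine ih.hat bijective_entry (Row.read_one (n := n))
      (delta := deltaD (cartan n) (mult n (⟨1, h1⟩ :: B)))
      (IsLet := fun nu => IsLetter (ellD (cartan n) (mult n (⟨1, h1⟩ :: B)) nu)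
        (ellBar (cartan n) (mult n (⟨1, h1⟩ :: B)) nu))
      (fun w b nu => rel_hat) (fun _ => (isChain_ellD hn _ _ _).exists_isLetter hn)
      (fun h h' => h.unique hn h') (fun h hy => ?_) (fun h h' h'' => ?_)
      fun h h' hy hy' heq => deltaD_injective hn (one_mem_mult_hat B) h h' hy hy' heq
    · have := exists_isRC_deltaD hn (one_mem_mult_hat B) h hy
      rwa [lhArray_mult_hat] at this
    · rw [← lhArray_mult_hat (h1 := h1) B] at h
      exact exists_deltaD_eq hn (one_mem_mult_hat B) h h' h''
  | ls s h1 h2 h3 B ih =>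
    refine ih.split (s := Row.ls) (g := id) Row.read_ls ls_injective
      Function.injective_id (fun w b nu => rel_ls) (isRC_ls hn) ?_
    intro lam rho w₁ w₂ b h hr
    refine (exists_ls_eq_iff.trans (le_iff_isRC hn (h3 := h3) h hr)).trans ?_
    simp

/-- A family of bijections with the required compatibilities satisfies the recursive relation. -/
theorem IsBijectionFamily.rel {hn : 4 ≤ n}
    {phi : ∀ (B : List Index) (lam : Node n → ℕ), P hn B lam → RCs n B lam}
    (h : IsBijectionFamily hn phi) (B : List Index) :
    ∀ (lam : Node n → ℕ) (b : P hn B lam), Rel B b.1 (phi B lam b).1 := by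
  induction B using split_induction with
  | nil =>
    rintro lam ⟨b, hb⟩
    obtain rfl := isHW_nil.1 hb
    exact rel_nil.2 h.empty
  | hat h1 B ih =>
    intro lam b
    have h4 := h.left_hat B lam b
    obtain ⟨y, hy⟩ := (isChain_ellD hn (cartan n) (mult n (⟨1, h1⟩ :: B))
      (phi _ lam b).1).exists_isLetter hn
    obtain ⟨mu, h5, h6, -⟩ := exists_isRC_deltaD hn (one_mem_mult_hat B) (phi _ lam b).2 hy
    rw [lhArray_mult_hat] at h5
    have h7 := (phi B (lh hn B lam b).1 (lh hn B lam b).2).2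
    rw [h4] at h7
    -- As in type `A`, the weight of the shortened path identifies the removed letter with the
    -- leftmost one.
    obtain rfl := letter_eq (read := read n) (k := ⟨1, h1⟩)
      (x := fun w => w.1 (0 : Fin 1)) (Row.read_one (n := n)) (letter_eq_of_wt hn)
      (fun w => ⟨_, Row.read_one (n := n) w⟩) b h5 h6 h7
    refine rel_hat.2 ⟨hy, ?_⟩
    rw [← h4]
    exact ih _ (lh hn B lam b).2
  | ls s h1 h2 h3 B ih =>
    intro lam b
    refine (rel_ls (h1 := h1) (h2 := h2)).2 ?_
    have h7 := h.left_split (s + 1) h2 B lam b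
    have h8 := ih lam (TypeD.ls hn h2 B lam b)
    rw [h7] at h8
    exact h8

theorem isBijectionFamily_map (hn : 4 ≤ n) :
    IsBijectionFamily hn fun B _ b => (good hn B).map b where
  bijective B lam := (good hn B).bijective_map lam
  empty := rel_nil.1 ((good hn []).rel_map (HW.empty (letters n hn) (read n)))
  left_hat B lam b := (good hn B).map_lh (good hn _) (fun w b nu => rel_hat) (fun h hy => by
    have := exists_isRC_deltaD hn (one_mem_mult_hat B) h hy
    rwa [lhArray_mult_hat] at this) _ b
  left_split s hs B lam b := by
    obtain ⟨s, rfl⟩ : ∃ t, s = t + 1 := ⟨s - 1, by omega⟩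
    exact (good hn (⟨s + 1 + 1, by omega⟩ :: B)).map_split
      (good hn (⟨1, le_rfl⟩ :: ⟨s + 1, hs⟩ :: B)) (s := Row.ls) (g := id)
      Row.read_ls (fun w b nu => rel_ls) (isRC_ls hn) b

theorem existsUnique_isBijectionFamily (hn : 4 ≤ n) :
    ∃! phi : (∀ (B : List Index) (lam : Node n → ℕ), P hn B lam → RCs n B lam),
      IsBijectionFamily hn phi := by
  refine ⟨_, isBijectionFamily_map hn, fun phi h => ?_⟩
  funext B lam b
  exact (Subtype.ext ((good hn B).eq_map b (phi B lam b).2 (h.rel B lam b))).symm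

end TypeD

end PathRC

/-- In type `A_n^{(1)}` (for tensor products of the `B^{r,s}`) and in type `D_n^{(1)}` (for tensor
products of the `B^{1,s}`) there is a unique family of bijections from paths to rigged
configurations with the prescribed compatibilities. -/
theorem mainTheorem6 :
    (∀ (n : ℕ) (hn : 1 ≤ n),
      ∃! phi : (∀ (B : List (PathRC.TypeA.Index n)) (lam : PathRC.Node n → ℕ),
          PathRC.TypeA.P n B lam → PathRC.TypeA.RCs n B lam),
        PathRC.TypeA.IsBijectionFamily hn phi) ∧
    (∀ (n : ℕ) (hn : 4 ≤ n),
      ∃! phi : (∀ (B : List PathRC.TypeD.Index) (lam : PathRC.Node n → ℕ),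
          PathRC.TypeD.P hn B lam → PathRC.TypeD.RCs n B lam),
        PathRC.TypeD.IsBijectionFamily hn phi) := by
  exact ⟨fun _ hn => PathRC.TypeA.existsUnique_isBijectionFamily hn,
    fun _ hn => PathRC.TypeD.existsUnique_isBijectionFamily hn⟩
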